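/- Let $m\ge 1$, $N\geq 1$ be integers, let $p>1$, $\gamma\in\mathbb R$, let $\Omega\subset\mathbb R^N$ be open and let $K\subset\mathbb R^N$ be an affine subspace of codimension $k\in\{1,\dots,N\}$ with $K\cap\Omega\ne\emptyset$. Put $d(x)=\mathrm{dist}(x,K)$ and suppose $d$ is bounded on $\Omega$. Let $X_1(t)=(1-\log t)^{-1}$ and $X_{i+1}(t)=X_1(X_i(t))$ for $t\in(0,1]$, $i\ge1$. Put $$a_i=\frac{k-\gamma-(m-2i)p}{p}\quad\Bigl(0\le i\le \bigl[\tfrac{m-1}2\bigr]\Bigr),\qquad b_j=\frac{pk-k+\gamma+(m-2j)p}{p}\quad\Bigl(1\le j\le \bigl[\tfrac m2\bigr]\Bigr),$$ assume that all the numbers $a_i,b_j$ are nonzero, and let $$|A(m,\gamma)|=\prod_i|a_i|^p\prod_j|b_j|^p,\qquad |B(m,\gamma)|=\frac{p-1}{2p}\,|A(m,\gamma)|\Bigl\{\sum_i a_i^{-2}+\sum_j b_j^{-2}\Bigr\},$$ where empty products are $1$ and empty sums are $0$. For odd $m$ read $|\Delta^{m/2}u|$ as $|\nabla\Delta^{(m-1)/2}u|$.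 Suppose that for some $D\ge\sup_\Omega d$, some integer $r\ge1$, some $\theta\in\mathbb R$ and some $C>0$ there holds $$\int_\Omega d^{-\gamma}|\Delta^{m/2}u|^p\,dx\ \ge\ |A(m,\gamma)|\int_\Omega d^{-\gamma-mp}|u|^p\,dx+|B(m,\gamma)|\sum_{i=1}^{r-1}\int_\Omega d^{-\gamma-mp}X_1^2\cdots X_i^2|u|^p\,dx+C\int_\Omega d^{-\gamma-mp}X_1^2\cdots X_{r-1}^2X_r^{\theta}|u|^p\,dx$$ for all real-valued $u\in C_c^\infty(\Omega\setminus K)$, where $X_j=X_j(d(x)/D)$. Then (i) $\theta\ge2$; (ii) if $\theta=2$ then $C\le|B(m,\gamma)|$. -/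

import Mathlib

open MeasureTheory
open scoped ContDiff

noncomputable section

namespace Rellich

/-- The iterated logarithmic functions `X₁(t) = (1 - log t)⁻¹`, `X_{i+1}(t) = X₁(X_i(t))`,
with the convention `X₀(t) = t`. They are only used for `t ∈ (0, 1]` and `i ≥ 1`; there
`0 < X_i(t) ≤ 1`. -/
def X : ℕ → ℝ → ℝ
  | 0, t => t
  | i + 1, t => (1 - Real.log (X i t))⁻¹

/-- The factor `(k - γ - (m - 2i)p) / p` of `A'(m, γ)`, for `0 ≤ i ≤ [(m-1)/2]`. -/
def factorA' (p γ : ℝ) (k m i : ℕ) : ℝ :=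
  ((k : ℝ) - γ - ((m : ℝ) - 2 * (i : ℝ)) * p) / p

/-- The factor `(pk - k + γ + (m - 2j)p) / p` of `A''(m, γ)`, for `1 ≤ j ≤ [m/2]`. -/
def factorA'' (p γ : ℝ) (k m j : ℕ) : ℝ :=
  (p * (k : ℝ) - (k : ℝ) + γ + ((m : ℝ) - 2 * (j : ℝ)) * p) / p

/-- `|A(m, γ)|`, the product of the `p`-th powers of the absolute values of all factors
(for `m ≥ 1`). The absolute values are taken inside because a real power of a negative number
has no meaning. -/
def absA (p γ : ℝ) (k m : ℕ) : ℝ :=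
  (∏ i ∈ Finset.range ((m - 1) / 2 + 1), |factorA' p γ k m i| ^ p) *
    ∏ j ∈ Finset.Icc 1 (m / 2), |factorA'' p γ k m j| ^ p

/-- `|B(m, γ)|`, meaningful when `p ≥ 1` and all factors are nonzero. -/
def absB (p γ : ℝ) (k m : ℕ) : ℝ :=
  (p - 1) / (2 * p) * absA p γ k m *
    ((∑ i ∈ Finset.range ((m - 1) / 2 + 1), (factorA' p γ k m i ^ 2)⁻¹) +
      ∑ j ∈ Finset.Icc 1 (m / 2), (factorA'' p γ k m j ^ 2)⁻¹)

/-- `|Δ^{m/2} u|`, read as `|∇ Δ^{(m-1)/2} u|` (Euclidean norm of the gradient) for odd `m`. -/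
def absLap {N : ℕ} (m : ℕ) (u : EuclideanSpace ℝ (Fin N) → ℝ) (x : EuclideanSpace ℝ (Fin N)) :
    ℝ :=
  if Even m then
    |(fun v : EuclideanSpace ℝ (Fin N) → ℝ => Laplacian.laplacian v)^[m / 2] u x|
  else
    ‖gradient
      ((fun v : EuclideanSpace ℝ (Fin N) → ℝ => Laplacian.laplacian v)^[(m - 1) / 2] u) x‖

/-- The distance function `d(x) = dist(x, K)`. -/
def dist {N : ℕ} (K : AffineSubspace ℝ (EuclideanSpace ℝ (Fin N)))
    (x : EuclideanSpace ℝ (Fin N)) : ℝ :=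
  Metric.infDist x (K : Set (EuclideanSpace ℝ (Fin N)))

/-- `u` is a real-valued function of class `C^∞_c(U)`. -/
def IsTest {N : ℕ} (U : Set (EuclideanSpace ℝ (Fin N))) (u : EuclideanSpace ℝ (Fin N) → ℝ) :
    Prop :=
  ContDiff ℝ ∞ u ∧ HasCompactSupport u ∧ tsupport u ⊆ U

/-- The improved Rellich inequality
`∫_Ω d^{-γ}|Δ^{m/2}u|^p ≥ |A| ∫_Ω d^{-γ-mp}|u|^p + |B| ∑_{i=1}^{r-1} ∫_Ω d^{-γ-mp}X₁²⋯X_i²|u|^p`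
`  + C ∫_Ω d^{-γ-mp}X₁²⋯X_{r-1}² X_r^θ |u|^p` with `X_j = X_j(d(x)/D)`, for the function `u`.
For a test function `u` supported in `Ω \ K` (and `D ≥ sup_Ω d`) all the integrands are continuous
with compact support in `Ω \ K`, so all the integrals converge. -/
def ImprovedRellichIneq {N : ℕ} (Ω : Set (EuclideanSpace ℝ (Fin N)))
    (K : AffineSubspace ℝ (EuclideanSpace ℝ (Fin N))) (k m r : ℕ) (p γ D θ C : ℝ)
    (u : EuclideanSpace ℝ (Fin N) → ℝ) : Prop :=
  absA p γ k m * (∫ x in Ω, dist K x ^ (-γ - (m : ℝ) * p) * |u x| ^ p)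
    + absB p γ k m * (∑ i ∈ Finset.Icc 1 (r - 1),
        ∫ x in Ω, dist K x ^ (-γ - (m : ℝ) * p)
          * (∏ j ∈ Finset.Icc 1 i, X j (dist K x / D) ^ 2) * |u x| ^ p)
    + C * (∫ x in Ω, dist K x ^ (-γ - (m : ℝ) * p)
        * (∏ j ∈ Finset.Icc 1 (r - 1), X j (dist K x / D) ^ 2)
        * X r (dist K x / D) ^ θ * |u x| ^ p)
  ≤ ∫ x in Ω, dist K x ^ (-γ) * absLap m u x ^ p

end Rellich

end

/-! The constants are tested on functions concentrating at K near a point x₀ of K ∩ Ω. Put σ =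
(mp+γ-k)/p, the exponent at which all the weights balance, and τ = 1 - log(d/D) = c - log d with c =
1 + log D. Then X_{i+1} = 1/L_i(τ), where L_0 = τ and L_{i+1} = 1 + log L_i. Take u = d^σ h(τ) φ,
with φ a cutoff depending only on the component along K. The Laplacian sends d^s h(τ) to d^{s-2}
(s-∂)(s+k-2-∂)h and has no cross term with φ. Hence |Δ^{m/2}u| is at most d^{σ-m} |Th| φ plus terms
with an extra factor d = e^{c-τ} (`absLap_radial_mul_le`), where T is a product of m operators c_i -
∂ and the c_i are, up to sign, the numbers a_i and b_j. Weights and volume element combine to dτ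
(`integral_normal_mul_tangential`), so everything reduces to estimating ∫|Th|^p dτ from above.

Write r+1 for the r of the theorem and put P = L_0⋯L_r, z_i = 1/(L_0⋯L_i), κ = z_0+⋯+z_r, so that P'
= κP. The profile is h = P^{1/p} v^n with v a cutoff in L_{r+1}/R and R → ∞. Every derivative of h
gains a factor 1/τ, so only the second order expansion of T matters. With W = h^p and e₁, e₂ the
elementary symmetric functions of the 1/c_i, |Th|^p ≤ |A| (W - e₁W' + e₂W'') + |A| p(p-1)/2
(e₁²-2e₂) W (h'/h)² + error, and e₁² - 2e₂ = Σ c_i^{-2}. Here W(h'/h)² = W'²/(p²W), and the Riccati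
identity κ' = -(κ²+Σz_i²)/2 gives W'²/W = 2(κW)' + Σz_i² W + cutoff error. The total derivatives
integrate to zero, and what is left is |A|∫W + |B| Σ_{i≤r} ∫z_i²W up to errors
(`exists_listOp_rpow_le`, `integral_fluxDeriv`).

The terms with |A| and those with i < r cancel against the assumed inequality, leaving C∫L_r^{2-θ}
z_r²W ≤ |B| J + error with J = ∫z_r²W. Since z_r²W = v^{np}/P and 1/P is the derivative of L_{r+1},
J ≥ R, while the errors are o(J). On the support L_r ≥ R, so θ < 2 would force C R^{2-θ} to stay
bounded; for θ = 2, division by J gives C ≤ |B| (`sharpness_of_integral_inequality`). -/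

namespace Rellich

/-! ### The Laplacian of a function of the distance times a tangential factor. -/

section Geometry

open Laplacian Filter Topology RealInnerProductSpace

set_option linter.unusedSectionVars false

variable {E : Type*} [NormedAddCommGroup E] [InnerProductSpace ℝ E] [FiniteDimensional ℝ E]

theorem two_le_infty : (2 : WithTop ℕ∞) ≤ ∞ :=
  WithTop.coe_le_coe.2 (le_top : (2 : ℕ∞) ≤ ⊤)

theorem laplacian_eq_sum_fderiv {ι : Type*} [Fintype ι] (b : OrthonormalBasis ι ℝ E) {f : E → ℝ}
    {x : E} (hf : ContDiffAt ℝ 2 f x) :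
    Δ f x = ∑ i, fderiv ℝ (fun y => fderiv ℝ f y (b i)) x (b i) := by
  rw [InnerProductSpace.laplacian_eq_iteratedFDeriv_orthonormalBasis f b]
  refine Finset.sum_congr rfl fun i _ => ?_
  rw [iteratedFDeriv_two_apply]
  have hd : DifferentiableAt ℝ (fderiv ℝ f) x :=
    (hf.fderiv_right (m := 1) (by norm_num)).differentiableAt (by norm_num)
  simp [fderiv_clm_apply hd (differentiableAt_const _)]

theorem contDiff_laplacian {f : E → ℝ} (hf : ContDiff ℝ ∞ f) : ContDiff ℝ ∞ (Δ f) := by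
  have : Δ f = fun x => ∑ i, fderiv ℝ (fun y => fderiv ℝ f y (stdOrthonormalBasis ℝ E i)) x
      (stdOrthonormalBasis ℝ E i) := by
    ext x
    exact laplacian_eq_sum_fderiv _ ((hf.of_le two_le_infty).contDiffAt)
  rw [this]
  refine ContDiff.sum fun i _ => ?_
  have h1 : ContDiff ℝ ∞ (fun y => fderiv ℝ f y (stdOrthonormalBasis ℝ E i)) :=
    (hf.fderiv_right (m := ∞) (by simp)).clm_apply contDiff_const
  exact (h1.fderiv_right (m := ∞) (by simp)).clm_apply contDiff_const

theorem contDiff_iterate_laplacian {f : E → ℝ} (hf : ContDiff ℝ ∞ f) (j : ℕ) :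
    ContDiff ℝ ∞ ((fun v : E → ℝ => Δ v)^[j] f) := by
  induction j with
  | zero => simpa
  | succ j ih => rw [Function.iterate_succ_apply']; exact contDiff_laplacian ih

theorem iterate_laplacian_eventuallyEq {f g : E → ℝ} {x : E} (h : f =ᶠ[𝓝 x] g) (j : ℕ) :
    (fun v : E → ℝ => Δ v)^[j] f =ᶠ[𝓝 x] (fun v : E → ℝ => Δ v)^[j] g := by
  induction j with
  | zero => simpa
  | succ j ih =>
    rw [Function.iterate_succ_apply', Function.iterate_succ_apply']
    exact InnerProductSpace.laplacian_congr_nhds ih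

theorem iterate_laplacian_zero (j : ℕ) :
    (fun v : E → ℝ => Δ v)^[j] (0 : E → ℝ) = 0 := by
  induction j with
  | zero => rfl
  | succ j ih =>
    rw [Function.iterate_succ_apply', ih]
    exact InnerProductSpace.laplacian_const (c := (0 : ℝ))

theorem iterate_laplacian_eventuallyEq_zero {f : E → ℝ} {x : E} (h : f =ᶠ[𝓝 x] 0) (j : ℕ) :
    (fun v : E → ℝ => Δ v)^[j] f =ᶠ[𝓝 x] 0 := by
  simpa [iterate_laplacian_zero] using iterate_laplacian_eventuallyEq h j

variable (W : Submodule ℝ E) (x₀ : E)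

/-- The logarithm of the distance to the affine subspace `x₀ + Wᗮ`. -/
noncomputable def logDist (x : E) : ℝ := Real.log ‖W.starProjection (x - x₀)‖

theorem hasFDerivAt_logDist {x : E} (hx : W.starProjection (x - x₀) ≠ 0) :
    HasFDerivAt (logDist W x₀)
      ((‖W.starProjection (x - x₀)‖ ^ 2)⁻¹ • innerSL ℝ (W.starProjection (x - x₀))) x := by
  have h1 : HasFDerivAt (fun y : E => W.starProjection (y - x₀)) W.starProjection x :=
    W.starProjection.hasFDerivAt.comp x ((hasFDerivAt_id x).sub_const x₀)
  have h2 := (h1.norm_sq).log (by positivity)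
  have h3 : logDist W x₀ = fun y => (1 / 2 : ℝ) * Real.log (‖W.starProjection (y - x₀)‖ ^ 2) := by
    ext y; simp [logDist]
  rw [h3]
  refine (h2.const_mul (1 / 2 : ℝ)).congr_fderiv ?_
  ext v
  have : ⟪W.starProjection (x - x₀), W.starProjection v⟫ = ⟪W.starProjection (x - x₀), v⟫ := by
    rw [← Submodule.inner_starProjection_left_eq_right,
      Submodule.starProjection_eq_self_iff.2 (W.starProjection_apply_mem _)]
  simp only [smul_apply, innerSL_apply_apply, ContinuousLinearMap.comp_apply,
    smul_eq_mul, this, nsmul_eq_mul]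
  push_cast
  ring

theorem contDiffAt_logDist {x : E} (hx : W.starProjection (x - x₀) ≠ 0) :
    ContDiffAt ℝ ∞ (logDist W x₀) x := by
  have h1 : ContDiffAt ℝ ∞ (fun y : E => W.starProjection (y - x₀)) x := by fun_prop
  exact (h1.norm ℝ hx).log (norm_ne_zero_iff.2 hx)

theorem eventually_starProjection_sub_ne_zero {x : E} (hx : W.starProjection (x - x₀) ≠ 0) :
    ∀ᶠ y in 𝓝 x, W.starProjection (y - x₀) ≠ 0 := by
  have : ContinuousAt (fun y : E => W.starProjection (y - x₀)) x := by fun_prop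
  exact this.eventually_ne hx

/-- A function is constant along the directions of `W`. -/
def ConstAlong (φ : E → ℝ) : Prop := ∀ x, ∀ v ∈ W, φ (x + v) = φ x

variable {W x₀}

theorem ConstAlong.fderiv_apply {φ : E → ℝ} (h : ConstAlong W φ) (hφ : Differentiable ℝ φ) (x : E)
    {v : E} (hv : v ∈ W) : fderiv ℝ φ x v = 0 := by
  have h1 : HasDerivAt (fun t : ℝ => φ (x + t • v)) (fderiv ℝ φ x v) 0 := by
    have h2 : HasDerivAt (fun t : ℝ => x + t • v) v 0 := by
      simpa using ((hasDerivAt_id (0 : ℝ)).smul_const v).const_add x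
    have h3 : HasFDerivAt φ (fderiv ℝ φ x) (x + (0 : ℝ) • v) := by
      simpa using (hφ x).hasFDerivAt
    exact h3.comp_hasDerivAt (0 : ℝ) h2
  have h4 : (fun t : ℝ => φ (x + t • v)) = fun _ => φ x := by
    ext t; exact h x _ (W.smul_mem t hv)
  rw [h4] at h1
  exact h1.unique (hasDerivAt_const _ _)

theorem ConstAlong.laplacian {φ : E → ℝ} (h : ConstAlong W φ) : ConstAlong W (Δ φ) := by
  intro x v hv
  have h1 : φ = fun y => φ (y + v) := by ext y; exact (h y v hv).symm
  rw [InnerProductSpace.laplacian_eq_iteratedFDeriv_stdOrthonormalBasis]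
  simp only
  conv_rhs => rw [h1]
  simp only [iteratedFDeriv_comp_add_right]

theorem ConstAlong.iterate_laplacian {φ : E → ℝ} (h : ConstAlong W φ) (j : ℕ) :
    ConstAlong W ((fun v : E → ℝ => Δ v)^[j] φ) := by
  induction j with
  | zero => simpa
  | succ j ih => rw [Function.iterate_succ_apply']; exact ih.laplacian

/-- Both sides are the trace of the projection onto `W`, read once in an orthonormal basis and once
as the rank of an idempotent. -/
theorem sum_inner_starProjection {ι : Type*} [Fintype ι] (b : OrthonormalBasis ι ℝ E) :
    ∑ i, ⟪b i, W.starProjection (b i)⟫ = (Module.finrank ℝ W : ℝ) := by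
  rw [← LinearMap.IsProj.trace (p := W) (f := (W.starProjection : E →ₗ[ℝ] E))]
  · rw [LinearMap.trace_eq_sum_inner _ b]; rfl
  · exact ⟨fun x => W.starProjection_apply_mem x,
      fun x hx => Submodule.starProjection_eq_self_iff.2 hx⟩

theorem fderiv_radial_mul {f : ℝ → ℝ} {φ : E → ℝ} (hf : Differentiable ℝ f)
    (hφ : Differentiable ℝ φ) {x : E} (hx : W.starProjection (x - x₀) ≠ 0) (v : E) :
    fderiv ℝ (fun y => f (logDist W x₀ y) * φ y) x v =
      deriv f (logDist W x₀ x) * φ x *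
        ((‖W.starProjection (x - x₀)‖ ^ 2)⁻¹ * ⟪W.starProjection (x - x₀), v⟫) +
      f (logDist W x₀ x) * fderiv ℝ φ x v := by
  have h1 := (hf (logDist W x₀ x)).hasDerivAt.comp_hasFDerivAt x (hasFDerivAt_logDist W x₀ hx)
  have h2 := h1.mul (hφ x).hasFDerivAt
  have h3 : HasFDerivAt (fun y => f (logDist W x₀ y) * φ y) _ x := h2
  rw [h3.fderiv]
  simp [-map_sub]
  ring

/-- The gradient of `f (log d)` points in a direction of `W`, along which `φ` is constant, so the
product rule has no cross term. The radial part is the Laplacian in dimension dim `W`, written in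
the variable log d. -/
theorem laplacian_radial_mul {f : ℝ → ℝ} {φ : E → ℝ} (hf : ContDiff ℝ ∞ f)
    (hφ : ContDiff ℝ ∞ φ) (hφW : ConstAlong W φ) {x : E} (hx : W.starProjection (x - x₀) ≠ 0) :
    Δ (fun y => f (logDist W x₀ y) * φ y) x =
      Real.exp (-2 * logDist W x₀ x) * (deriv (deriv f) (logDist W x₀ x) +
        ((Module.finrank ℝ W : ℝ) - 2) * deriv f (logDist W x₀ x)) * φ x +
      f (logDist W x₀ x) * Δ φ x := by
  have hfd : Differentiable ℝ f := hf.differentiable (by simp)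
  have hφd : Differentiable ℝ φ := hφ.differentiable (by simp)
  have hf' : ContDiff ℝ ∞ (deriv f) := ((contDiff_infty_iff_deriv (𝕜 := ℝ)).1 hf).2
  have hfd' : Differentiable ℝ (deriv f) := hf'.differentiable (by simp)
  set b := stdOrthonormalBasis ℝ E
  set q : E → ℝ := fun y => ‖W.starProjection (y - x₀)‖ ^ 2 with hq
  have hqx : q x ≠ 0 := by simpa [hq] using hx
  have hcd : ContDiffAt ℝ 2 (fun y => f (logDist W x₀ y) * φ y) x :=
    ((hf.contDiffAt.comp x (contDiffAt_logDist W x₀ hx)).mul hφ.contDiffAt).of_le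
      two_le_infty
  rw [laplacian_eq_sum_fderiv b hcd,
    laplacian_eq_sum_fderiv b ((hφ.of_le two_le_infty).contDiffAt)]
  have key : ∀ v : E, fderiv ℝ (fun y => fderiv ℝ (fun y => f (logDist W x₀ y) * φ y) y v) x v =
      (deriv (deriv f) (logDist W x₀ x) - 2 * deriv f (logDist W x₀ x)) * φ x * ((q x)⁻¹ ^ 2) *
        ⟪W.starProjection (x - x₀), v⟫ ^ 2
      + 2 * deriv f (logDist W x₀ x) * (q x)⁻¹ *
        (fderiv ℝ φ x v * ⟪W.starProjection (x - x₀), v⟫)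
      + deriv f (logDist W x₀ x) * φ x * (q x)⁻¹ * ⟪v, W.starProjection v⟫
      + f (logDist W x₀ x) * fderiv ℝ (fun y => fderiv ℝ φ y v) x v := by
    intro v
    have hev : (fun y => fderiv ℝ (fun y => f (logDist W x₀ y) * φ y) y v) =ᶠ[𝓝 x]
        fun y => deriv f (logDist W x₀ y) * φ y *
          ((q y)⁻¹ * ⟪W.starProjection (y - x₀), v⟫) + f (logDist W x₀ y) * fderiv ℝ φ y v := by
      filter_upwards [eventually_starProjection_sub_ne_zero W x₀ hx] with y hy
      exact fderiv_radial_mul hfd hφd hy v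
    rw [hev.fderiv_eq]
    have hqx' : ‖W.starProjection (x - x₀)‖ ^ 2 = q x := rfl
    have hl := hasFDerivAt_logDist W x₀ hx
    have h1 : HasFDerivAt (fun y : E => W.starProjection (y - x₀)) W.starProjection x :=
      W.starProjection.hasFDerivAt.comp x ((hasFDerivAt_id x).sub_const x₀)
    have e1 := (hfd' (logDist W x₀ x)).hasDerivAt.comp_hasFDerivAt x hl
    have e0 := (hfd (logDist W x₀ x)).hasDerivAt.comp_hasFDerivAt x hl
    have eφ := (hφd x).hasFDerivAt
    have eq' : HasFDerivAt (fun y => (q y)⁻¹) _ x :=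
      (hasDerivAt_inv hqx).comp_hasFDerivAt x h1.norm_sq
    have ei := h1.inner ℝ (hasFDerivAt_const v x)
    have eφ' : HasFDerivAt (fun y => fderiv ℝ φ y v) (fderiv ℝ (fun y => fderiv ℝ φ y v) x) x :=
      (((hφ.fderiv_right (m := ∞) (by simp)).clm_apply contDiff_const).differentiable
        (by simp) x).hasFDerivAt
    have tot := ((e1.mul eφ).mul (eq'.mul ei)).add (e0.mul eφ')
    have tot' : HasFDerivAt (fun y => deriv f (logDist W x₀ y) * φ y *
          ((q y)⁻¹ * ⟪W.starProjection (y - x₀), v⟫) + f (logDist W x₀ y) * fderiv ℝ φ y v) _ x :=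
      tot
    rw [tot'.fderiv]
    have hs : ⟪W.starProjection (x - x₀), W.starProjection v⟫ = ⟪W.starProjection (x - x₀), v⟫ := by
      rw [← Submodule.inner_starProjection_left_eq_right,
        Submodule.starProjection_eq_self_iff.2 (W.starProjection_apply_mem _)]
    have hs2 : ⟪W.starProjection v, v⟫ = ⟪v, W.starProjection v⟫ := real_inner_comm _ _
    simp only [hqx']
    simp [-map_sub, hs, hs2, fderivInnerCLM_apply]
    field_simp
    ring
  simp only [key, Finset.sum_add_distrib, ← Finset.mul_sum]
  have s1 : ∑ i, ⟪W.starProjection (x - x₀), b i⟫ ^ 2 = q x := by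
    have := b.sum_sq_inner_left (W.starProjection (x - x₀))
    simpa [hq] using this
  have s2 : ∑ i, fderiv ℝ φ x (b i) * ⟪W.starProjection (x - x₀), b i⟫ = 0 := by
    have h := hφW.fderiv_apply hφd x (W.starProjection_apply_mem (x - x₀))
    rw [← b.sum_repr' (W.starProjection (x - x₀)), map_sum] at h
    rw [← h]
    refine Finset.sum_congr rfl fun i _ => ?_
    rw [map_smul, smul_eq_mul, real_inner_comm, mul_comm]
  have s3 := sum_inner_starProjection (W := W) b
  have hexp : Real.exp (-2 * logDist W x₀ x) = (q x)⁻¹ := by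
    rw [show -2 * logDist W x₀ x = -(logDist W x₀ x + logDist W x₀ x) by ring, Real.exp_neg,
      Real.exp_add, logDist, Real.exp_log (norm_pos_iff.2 hx)]
    simp [hq, sq]
  rw [s1, s2, s3, hexp]
  field_simp
  ring

end Geometry

/-! ### Iterated Laplacians as products of first order operators in the logarithmic variable. -/

section Operators

open Laplacian Filter Topology RealInnerProductSpace

/-- The first order operator `c - d/dτ`. -/
noncomputable def stepOp (c : ℝ) (h : ℝ → ℝ) : ℝ → ℝ := fun τ => c * h τ - deriv h τ

/-- The operator by which `Δ^j` acts on the profile `h` of `d^σ h(log(1/d))`. -/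
noncomputable def evenOp (σ : ℝ) (k : ℕ) : ℕ → (ℝ → ℝ) → ℝ → ℝ
  | 0, h => h
  | j + 1, h => stepOp (σ - 2 * j) (stepOp (σ + k - 2 - 2 * j) (evenOp σ k j h))

/-- The operator by which `Δ^{m/2}` acts on the profile `h` of `d^σ h(log(1/d))`. -/
noncomputable def lapOp (σ : ℝ) (k m : ℕ) (h : ℝ → ℝ) : ℝ → ℝ :=
  if Even m then evenOp σ k (m / 2) h
  else stepOp (σ - 2 * ((m - 1) / 2 : ℕ)) (evenOp σ k ((m - 1) / 2) h)

theorem contDiff_stepOp {h : ℝ → ℝ} (hh : ContDiff ℝ ∞ h) (c : ℝ) : ContDiff ℝ ∞ (stepOp c h) :=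
  (contDiff_const.mul hh).sub ((contDiff_infty_iff_deriv (𝕜 := ℝ)).1 hh).2

theorem contDiff_evenOp {h : ℝ → ℝ} (hh : ContDiff ℝ ∞ h) (σ : ℝ) (k j : ℕ) :
    ContDiff ℝ ∞ (evenOp σ k j h) := by
  induction j with
  | zero => exact hh
  | succ j ih => exact contDiff_stepOp (contDiff_stepOp ih _) _

/-- The function `d^s h(c - log d)` in terms of `ρ = log d`. -/
noncomputable def radial (c s : ℝ) (h : ℝ → ℝ) (ρ : ℝ) : ℝ := Real.exp (s * ρ) * h (c - ρ)

theorem contDiff_radial {h : ℝ → ℝ} (hh : ContDiff ℝ ∞ h) (c s : ℝ) :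
    ContDiff ℝ ∞ (radial c s h) :=
  (contDiff_const.mul contDiff_id).exp.mul (hh.comp (contDiff_const.sub contDiff_id))

theorem deriv_radial {h : ℝ → ℝ} (hh : Differentiable ℝ h) (c s : ℝ) :
    deriv (radial c s h) = radial c s (stepOp s h) := by
  ext ρ
  have h1 : HasDerivAt (fun ρ : ℝ => Real.exp (s * ρ)) (Real.exp (s * ρ) * (s * 1)) ρ :=
    ((hasDerivAt_id ρ).const_mul s).exp
  have h2 : HasDerivAt (fun ρ : ℝ => h (c - ρ)) (deriv h (c - ρ) * (-1)) ρ :=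
    HasDerivAt.comp ρ (hh (c - ρ)).hasDerivAt ((hasDerivAt_id ρ).const_sub c)
  have h3 : HasDerivAt (radial c s h) _ ρ := h1.mul h2
  rw [h3.deriv, radial, stepOp]
  ring

/-- Differentiation in ρ turns the profile `h` into `s * h - h'`. Hence ∂_ρ² + (k-2)∂_ρ = ∂_ρ(∂_ρ +
k - 2) becomes a product of two operators `stepOp`. -/
theorem radial_laplacian {h : ℝ → ℝ} (hh : ContDiff ℝ ∞ h) (c s : ℝ) (k : ℝ) (ρ : ℝ) :
    Real.exp (-2 * ρ) * (deriv (deriv (radial c s h)) ρ + (k - 2) * deriv (radial c s h) ρ) =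
      radial c (s - 2) (stepOp s (stepOp (s + k - 2) h)) ρ := by
  have hd : Differentiable ℝ h := hh.differentiable (by simp)
  have hd' : Differentiable ℝ (deriv h) :=
    ((contDiff_infty_iff_deriv (𝕜 := ℝ)).1 hh).2.differentiable (by simp)
  have e : ∀ b τ, deriv (stepOp b h) τ = b * deriv h τ - deriv (deriv h) τ := by
    intro b τ
    exact (((hd τ).hasDerivAt.const_mul b).sub (hd' τ).hasDerivAt).deriv
  rw [deriv_radial hd, deriv_radial ((contDiff_stepOp hh s).differentiable (by simp))]
  simp only [radial, stepOp.eq_1 s, e]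
  rw [show (s - 2) * ρ = -2 * ρ + s * ρ by ring, Real.exp_add]
  simp only [stepOp]
  ring

variable {E : Type*} [NormedAddCommGroup E] [InnerProductSpace ℝ E] [FiniteDimensional ℝ E]
  {W : Submodule ℝ E} {x₀ : E}

theorem contDiffAt_radial_mul {f : ℝ → ℝ} {φ : E → ℝ} (hf : ContDiff ℝ ∞ f)
    (hφ : ContDiff ℝ ∞ φ) {x : E} (hx : W.starProjection (x - x₀) ≠ 0) :
    ContDiffAt ℝ ∞ (fun y => f (logDist W x₀ y) * φ y) x :=
  (hf.contDiffAt.comp x (contDiffAt_logDist W x₀ hx)).mul hφ.contDiffAt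

theorem laplacian_finset_sum {ι : Type*} (s : Finset ι) (a : ι → ℝ) (f : ι → E → ℝ) {x : E}
    (hf : ∀ i ∈ s, ContDiffAt ℝ 2 (f i) x) :
    Δ (fun y => ∑ i ∈ s, a i * f i y) x = ∑ i ∈ s, a i * Δ (f i) x := by
  classical
  induction s using Finset.induction_on with
  | empty => simp
  | insert i s hi ih =>
    simp only [Finset.sum_insert hi]
    have h1 : ContDiffAt ℝ 2 (a i • f i) x :=
      contDiffAt_const.smul (hf i (Finset.mem_insert_self _ _))
    have h2 : ContDiffAt ℝ 2 (fun y => ∑ j ∈ s, a j * f j y) x :=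
      ContDiffAt.sum fun j hj => contDiffAt_const.mul (hf j (Finset.mem_insert_of_mem hj))
    have h3 := h1.laplacian_add h2
    rw [InnerProductSpace.laplacian_smul (a i) (hf i (Finset.mem_insert_self _ _)),
      ih fun j hj => hf j (Finset.mem_insert_of_mem hj)] at h3
    exact h3

/-- Each Laplacian falls either on the radial or on the tangential factor. There are never cross
terms, because the iterated Laplacians of `φ` stay constant along `W`; Pascal's rule then gives a
binomial formula. -/
theorem iterate_laplacian_radial_mul {h : ℝ → ℝ} {φ : E → ℝ} (hh : ContDiff ℝ ∞ h)
    (hφ : ContDiff ℝ ∞ φ) (hφW : ConstAlong W φ) (c σ : ℝ) (j : ℕ) {x : E}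
    (hx : W.starProjection (x - x₀) ≠ 0) :
    (fun v : E → ℝ => Δ v)^[j] (fun y => radial c σ h (logDist W x₀ y) * φ y) x =
      ∑ ij ∈ Finset.HasAntidiagonal.antidiagonal j, (j.choose ij.1 : ℝ) *
        (radial c (σ - 2 * ij.1) (evenOp σ (Module.finrank ℝ W) ij.1 h) (logDist W x₀ x) *
          (fun v : E → ℝ => Δ v)^[ij.2] φ x) := by
  induction j generalizing x with
  | zero => simp [evenOp]
  | succ j ih =>
    rw [Function.iterate_succ_apply', Finset.sum_antidiagonal_choose_succ_mul (fun i l =>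
      radial c (σ - 2 * i) (evenOp σ (Module.finrank ℝ W) i h) (logDist W x₀ x) *
          (fun v : E → ℝ => Δ v)^[l] φ x)]
    have hev : (fun v : E → ℝ => Δ v)^[j] (fun y => radial c σ h (logDist W x₀ y) * φ y) =ᶠ[𝓝 x]
        fun y => ∑ ij ∈ Finset.HasAntidiagonal.antidiagonal j, (j.choose ij.1 : ℝ) *
        (radial c (σ - 2 * ij.1) (evenOp σ (Module.finrank ℝ W) ij.1 h) (logDist W x₀ y) *
          (fun v : E → ℝ => Δ v)^[ij.2] φ y) := by
      filter_upwards [eventually_starProjection_sub_ne_zero W x₀ hx] with y hy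
      exact ih hy
    have hL := (InnerProductSpace.laplacian_congr_nhds hev).eq_of_nhds
    rw [hL, laplacian_finset_sum]
    · rw [← Finset.sum_add_distrib]
      refine Finset.sum_congr rfl fun ij hij => ?_
      rw [laplacian_radial_mul (contDiff_radial (contDiff_evenOp hh _ _ _) _ _)
        (contDiff_iterate_laplacian hφ _) (hφW.iterate_laplacian _) hx,
        radial_laplacian (contDiff_evenOp hh _ _ _), Function.iterate_succ_apply',
        evenOp, Nat.choose_symm_of_eq_add (Finset.HasAntidiagonal.mem_antidiagonal.1 hij).symm]
      push_cast
      rw [show σ - 2 * (ij.1 : ℝ) - 2 = σ - 2 * ((ij.1 : ℝ) + 1) by ring,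
        show σ - 2 * (ij.1 : ℝ) + (Module.finrank ℝ W : ℝ) - 2 =
          σ + (Module.finrank ℝ W : ℝ) - 2 - 2 * (ij.1 : ℝ) by ring]
      ring
    · intro ij _
      exact (contDiffAt_radial_mul (contDiff_radial (contDiff_evenOp hh _ _ _) _ _)
        (contDiff_iterate_laplacian hφ _) hx).of_le two_le_infty

theorem norm_fderiv_logDist {x : E} (hx : W.starProjection (x - x₀) ≠ 0) :
    ‖(‖W.starProjection (x - x₀)‖ ^ 2)⁻¹ • innerSL ℝ (W.starProjection (x - x₀))‖ =
      Real.exp (-logDist W x₀ x) := by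
  have h := norm_pos_iff.2 hx
  rw [norm_smul, innerSL_apply_norm, Real.exp_neg, logDist, Real.exp_log h, norm_inv, norm_pow,
    norm_norm]
  field_simp

theorem hasFDerivAt_radial_mul {f : ℝ → ℝ} {φ : E → ℝ} (hf : ContDiff ℝ ∞ f)
    (hφ : ContDiff ℝ ∞ φ) {x : E} (hx : W.starProjection (x - x₀) ≠ 0) :
    HasFDerivAt (fun y => f (logDist W x₀ y) * φ y)
      ((φ x * deriv f (logDist W x₀ x)) •
        ((‖W.starProjection (x - x₀)‖ ^ 2)⁻¹ • innerSL ℝ (W.starProjection (x - x₀))) +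
        f (logDist W x₀ x) • fderiv ℝ φ x) x := by
  have h1 := ((hf.differentiable (by simp)) (logDist W x₀ x)).hasDerivAt.comp_hasFDerivAt x
    (hasFDerivAt_logDist W x₀ hx)
  have h2 := h1.mul ((hφ.differentiable (by simp)) x).hasFDerivAt
  refine h2.congr_fderiv ?_
  rw [mul_smul, add_comm]
  rfl

/-- Here e^ρ = d ≤ 1: a term in which fewer derivatives hit the power of the distance is smaller by
at least one factor d. -/
theorem exp_sub_mul_le {σ ρ : ℝ} (hρ : ρ ≤ 0) {i j : ℕ} (h : i + 1 ≤ j) :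
    Real.exp ((σ - i) * ρ) ≤ Real.exp ((σ - j) * ρ) * Real.exp ρ := by
  rw [← Real.exp_add, Real.exp_le_exp]
  have : (i : ℝ) + 1 ≤ j := by exact_mod_cast h
  nlinarith

/-- On a radial profile times a tangential cutoff, `Δ^{m/2}` acts through `lapOp` up to terms of
lower order in the distance. -/
theorem absLap_radial_mul_le {N : ℕ} {W : Submodule ℝ (EuclideanSpace ℝ (Fin N))}
    {x₀ x : EuclideanSpace ℝ (Fin N)} {h : ℝ → ℝ} {φ : EuclideanSpace ℝ (Fin N) → ℝ}
    (hh : ContDiff ℝ ∞ h) (hφ : ContDiff ℝ ∞ φ) (hφW : ConstAlong W φ) (c σ : ℝ) (m : ℕ)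
    (hx : W.starProjection (x - x₀) ≠ 0) (hρ : logDist W x₀ x ≤ 0) {G M : ℝ}
    (hG : ∀ i ≤ m, |evenOp σ (Module.finrank ℝ W) i h (c - logDist W x₀ x)| ≤ G)
    (hG' : ∀ i ≤ m, |stepOp (σ - 2 * i) (evenOp σ (Module.finrank ℝ W) i h)
      (c - logDist W x₀ x)| ≤ G)
    (hM : ∀ l ≤ m, |(fun v : EuclideanSpace ℝ (Fin N) → ℝ => Δ v)^[l] φ x| ≤ M)
    (hM' : ∀ l ≤ m, ‖fderiv ℝ ((fun v : EuclideanSpace ℝ (Fin N) → ℝ => Δ v)^[l] φ) x‖ ≤ M) :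
    absLap m (fun y => radial c σ h (logDist W x₀ y) * φ y) x ≤
      Real.exp ((σ - m) * logDist W x₀ x) *
        (|lapOp σ (Module.finrank ℝ W) m h (c - logDist W x₀ x)| * |φ x| +
          2 * 2 ^ m * G * M * Real.exp (logDist W x₀ x)) := by
  set k := Module.finrank ℝ W
  set ρ := logDist W x₀ x
  set Lφ := fun l => (fun v : EuclideanSpace ℝ (Fin N) → ℝ => Δ v)^[l] φ
  have hG0 : 0 ≤ G := (abs_nonneg _).trans (hG 0 (Nat.zero_le _))
  have hM0 : 0 ≤ M := (abs_nonneg _).trans (hM 0 (Nat.zero_le _))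
  have habs : ∀ s f, |radial c s f ρ| = Real.exp (s * ρ) * |f (c - ρ)| := fun s f => by
    rw [radial, abs_mul, abs_of_pos (Real.exp_pos _)]
  have hsum : ∀ j ≤ m, ∀ B : ℝ, 0 ≤ B →
      ∑ ij ∈ Finset.HasAntidiagonal.antidiagonal j, (j.choose ij.1 : ℝ) * B ≤ 2 ^ m * B := by
    intro j hj B hB
    rw [← Finset.sum_mul]
    gcongr
    rw [Finset.Nat.sum_antidiagonal_eq_sum_range_succ_mk]
    have := Nat.sum_range_choose j
    have h2 : ((∑ i ∈ Finset.range (j + 1), j.choose i : ℕ) : ℝ) = 2 ^ j := by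
      rw [this]; push_cast; rfl
    push_cast at h2
    simp only [Nat.succ_eq_add_one]
    rw [h2]
    exact pow_le_pow_right₀ (by norm_num) hj
  -- Isolates the term `(j, 0)`, in which every Laplacian falls on the radial factor. The slack `B`
  -- allowed in that term accommodates the gradient of `φ` when `m` is odd.
  have hsplit : ∀ j (t : ℕ × ℕ → ℝ) (a B : ℝ), j ≤ m → 0 ≤ B → t (j, 0) ≤ a + B →
      (∀ ij ∈ Finset.HasAntidiagonal.antidiagonal j, ij.1 + 1 ≤ j → t ij ≤ (j.choose ij.1 : ℝ) * B) →
      ∑ ij ∈ Finset.HasAntidiagonal.antidiagonal j, t ij ≤ a + 2 ^ m * B := by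
    intro j t a B hj hB h0 h1
    have : ∑ ij ∈ Finset.HasAntidiagonal.antidiagonal j, (t ij - if ij = (j, 0) then a else 0) ≤
        ∑ ij ∈ Finset.HasAntidiagonal.antidiagonal j, (j.choose ij.1 : ℝ) * B := by
      refine Finset.sum_le_sum fun ij hij => ?_
      have hm := Finset.HasAntidiagonal.mem_antidiagonal.1 hij
      split_ifs with he
      · subst he; simp; linarith
      · rw [sub_zero]
        refine h1 ij hij ?_
        by_contra hcon
        exact he (Prod.ext (by simp; omega) (by simp; omega))
    rw [Finset.sum_sub_distrib, Finset.sum_ite_eq' (Finset.HasAntidiagonal.antidiagonal j) (j, 0)] at this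
    simp only [Finset.HasAntidiagonal.mem_antidiagonal, add_zero, if_true] at this
    linarith [hsum j hj B hB]
  rcases Nat.even_or_odd m with hm | hm
  · obtain ⟨j, rfl⟩ := hm
    have hj : (j + j) / 2 = j := by omega
    rw [absLap, lapOp, if_pos ⟨j, rfl⟩, if_pos ⟨j, rfl⟩, hj,
      iterate_laplacian_radial_mul hh hφ hφW c σ j hx]
    refine (Finset.abs_sum_le_sum_abs _ _).trans ?_
    refine (hsplit j _ (Real.exp ((σ - (j + j : ℕ)) * ρ) * (|evenOp σ k j h (c - ρ)| * |φ x|))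
      (Real.exp ((σ - (j + j : ℕ)) * ρ) * (G * M * Real.exp ρ)) (by omega) (by positivity)
      ?_ ?_).trans ?_
    · simp only [Nat.choose_self, Nat.cast_one, one_mul, Function.iterate_zero, id_eq, abs_mul]
      rw [habs]
      push_cast
      rw [show σ - 2 * (j : ℝ) = σ - (j + j) by ring, mul_assoc]
      have : 0 ≤ Real.exp ((σ - (j + j)) * ρ) * (G * M * Real.exp ρ) := by positivity
      linarith
    · intro ij hij hlt
      have hm := Finset.HasAntidiagonal.mem_antidiagonal.1 hij
      rw [abs_mul, abs_mul, habs, Nat.abs_cast]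
      refine mul_le_mul_of_nonneg_left ?_ (Nat.cast_nonneg _)
      have e1 := exp_sub_mul_le (σ := σ) hρ (show (2 * ij.1) + 1 ≤ j + j by omega)
      push_cast at e1 ⊢
      calc _ ≤ (Real.exp ((σ - (j + j)) * ρ) * Real.exp ρ) * G * M := by
            gcongr
            · exact hG _ (by omega)
            · exact hM _ (by omega)
        _ = _ := by ring
    · rw [mul_add]
      have : 0 ≤ Real.exp ((σ - (j + j : ℕ)) * ρ) * (2 ^ (j + j) * G * M * Real.exp ρ) := by
        positivity
      nlinarith
  · obtain ⟨j, rfl⟩ := hm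
    have hj : (2 * j + 1 - 1) / 2 = j := by omega
    have hne : ¬ Even (2 * j + 1) := by simp
    rw [absLap, lapOp, if_neg hne, if_neg hne, hj, gradient, LinearIsometryEquiv.norm_map]
    have hev : (fun v : EuclideanSpace ℝ (Fin N) → ℝ => Δ v)^[j]
        (fun y => radial c σ h (logDist W x₀ y) * φ y) =ᶠ[𝓝 x]
        fun y => ∑ ij ∈ Finset.HasAntidiagonal.antidiagonal j, (j.choose ij.1 : ℝ) *
        (radial c (σ - 2 * ij.1) (evenOp σ k ij.1 h) (logDist W x₀ y) * Lφ ij.2 y) := by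
      filter_upwards [eventually_starProjection_sub_ne_zero W x₀ hx] with y hy
      exact iterate_laplacian_radial_mul hh hφ hφW c σ j hy
    rw [hev.fderiv_eq]
    have hD := HasFDerivAt.fun_sum (u := Finset.HasAntidiagonal.antidiagonal j) fun ij _ =>
      (hasFDerivAt_radial_mul (x₀ := x₀)
        (contDiff_radial (contDiff_evenOp hh σ k ij.1) c (σ - 2 * ij.1))
        (contDiff_iterate_laplacian hφ ij.2) hx).const_mul (j.choose ij.1 : ℝ)
    rw [hD.fderiv]
    refine (norm_sum_le _ _).trans ?_
    have hterm : ∀ ij : ℕ × ℕ, ‖(j.choose ij.1 : ℝ) • ((Lφ ij.2 x *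
        deriv (radial c (σ - 2 * ij.1) (evenOp σ k ij.1 h)) ρ) •
        ((‖W.starProjection (x - x₀)‖ ^ 2)⁻¹ • innerSL ℝ (W.starProjection (x - x₀))) +
        radial c (σ - 2 * ij.1) (evenOp σ k ij.1 h) ρ • fderiv ℝ (Lφ ij.2) x)‖ ≤
        (j.choose ij.1 : ℝ) * (Real.exp ((σ - (2 * ij.1 + 1 : ℕ)) * ρ) *
          (|stepOp (σ - 2 * ij.1) (evenOp σ k ij.1 h) (c - ρ)| * |Lφ ij.2 x| +
          Real.exp ρ * |evenOp σ k ij.1 h (c - ρ)| * ‖fderiv ℝ (Lφ ij.2) x‖)) := by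
      intro ij
      rw [norm_smul, Real.norm_natCast]
      refine mul_le_mul_of_nonneg_left ((norm_add_le _ _).trans (le_of_eq ?_)) (Nat.cast_nonneg _)
      rw [norm_smul, norm_fderiv_logDist hx, norm_smul,
        deriv_radial ((contDiff_evenOp hh σ k ij.1).differentiable (by simp)),
        Real.norm_eq_abs, abs_mul, habs, Real.norm_eq_abs, habs]
      have e1 : Real.exp ((σ - 2 * ij.1) * ρ) =
          Real.exp ((σ - (2 * ij.1 + 1 : ℕ)) * ρ) * Real.exp ρ := by
        rw [← Real.exp_add]; push_cast; ring_nf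
      have e2 : Real.exp ρ * Real.exp (-ρ) = 1 := by rw [← Real.exp_add]; simp
      rw [e1]
      linear_combination (Real.exp ((σ - (2 * ij.1 + 1 : ℕ)) * ρ) * |Lφ ij.2 x| *
        |stepOp (σ - 2 * ij.1) (evenOp σ k ij.1 h) (c - ρ)|) * e2
    -- The factor 2 in the error bound collects the two halves of the product rule, radial
    -- derivative and gradient of the tangential factor.
    refine (Finset.sum_le_sum fun ij _ => hterm ij).trans ?_
    refine (hsplit j _ (Real.exp ((σ - (2 * j + 1 : ℕ)) * ρ) *
      (|stepOp (σ - 2 * j) (evenOp σ k j h) (c - ρ)| * |φ x|))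
      (Real.exp ((σ - (2 * j + 1 : ℕ)) * ρ) * (2 * G * M * Real.exp ρ)) (by omega) (by positivity)
      ?_ ?_).trans (le_of_eq (by ring))
    · have h1 := hG j (by omega)
      have h2 := hM' 0 (by omega)
      simp only [Nat.choose_self, Nat.cast_one, one_mul]
      rw [← mul_add]
      refine mul_le_mul_of_nonneg_left ?_ (Real.exp_pos _).le
      have h3 : Real.exp ρ * |evenOp σ k j h (c - ρ)| * ‖fderiv ℝ (Lφ 0) x‖ ≤
          Real.exp ρ * G * M := by gcongr
      have h4 : 0 ≤ G * M * Real.exp ρ := by positivity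
      have h5 : |Lφ 0 x| = |φ x| := rfl
      rw [h5]
      linarith
    · intro ij hij hlt
      have hm := Finset.HasAntidiagonal.mem_antidiagonal.1 hij
      refine mul_le_mul_of_nonneg_left ?_ (Nat.cast_nonneg _)
      have e1 := exp_sub_mul_le (σ := σ) hρ (show (2 * ij.1 + 1) + 1 ≤ 2 * j + 1 by omega)
      have h1 := hG ij.1 (by omega)
      have h2 := hM' ij.2 (by omega)
      have h3 := hG' ij.1 (by omega)
      have h4 := hM ij.2 (by omega)
      have h5 : Real.exp ρ ≤ 1 := Real.exp_le_one_iff.2 hρ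
      calc _ ≤ (Real.exp ((σ - (2 * j + 1 : ℕ)) * ρ) * Real.exp ρ) * (G * M + 1 * G * M) := by
            gcongr
        _ = _ := by ring

end Operators

/-! ### Iterated logarithms, their inverses and their products. -/

section IteratedLogarithms

open Filter Topology

/-- The iterated logarithms `L₀ τ = τ`, `L_{i+1} τ = 1 + log (L_i τ)`. -/
noncomputable def iterLog : ℕ → ℝ → ℝ
  | 0, τ => τ
  | i + 1, τ => 1 + Real.log (iterLog i τ)

/-- The inverse function of `iterLog i`. -/
noncomputable def iterExp : ℕ → ℝ → ℝ
  | 0, s => s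
  | i + 1, s => iterExp i (Real.exp (s - 1))

/-- The substitution τ = 1 - log t linearises the iteration: taking the reciprocal turns 1 - log
into 1 + log. -/
theorem X_succ_eq (i : ℕ) (t : ℝ) : X (i + 1) t = (iterLog i (1 - Real.log t))⁻¹ := by
  induction i with
  | zero => simp [X, iterLog]
  | succ i ih =>
    rw [X, ih, iterLog, Real.log_inv, sub_neg_eq_add]

theorem one_le_iterLog (i : ℕ) {τ : ℝ} (h : 1 ≤ τ) : 1 ≤ iterLog i τ := by
  induction i with
  | zero => exact h
  | succ i ih => rw [iterLog]; linarith [Real.log_nonneg ih]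

theorem iterLog_pos (i : ℕ) {τ : ℝ} (h : 1 ≤ τ) : 0 < iterLog i τ :=
  zero_lt_one.trans_le (one_le_iterLog i h)

theorem iterLog_succ_le (i : ℕ) {τ : ℝ} (h : 1 ≤ τ) : iterLog (i + 1) τ ≤ iterLog i τ := by
  rw [iterLog]
  linarith [Real.log_le_sub_one_of_pos (iterLog_pos i h)]

theorem iterLog_anti {i j : ℕ} (hij : i ≤ j) {τ : ℝ} (h : 1 ≤ τ) : iterLog j τ ≤ iterLog i τ := by
  induction j, hij using Nat.le_induction with
  | base => exact le_rfl
  | succ j _ ih => exact (iterLog_succ_le j h).trans ih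

theorem iterLog_lt_iterLog (i : ℕ) {τ τ' : ℝ} (h : 1 ≤ τ) (h' : τ < τ') :
    iterLog i τ < iterLog i τ' := by
  induction i with
  | zero => exact h'
  | succ i ih =>
    simp only [iterLog]
    linarith [Real.log_lt_log (iterLog_pos i h) ih]

theorem iterLog_mono (i : ℕ) {τ τ' : ℝ} (h : 1 ≤ τ) (h' : τ ≤ τ') :
    iterLog i τ ≤ iterLog i τ' := by
  rcases h'.eq_or_lt with rfl | h'
  · exact le_rfl
  · exact (iterLog_lt_iterLog i h h').le

theorem iterLog_iterExp (i : ℕ) (s : ℝ) : iterLog i (iterExp i s) = s := by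
  induction i generalizing s with
  | zero => rfl
  | succ i ih => simp [iterLog, iterExp, ih]

theorem le_iterExp (i : ℕ) (s : ℝ) : s ≤ iterExp i s := by
  induction i generalizing s with
  | zero => exact le_rfl
  | succ i ih =>
    rw [iterExp]
    have := Real.add_one_le_exp (s - 1)
    linarith [ih (Real.exp (s - 1))]

theorem iterExp_mono (i : ℕ) {s t : ℝ} (h : s ≤ t) : iterExp i s ≤ iterExp i t := by
  induction i generalizing s t with
  | zero => exact h
  | succ i ih => exact ih (Real.exp_le_exp.2 (by linarith))

/-- The bounds from below by 1 are needed because `iterLog i` is strictly increasing only where all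
the inner logarithms have positive arguments. -/
theorem le_iterLog_iff (i : ℕ) {s τ : ℝ} (hs : 1 ≤ s) (hτ : 1 ≤ τ) :
    s ≤ iterLog i τ ↔ iterExp i s ≤ τ := by
  constructor
  · intro h
    by_contra! hlt
    have := iterLog_lt_iterLog i hτ hlt
    rw [iterLog_iterExp] at this
    linarith
  · intro h
    have := iterLog_mono i (hs.trans (le_iterExp i s)) h
    rwa [iterLog_iterExp] at this

theorem iterLog_le_iff (i : ℕ) {s τ : ℝ} (hs : 1 ≤ s) (hτ : 1 ≤ τ) :
    iterLog i τ ≤ s ↔ τ ≤ iterExp i s := by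
  constructor
  · intro h
    by_contra! hlt
    have := iterLog_lt_iterLog i (hs.trans (le_iterExp i s)) hlt
    rw [iterLog_iterExp] at this
    linarith
  · intro h
    have := iterLog_mono i hτ h
    rwa [iterLog_iterExp] at this

/-- The product `L₀ ⋯ L_{r-1}`. -/
noncomputable def logProd (r : ℕ) (τ : ℝ) : ℝ := ∏ i ∈ Finset.range r, iterLog i τ

theorem one_le_logProd (r : ℕ) {τ : ℝ} (h : 1 ≤ τ) : 1 ≤ logProd r τ := by
  induction r with
  | zero => simp [logProd]
  | succ r ih =>
    rw [logProd, Finset.prod_range_succ]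
    exact one_le_mul_of_one_le_of_one_le ih (one_le_iterLog r h)

theorem logProd_pos (r : ℕ) {τ : ℝ} (h : 1 ≤ τ) : 0 < logProd r τ :=
  zero_lt_one.trans_le (one_le_logProd r h)

theorem logProd_succ (r : ℕ) (τ : ℝ) : logProd (r + 1) τ = logProd r τ * iterLog r τ :=
  Finset.prod_range_succ _ _

theorem le_logProd_succ (r : ℕ) {τ : ℝ} (h : 1 ≤ τ) : τ ≤ logProd (r + 1) τ := by
  induction r with
  | zero => simp [logProd, iterLog]
  | succ r ih =>
    rw [logProd_succ]
    exact ih.trans (le_mul_of_one_le_right (logProd_pos _ h).le (one_le_iterLog _ h))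

/-- `z_i = (L₀ ⋯ L_i)⁻¹`, the product `X₁ ⋯ X_{i+1}` in the logarithmic variable. -/
noncomputable def logWeight (i : ℕ) (τ : ℝ) : ℝ := (logProd (i + 1) τ)⁻¹

/-- The logarithmic derivative of `logProd r`. -/
noncomputable def logSlope (r : ℕ) (τ : ℝ) : ℝ := ∑ i ∈ Finset.range r, logWeight i τ

theorem logWeight_pos (i : ℕ) {τ : ℝ} (h : 1 ≤ τ) : 0 < logWeight i τ := inv_pos.2 (logProd_pos _ h)

theorem logWeight_le (i : ℕ) {τ : ℝ} (h : 1 ≤ τ) : logWeight i τ ≤ τ⁻¹ :=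
  inv_anti₀ (zero_lt_one.trans_le h) (le_logProd_succ i h)

theorem hasDerivAt_iterLog (i : ℕ) {τ : ℝ} (h : 1 ≤ τ) :
    HasDerivAt (iterLog i) (logProd i τ)⁻¹ τ := by
  induction i with
  | zero => exact (hasDerivAt_id τ).congr_deriv (by simp [logProd])
  | succ i ih =>
    have h1 := (ih.log (iterLog_pos i h).ne').const_add 1
    rw [logProd_succ, mul_inv, ← div_eq_mul_inv]
    exact h1

theorem hasDerivAt_logProd (r : ℕ) {τ : ℝ} (h : 1 ≤ τ) :
    HasDerivAt (logProd r) (logProd r τ * logSlope r τ) τ := by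
  induction r with
  | zero =>
    have : logProd 0 = fun _ => 1 := by ext; simp [logProd]
    rw [this]
    simpa [logSlope] using hasDerivAt_const τ (1 : ℝ)
  | succ r ih =>
    have h1 := ih.mul (hasDerivAt_iterLog r h)
    have h2 : logProd (r + 1) = logProd r * iterLog r := by
      ext τ; exact logProd_succ r τ
    rw [h2]
    refine h1.congr_deriv ?_
    have h3 := (logProd_pos r h).ne'
    have h4 := (iterLog_pos r h).ne'
    rw [Pi.mul_apply, logSlope, logSlope, Finset.sum_range_succ, logWeight, logProd_succ]
    field_simp

theorem hasDerivAt_logWeight (i : ℕ) {τ : ℝ} (h : 1 ≤ τ) :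
    HasDerivAt (logWeight i) (-(logWeight i τ * logSlope (i + 1) τ)) τ := by
  have h1 := (hasDerivAt_logProd (i + 1) h).inv (logProd_pos _ h).ne'
  refine h1.congr_deriv ?_
  have h3 := (logProd_pos (i + 1) h).ne'
  rw [logWeight]
  field_simp

/-- Symmetrisation of the double sum of z_i z_j over j ≤ i: the off-diagonal terms make up the
square of the sum and the diagonal is counted once more. -/
theorem two_mul_sum_logWeight_mul (r : ℕ) (τ : ℝ) :
    2 * ∑ i ∈ Finset.range r, logWeight i τ * logSlope (i + 1) τ =
      logSlope r τ ^ 2 + ∑ i ∈ Finset.range r, logWeight i τ ^ 2 := by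
  induction r with
  | zero => simp [logSlope]
  | succ r ih =>
    have : logSlope (r + 1) τ = logSlope r τ + logWeight r τ := Finset.sum_range_succ _ _
    rw [Finset.sum_range_succ, Finset.sum_range_succ, mul_add, ih, this]
    ring

/-- This Riccati identity is the source of the series of logarithmic squares: it trades κ²W for a
total derivative and Σ z_i² W, with exact coefficients. -/
theorem hasDerivAt_logSlope (r : ℕ) {τ : ℝ} (h : 1 ≤ τ) :
    HasDerivAt (logSlope r)
      (-(logSlope r τ ^ 2 + ∑ i ∈ Finset.range r, logWeight i τ ^ 2) / 2) τ := by
  have h1 := HasDerivAt.fun_sum (u := Finset.range r) fun i _ => hasDerivAt_logWeight i h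
  refine h1.congr_deriv ?_
  rw [← two_mul_sum_logWeight_mul, Finset.sum_neg_distrib]
  ring

theorem contDiffAt_iterLog (i : ℕ) {τ : ℝ} (h : 1 ≤ τ) : ContDiffAt ℝ ∞ (iterLog i) τ := by
  induction i with
  | zero => exact contDiffAt_id
  | succ i ih => exact contDiffAt_const.add (ih.log (iterLog_pos i h).ne')

theorem contDiffAt_logProd (r : ℕ) {τ : ℝ} (h : 1 ≤ τ) : ContDiffAt ℝ ∞ (logProd r) τ :=
  contDiffAt_prod fun i _ => contDiffAt_iterLog i h

theorem logProd_succ_le_pow (r : ℕ) {τ : ℝ} (h : 1 ≤ τ) :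
    logProd (r + 1) τ ≤ τ * (1 + Real.log τ) ^ r := by
  induction r with
  | zero => simp [logProd, iterLog]
  | succ r ih =>
    rw [logProd_succ, pow_succ, ← mul_assoc]
    have h1 : iterLog (r + 1) τ ≤ 1 + Real.log τ := iterLog_anti (i := 1) (by omega) h
    exact mul_le_mul ih h1 (iterLog_pos _ h).le
      ((logProd_pos _ h).le.trans ih)

/-- The product is at most τ times a power of 1 + log τ. This makes the third order error τ⁻³ P
negligible against 1/P. -/
theorem tendsto_logProd_sq_div_cube (r : ℕ) :
    Tendsto (fun τ => logProd r τ ^ 2 / τ ^ 3) atTop (𝓝 0) := by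
  have h1 : Tendsto (fun s : ℝ => Real.exp 1 * (s ^ (2 * r) * Real.exp (-s))) atTop (𝓝 0) := by
    simpa using (Real.tendsto_pow_mul_exp_neg_atTop_nhds_zero (2 * r)).const_mul (Real.exp 1)
  have h2 : Tendsto (fun τ : ℝ => 1 + Real.log τ) atTop atTop :=
    tendsto_atTop_add_const_left _ _ Real.tendsto_log_atTop
  refine squeeze_zero' ?_ ?_ (h1.comp h2)
  · filter_upwards [eventually_ge_atTop 1] with τ hτ
    positivity
  · filter_upwards [eventually_ge_atTop 1] with τ hτ
    have hτ0 : 0 < τ := by linarith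
    have h3 : logProd r τ ≤ τ * (1 + Real.log τ) ^ r := by
      refine le_trans ?_ (logProd_succ_le_pow r hτ)
      rw [logProd_succ]
      exact le_mul_of_one_le_right (logProd_pos _ hτ).le (one_le_iterLog _ hτ)
    have h4 : logProd r τ ^ 2 ≤ (τ * (1 + Real.log τ) ^ r) ^ 2 :=
      pow_le_pow_left₀ (logProd_pos _ hτ).le h3 2
    have h5 : Real.exp 1 * Real.exp (-(1 + Real.log τ)) = τ⁻¹ := by
      rw [← Real.exp_add, show 1 + -(1 + Real.log τ) = -Real.log τ by ring, Real.exp_neg,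
        Real.exp_log hτ0]
    calc logProd r τ ^ 2 / τ ^ 3 ≤ (τ * (1 + Real.log τ) ^ r) ^ 2 / τ ^ 3 := by gcongr
      _ = (1 + Real.log τ) ^ (2 * r) * τ⁻¹ := by field_simp; ring
      _ = _ := by rw [← h5]; simp only [Function.comp]; ring

end IteratedLogarithms

/-! ### A symbol calculus uniform in the parameter R. -/

section Symbols

/-- Families of functions on `(1, ∞)` that decay like `τ^{-a}`, uniformly in the parameter, and
such that every derivative up to order `n` gains a further factor `τ⁻¹`. -/
def IsSymbol : ℕ → ℕ → (ℝ → ℝ → ℝ) → Prop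
  | 0, a, f => ∃ C, ∀ R, 1 ≤ R → ∀ τ, 1 < τ → |f R τ| ≤ C * (τ ^ a)⁻¹
  | n + 1, a, f => (∃ C, ∀ R, 1 ≤ R → ∀ τ, 1 < τ → |f R τ| ≤ C * (τ ^ a)⁻¹) ∧
      ∃ f' : ℝ → ℝ → ℝ, (∀ R, 1 ≤ R → ∀ τ, 1 < τ → HasDerivAt (f R) (f' R τ) τ) ∧
        IsSymbol n (a + 1) f'

namespace IsSymbol

variable {n a b : ℕ} {f g : ℝ → ℝ → ℝ}

theorem bound (h : IsSymbol n a f) :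
    ∃ C, 0 ≤ C ∧ ∀ R, 1 ≤ R → ∀ τ, 1 < τ → |f R τ| ≤ C * (τ ^ a)⁻¹ := by
  have : ∃ C, ∀ R, 1 ≤ R → ∀ τ, 1 < τ → |f R τ| ≤ C * (τ ^ a)⁻¹ := by
    cases n with
    | zero => exact h
    | succ n => exact h.1
  obtain ⟨C, hC⟩ := this
  refine ⟨max C 0, le_max_right _ _, fun R hR τ hτ => (hC R hR τ hτ).trans ?_⟩
  have : 0 < τ := by linarith
  gcongr
  exact le_max_left _ _

theorem of_succ (h : IsSymbol (n + 1) a f) : IsSymbol n a f := by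
  induction n generalizing a f with
  | zero => exact h.1
  | succ n ih =>
    obtain ⟨h1, f', h2, h3⟩ := h
    exact ⟨h1, f', h2, ih h3⟩

theorem zero (n a : ℕ) : IsSymbol n a fun _ _ => 0 := by
  induction n generalizing a with
  | zero => exact ⟨0, by simp⟩
  | succ n ih => exact ⟨⟨0, by simp⟩, fun _ _ => 0, fun R _ τ _ => hasDerivAt_const τ 0, ih _⟩

theorem add (hf : IsSymbol n a f) (hg : IsSymbol n a g) :
    IsSymbol n a fun R τ => f R τ + g R τ := by
  induction n generalizing a f g with
  | zero =>
    obtain ⟨C, hC⟩ := hf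
    obtain ⟨C', hC'⟩ := hg
    refine ⟨C + C', fun R hR τ hτ => (abs_add_le _ _).trans ?_⟩
    rw [add_mul]
    exact add_le_add (hC R hR τ hτ) (hC' R hR τ hτ)
  | succ n ih =>
    have hb := ih hf.of_succ hg.of_succ
    obtain ⟨_, f', h2, h3⟩ := hf
    obtain ⟨_, g', h2', h3'⟩ := hg
    obtain ⟨C, _, hC⟩ := hb.bound
    exact ⟨⟨C, hC⟩, fun R τ => f' R τ + g' R τ,
      fun R hR τ hτ => (h2 R hR τ hτ).add (h2' R hR τ hτ), ih h3 h3'⟩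

theorem mul (hf : IsSymbol n a f) (hg : IsSymbol n b g) :
    IsSymbol n (a + b) fun R τ => f R τ * g R τ := by
  induction n generalizing a b f g with
  | zero =>
    obtain ⟨C, hC0, hC⟩ := hf.bound
    obtain ⟨C', hC0', hC'⟩ := hg.bound
    refine ⟨C * C', fun R hR τ hτ => ?_⟩
    have : 0 < τ := by linarith
    rw [abs_mul]
    calc |f R τ| * |g R τ| ≤ (C * (τ ^ a)⁻¹) * (C' * (τ ^ b)⁻¹) :=
          mul_le_mul (hC R hR τ hτ) (hC' R hR τ hτ) (abs_nonneg _) (by positivity)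
      _ = _ := by rw [pow_add, mul_inv]; ring
  | succ n ih =>
    have hb := ih hf.of_succ hg.of_succ
    have hf0 := hf.of_succ
    have hg0 := hg.of_succ
    obtain ⟨_, f', h2, h3⟩ := hf
    obtain ⟨_, g', h2', h3'⟩ := hg
    obtain ⟨C, _, hC⟩ := hb.bound
    refine ⟨⟨C, hC⟩, fun R τ => f' R τ * g R τ + f R τ * g' R τ,
      fun R hR τ hτ => (h2 R hR τ hτ).mul (h2' R hR τ hτ), ?_⟩
    have e1 := ih h3 hg0
    have e2 := ih hf0 h3'
    rw [show a + 1 + b = a + b + 1 by ring] at e1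
    rw [show a + (b + 1) = a + b + 1 by ring] at e2
    exact e1.add e2

theorem of_bounded {c : ℝ → ℝ} {C : ℝ} (h : ∀ R, 1 ≤ R → |c R| ≤ C) (n : ℕ) :
    IsSymbol n 0 fun R _ => c R := by
  cases n with
  | zero => exact ⟨C, fun R hR τ _ => by simpa using h R hR⟩
  | succ n =>
    exact ⟨⟨C, fun R hR τ _ => by simpa using h R hR⟩, fun _ _ => 0,
      fun R _ τ _ => hasDerivAt_const τ _, zero n 1⟩

theorem const (c : ℝ) (n : ℕ) : IsSymbol n 0 fun _ _ => c :=
  of_bounded (fun _ _ => le_rfl) n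

theorem const_mul (hf : IsSymbol n a f) (c : ℝ) : IsSymbol n a fun R τ => c * f R τ := by
  simpa using (const c n).mul hf

theorem neg (hf : IsSymbol n a f) : IsSymbol n a fun R τ => -f R τ := by
  simpa using hf.const_mul (-1)

theorem finset_sum {ι : Type*} (s : Finset ι) {F : ι → ℝ → ℝ → ℝ}
    (h : ∀ i ∈ s, IsSymbol n a (F i)) : IsSymbol n a fun R τ => ∑ i ∈ s, F i R τ := by
  classical
  induction s using Finset.induction_on with
  | empty => simpa using zero n a
  | insert i s hi ih =>
    simp only [Finset.sum_insert hi]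
    exact (h i (Finset.mem_insert_self _ _)).add
      (ih fun j hj => h j (Finset.mem_insert_of_mem hj))

end IsSymbol

/-- The derivative of z_i is -z_i (z_0 + ⋯ + z_i), again a polynomial in the weights with one more
factor of size 1/τ, so the induction on the number of derivatives closes. -/
theorem isSymbol_logWeight (n i : ℕ) : IsSymbol n 1 fun _ => logWeight i := by
  have hb : ∀ i : ℕ, ∃ C : ℝ, ∀ R : ℝ, 1 ≤ R → ∀ τ : ℝ, 1 < τ →
      |logWeight i τ| ≤ C * (τ ^ 1)⁻¹ := fun i =>
    ⟨1, fun R _ τ hτ => by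
      rw [abs_of_pos (logWeight_pos i hτ.le)]; simpa using logWeight_le i hτ.le⟩
  induction n generalizing i with
  | zero => exact hb i
  | succ n ih =>
    refine ⟨hb i, fun _ τ => -(logWeight i τ * logSlope (i + 1) τ),
      fun R _ τ hτ => hasDerivAt_logWeight i hτ.le, ?_⟩
    exact ((ih i).mul (IsSymbol.finset_sum _ fun j _ => ih j)).neg

theorem isSymbol_logSlope (n r : ℕ) : IsSymbol n 1 fun _ => logSlope r :=
  IsSymbol.finset_sum _ fun i _ => isSymbol_logWeight n i

end Symbols

/-! ### The logarithmic profile and products of operators c - d/dτ. -/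

section Profile

open Filter Topology

/-- A smooth cutoff with values in `[0, 1]`, supported in `[1, 4]`, equal to `1` on `[2, 3]`. -/
noncomputable def cut : ℝ → ℝ :=
  (⟨1 / 2, 3 / 2, by norm_num, by norm_num⟩ : ContDiffBump (5 / 2 : ℝ))

theorem contDiff_cut : ContDiff ℝ ∞ cut := ContDiffBump.contDiff _

theorem cut_nonneg (x : ℝ) : 0 ≤ cut x := ContDiffBump.nonneg _

theorem cut_le_one (x : ℝ) : cut x ≤ 1 := ContDiffBump.le_one _

theorem cut_eq_one {x : ℝ} (h : 2 ≤ x) (h' : x ≤ 3) : cut x = 1 := by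
  refine ContDiffBump.one_of_mem_closedBall _ ?_
  rw [Real.closedBall_eq_Icc]
  constructor <;> norm_num <;> linarith

theorem cut_eq_zero_of_le {x : ℝ} (h : x ≤ 1) : cut x = 0 := by
  refine ContDiffBump.zero_of_le_dist _ ?_
  rw [Real.dist_eq, abs_of_nonpos (by linarith)]
  norm_num; linarith

theorem cut_eq_zero_of_ge {x : ℝ} (h : 4 ≤ x) : cut x = 0 := by
  refine ContDiffBump.zero_of_le_dist _ ?_
  rw [Real.dist_eq, abs_of_nonneg (by linarith)]
  norm_num; linarith

theorem hasCompactSupport_cut : HasCompactSupport cut := ContDiffBump.hasCompactSupport _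

theorem contDiff_iterate_deriv {f : ℝ → ℝ} (hf : ContDiff ℝ ∞ f) (i : ℕ) :
    ContDiff ℝ ∞ (deriv^[i] f) := by
  induction i with
  | zero => exact hf
  | succ i ih =>
    rw [Function.iterate_succ_apply']
    exact ((contDiff_infty_iff_deriv (𝕜 := ℝ)).1 ih).2

theorem exists_bound_iterate_deriv_cut (i : ℕ) : ∃ C, ∀ x, |(deriv^[i] cut) x| ≤ C := by
  have h : HasCompactSupport (deriv^[i] cut) := by
    induction i with
    | zero => exact hasCompactSupport_cut
    | succ i ih => rw [Function.iterate_succ_apply']; exact ih.deriv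
  exact (contDiff_iterate_deriv contDiff_cut i).continuous.bounded_above_of_compact_support h

theorem IsSymbol.mono_weight {n a : ℕ} {f : ℝ → ℝ → ℝ} (h : IsSymbol n (a + 1) f) :
    IsSymbol n a f := by
  have hb : ∀ {n a : ℕ} {f : ℝ → ℝ → ℝ}, IsSymbol n (a + 1) f →
      ∃ C, ∀ R, 1 ≤ R → ∀ τ, 1 < τ → |f R τ| ≤ C * (τ ^ a)⁻¹ := by
    intro n a f h
    obtain ⟨C, hC0, hC⟩ := h.bound
    refine ⟨C, fun R hR τ hτ => (hC R hR τ hτ).trans ?_⟩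
    have h0 : 0 < τ := by linarith
    gcongr
    · exact hτ.le
    · omega
  induction n generalizing a f with
  | zero => exact hb h
  | succ n ih =>
    have h1 := hb h
    obtain ⟨_, f', h2, h3⟩ := h
    exact ⟨h1, f', h2, ih h3⟩

theorem hasDerivAt_comp_stretch {f : ℝ → ℝ} (hf : Differentiable ℝ f) (r : ℕ) (R : ℝ) {τ : ℝ}
    (hτ : 1 ≤ τ) : HasDerivAt (fun τ => f (iterLog (r + 1) τ / R))
      (deriv f (iterLog (r + 1) τ / R) * (R⁻¹ * logWeight r τ)) τ := by
  have h := (hf (iterLog (r + 1) τ / R)).hasDerivAt.comp τ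
    ((hasDerivAt_iterLog (r + 1) hτ).div_const R)
  refine h.congr_deriv ?_
  rw [logWeight]
  ring

theorem isSymbol_inv_param (n : ℕ) : IsSymbol n 0 fun R _ => R⁻¹ :=
  IsSymbol.of_bounded (C := 1) (fun R hR => by
    rw [abs_of_pos (by positivity)]; exact inv_le_one_of_one_le₀ hR) n

theorem isSymbol_inv_mul_logWeight (n i : ℕ) : IsSymbol n 1 fun R τ => R⁻¹ * logWeight i τ := by
  simpa using (isSymbol_inv_param n).mul (isSymbol_logWeight n i)

/-- Every derivative brings out R⁻¹ z_r, which is at most 1/τ uniformly in R ≥ 1, and the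
derivatives of the fixed cutoff are bounded. -/
theorem isSymbol_cut (n r i : ℕ) :
    IsSymbol n 0 fun R τ => (deriv^[i] cut) (iterLog (r + 1) τ / R) := by
  have hb : ∀ i : ℕ, ∃ C : ℝ, ∀ R : ℝ, 1 ≤ R → ∀ τ : ℝ, 1 < τ →
      |(deriv^[i] cut) (iterLog (r + 1) τ / R)| ≤ C * (τ ^ 0)⁻¹ := fun i => by
    obtain ⟨C, hC⟩ := exists_bound_iterate_deriv_cut i
    exact ⟨C, fun R _ τ _ => by simpa using hC _⟩
  induction n generalizing i with
  | zero => exact hb i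
  | succ n ih =>
    refine ⟨hb i, fun R τ => (deriv^[i + 1] cut) (iterLog (r + 1) τ / R) * (R⁻¹ * logWeight r τ),
      fun R hR τ hτ => ?_, ?_⟩
    · rw [Function.iterate_succ_apply']
      exact hasDerivAt_comp_stretch
        ((contDiff_iterate_deriv contDiff_cut i).differentiable (by simp)) r R hτ.le
    · simpa using (ih (i + 1)).mul (isSymbol_inv_mul_logWeight n r)

/-- The family `f` is `(L₀ ⋯ L_r)^{1/p}` times the `l`-th power of the stretched cutoff, times a
symbol. -/
def HasProfileForm (p : ℝ) (r l n a : ℕ) (f : ℝ → ℝ → ℝ) : Prop :=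
  ∃ b, IsSymbol n a b ∧ ∀ R, 1 ≤ R → ∀ τ, 1 < τ →
    f R τ = logProd (r + 1) τ ^ (1 / p) * cut (iterLog (r + 1) τ / R) ^ l * b R τ

/-- The three terms of `b` come from the product rule: the root of P contributes κ/p, the power of
the cutoff drops by one, and the symbol is differentiated. Each gains 1/τ. The power `l` is thus a
reserve from which derivatives are paid. -/
theorem HasProfileForm.deriv {p : ℝ} {r l n a : ℕ} {f : ℝ → ℝ → ℝ}
    (h : HasProfileForm p r (l + 1) (n + 1) a f) :
    HasProfileForm p r l n (a + 1) fun R => deriv (f R) := by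
  obtain ⟨b, hb, hf⟩ := h
  have hb0 := hb.of_succ
  obtain ⟨_, b', hb1, hb'⟩ := hb
  refine ⟨fun R τ => 1 / p * (logSlope (r + 1) τ * (cut (iterLog (r + 1) τ / R) * b R τ)) +
    ((l + 1 : ℝ) * ((_root_.deriv^[1] cut) (iterLog (r + 1) τ / R) * (R⁻¹ * logWeight r τ) * b R τ) +
      cut (iterLog (r + 1) τ / R) * b' R τ), ?_, ?_⟩
  · have hc : IsSymbol n 0 fun R τ => cut (iterLog (r + 1) τ / R) := isSymbol_cut n r 0
    refine IsSymbol.add (IsSymbol.const_mul ?_ _) (IsSymbol.add (IsSymbol.const_mul ?_ _) ?_)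
    · have := (isSymbol_logSlope n (r + 1)).mul (hc.mul hb0)
      rwa [show 1 + (0 + a) = a + 1 by ring] at this
    · have := ((isSymbol_cut n r 1).mul (isSymbol_inv_mul_logWeight n r)).mul hb0
      rwa [show 0 + 1 + a = a + 1 by ring] at this
    · have := hc.mul hb'
      rwa [zero_add] at this
  · intro R hR τ hτ
    have hev : f R =ᶠ[𝓝 τ] fun τ =>
        logProd (r + 1) τ ^ (1 / p) * cut (iterLog (r + 1) τ / R) ^ (l + 1) * b R τ := by
      filter_upwards [eventually_gt_nhds hτ] with t ht
      exact hf R hR t ht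
    have hP := (hasDerivAt_logProd (r + 1) hτ.le).rpow_const (p := 1 / p)
      (Or.inl (logProd_pos _ hτ.le).ne')
    have hc := (hasDerivAt_comp_stretch (contDiff_cut.differentiable (by simp)) r R hτ.le).pow
      (l + 1)
    have ht := (hP.mul hc).mul (hb1 R hR τ hτ)
    have ht' : HasDerivAt (fun τ =>
        logProd (r + 1) τ ^ (1 / p) * cut (iterLog (r + 1) τ / R) ^ (l + 1) * b R τ) _ τ := ht
    beta_reduce
    rw [hev.deriv_eq, ht'.deriv, Real.rpow_sub_one (logProd_pos _ hτ.le).ne']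
    have h0 := (logProd_pos (r + 1) hτ.le).ne'
    simp only [Nat.add_sub_cancel, Nat.cast_add, Nat.cast_one, Pi.mul_apply, Pi.pow_apply,
      Function.iterate_one]
    field_simp
    ring

theorem HasProfileForm.weaken {p : ℝ} {r l n a : ℕ} {f : ℝ → ℝ → ℝ}
    (h : HasProfileForm p r (l + 1) (n + 1) a f) : HasProfileForm p r l n a f := by
  obtain ⟨b, hb, hf⟩ := h
  refine ⟨fun R τ => cut (iterLog (r + 1) τ / R) * b R τ, ?_, fun R hR τ hτ => ?_⟩
  · simpa using (isSymbol_cut n r 0).mul hb.of_succ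
  · rw [hf R hR τ hτ]; ring

theorem HasProfileForm.stepOp {p : ℝ} {r l n a : ℕ} {f : ℝ → ℝ → ℝ}
    (h : HasProfileForm p r (l + 1) (n + 1) a f) (c : ℝ) :
    HasProfileForm p r l n a fun R => stepOp c (f R) := by
  obtain ⟨b, hb, hf⟩ := h.weaken
  obtain ⟨b', hb', hf'⟩ := h.deriv
  refine ⟨fun R τ => c * b R τ + -b' R τ, (hb.const_mul c).add hb'.mono_weight.neg,
    fun R hR τ hτ => ?_⟩
  have h1 : _root_.deriv (f R) τ = _ := hf' R hR τ hτ
  change c * f R τ - _root_.deriv (f R) τ = _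
  rw [hf R hR τ hτ, h1]
  ring

theorem HasProfileForm.iterate_deriv {p : ℝ} {r l n a : ℕ} {f : ℝ → ℝ → ℝ} (j : ℕ)
    (h : HasProfileForm p r (l + j) (n + j) a f) :
    HasProfileForm p r l n (a + j) fun R => _root_.deriv^[j] (f R) := by
  induction j generalizing l n with
  | zero => exact h
  | succ j ih =>
    have h1 : HasProfileForm p r (l + 1) (n + 1) (a + j) fun R => _root_.deriv^[j] (f R) := by
      refine ih ?_
      rwa [show l + 1 + j = l + (j + 1) by ring, show n + 1 + j = n + (j + 1) by ring]
    simp only [Function.iterate_succ_apply']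
    exact h1.deriv

theorem HasProfileForm.bound {p : ℝ} {r l n a : ℕ} {f : ℝ → ℝ → ℝ}
    (h : HasProfileForm p r l n a f) : ∃ C, 0 ≤ C ∧ ∀ R, 1 ≤ R → ∀ τ, 1 < τ →
      |f R τ| ≤ C * (τ ^ a)⁻¹ * (logProd (r + 1) τ ^ (1 / p) *
        cut (iterLog (r + 1) τ / R) ^ l) := by
  obtain ⟨b, hb, hf⟩ := h
  obtain ⟨C, hC0, hC⟩ := hb.bound
  refine ⟨C, hC0, fun R hR τ hτ => ?_⟩
  have h1 : 0 ≤ logProd (r + 1) τ ^ (1 / p) * cut (iterLog (r + 1) τ / R) ^ l :=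
    mul_nonneg (Real.rpow_nonneg (logProd_pos _ hτ.le).le _) (pow_nonneg (cut_nonneg _) _)
  rw [hf R hR τ hτ, abs_mul, abs_of_nonneg h1, mul_comm]
  exact mul_le_mul_of_nonneg_right (hC R hR τ hτ) h1

/-- The logarithmic profile of the test functions. -/
noncomputable def profile (p : ℝ) (r n : ℕ) (R τ : ℝ) : ℝ :=
  if 1 < τ then logProd (r + 1) τ ^ (1 / p) * cut (iterLog (r + 1) τ / R) ^ n else 0

theorem profile_nonneg (p : ℝ) (r n : ℕ) (R τ : ℝ) : 0 ≤ profile p r n R τ := by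
  rw [profile]
  split_ifs with h
  · exact mul_nonneg (Real.rpow_nonneg (logProd_pos _ h.le).le _) (pow_nonneg (cut_nonneg _) _)
  · exact le_rfl

theorem hasProfileForm_profile (p : ℝ) (r l n : ℕ) :
    HasProfileForm p r l n 0 (profile p r l) :=
  ⟨fun _ _ => 1, IsSymbol.const 1 n, fun R _ τ hτ => by rw [profile, if_pos hτ, mul_one]⟩

/-- The interval is open: the cutoff also vanishes at the two endpoints, and this is what kills the
boundary terms later. -/
theorem cut_stretch_eq_zero {r : ℕ} {R τ : ℝ} (hR : 1 ≤ R) (hτ : 1 ≤ τ)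
    (h : τ ∉ Set.Ioo (iterExp (r + 1) R) (iterExp (r + 1) (4 * R))) :
    cut (iterLog (r + 1) τ / R) = 0 := by
  have hR0 : 0 < R := by linarith
  by_cases h1 : τ ≤ iterExp (r + 1) R
  · exact cut_eq_zero_of_le ((div_le_one hR0).2 ((iterLog_le_iff _ hR hτ).2 h1))
  · have h2 : iterExp (r + 1) (4 * R) ≤ τ := by
      by_contra h3
      exact h ⟨not_le.1 h1, not_le.1 h3⟩
    refine cut_eq_zero_of_ge ((le_div_iff₀ hR0).2 ?_)
    exact (le_iterLog_iff _ (by linarith) hτ).2 h2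

theorem profile_eq_zero {p : ℝ} {r n : ℕ} (hn : n ≠ 0) {R τ : ℝ} (hR : 1 ≤ R)
    (h : τ ∉ Set.Icc (iterExp (r + 1) R) (iterExp (r + 1) (4 * R))) : profile p r n R τ = 0 := by
  rw [profile]
  split_ifs with h1
  · rw [cut_stretch_eq_zero hR h1.le fun h2 => h (Set.Ioo_subset_Icc_self h2), zero_pow hn,
      mul_zero]
  · rfl

/-- With R > 1 strictly, the support starts at `iterExp (r + 1) R` ≥ R > 1, so the truncation at τ =
1 takes place where the profile is already zero. -/
theorem contDiff_profile {p : ℝ} {r n : ℕ} (hn : n ≠ 0) {R : ℝ} (hR : 1 < R) :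
    ContDiff ℝ ∞ (profile p r n R) := by
  rw [contDiff_iff_contDiffAt]
  intro τ
  rcases lt_or_ge 1 τ with hτ | hτ
  · have hev : profile p r n R =ᶠ[𝓝 τ] fun τ =>
        logProd (r + 1) τ ^ (1 / p) * cut (iterLog (r + 1) τ / R) ^ n := by
      filter_upwards [eventually_gt_nhds hτ] with t ht
      rw [profile, if_pos ht]
    refine ContDiffAt.congr_of_eventuallyEq ?_ hev
    exact ((contDiffAt_logProd _ hτ.le).rpow_const_of_ne (logProd_pos _ hτ.le).ne').mul
      ((contDiff_cut.contDiffAt.comp τ ((contDiffAt_iterLog _ hτ.le).div_const R)).pow n)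
  · have hev : profile p r n R =ᶠ[𝓝 τ] fun _ => 0 := by
      filter_upwards [eventually_lt_nhds (show τ < R by linarith)] with t ht
      refine profile_eq_zero hn hR.le fun h => ?_
      linarith [h.1, le_iterExp (r + 1) R]
    exact contDiffAt_const.congr_of_eventuallyEq hev

theorem profile_rpow {p : ℝ} (hp : 0 < p) (r n : ℕ) (R : ℝ) {τ : ℝ} (hτ : 1 < τ) :
    profile p r n R τ ^ p =
      logProd (r + 1) τ * cut (iterLog (r + 1) τ / R) ^ (n * p) := by
  rw [profile, if_pos hτ, Real.mul_rpow (Real.rpow_nonneg (logProd_pos _ hτ.le).le _)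
    (pow_nonneg (cut_nonneg _) _), ← Real.rpow_mul (logProd_pos _ hτ.le).le,
    one_div_mul_cancel hp.ne', Real.rpow_one, ← Real.rpow_natCast, ← Real.rpow_mul (cut_nonneg _)]

/-- Successive application of the operators `c - d/dτ` for `c` in a list. -/
noncomputable def listOp : List ℝ → (ℝ → ℝ) → ℝ → ℝ
  | [], h => h
  | c :: l, h => stepOp c (listOp l h)

/-- The factors of `evenOp`. -/
noncomputable def evenFactors (σ : ℝ) (k : ℕ) : ℕ → List ℝ
  | 0 => []
  | j + 1 => (σ - 2 * j) :: (σ + k - 2 - 2 * j) :: evenFactors σ k j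

/-- The factors of `lapOp`. -/
noncomputable def lapFactors (σ : ℝ) (k m : ℕ) : List ℝ :=
  if Even m then evenFactors σ k (m / 2)
  else (σ - 2 * ((m - 1) / 2 : ℕ)) :: evenFactors σ k ((m - 1) / 2)

theorem evenOp_eq_listOp (σ : ℝ) (k j : ℕ) (h : ℝ → ℝ) :
    evenOp σ k j h = listOp (evenFactors σ k j) h := by
  induction j with
  | zero => rfl
  | succ j ih => simp [evenOp, evenFactors, listOp, ih]

theorem lapOp_eq_listOp (σ : ℝ) (k m : ℕ) (h : ℝ → ℝ) :
    lapOp σ k m h = listOp (lapFactors σ k m) h := by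
  unfold lapOp lapFactors
  split_ifs
  · exact evenOp_eq_listOp _ _ _ _
  · rw [listOp, evenOp_eq_listOp]

theorem length_evenFactors (σ : ℝ) (k j : ℕ) : (evenFactors σ k j).length = 2 * j := by
  induction j with
  | zero => rfl
  | succ j ih => simp [evenFactors, ih]; ring

theorem length_lapFactors (σ : ℝ) (k : ℕ) {m : ℕ} : (lapFactors σ k m).length = m := by
  rw [lapFactors]
  split_ifs with h
  · rw [length_evenFactors]; exact Nat.two_mul_div_two_of_even h
  · rw [List.length_cons, length_evenFactors]
    obtain ⟨j, rfl⟩ := Nat.not_even_iff_odd.1 h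
    omega

theorem HasProfileForm.listOp {p : ℝ} {r l n a : ℕ} {f : ℝ → ℝ → ℝ} (L : List ℝ)
    (h : HasProfileForm p r (l + L.length) (n + L.length) a f) :
    HasProfileForm p r l n a fun R => listOp L (f R) := by
  induction L generalizing l n with
  | nil => exact h
  | cons c L ih =>
    have h1 : HasProfileForm p r (l + 1) (n + 1) a fun R => Rellich.listOp L (f R) := by
      refine ih ?_
      rw [List.length_cons] at h
      rwa [show l + 1 + L.length = l + (L.length + 1) by ring,
        show n + 1 + L.length = n + (L.length + 1) by ring]
    exact h1.stepOp c

theorem contDiff_listOp {h : ℝ → ℝ} (hh : ContDiff ℝ ∞ h) (L : List ℝ) :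
    ContDiff ℝ ∞ (listOp L h) := by
  induction L with
  | nil => exact hh
  | cons c L ih => exact contDiff_stepOp ih c

/-- Expansion of a product of operators `c - d/dτ` up to second order. -/
theorem exists_listOp_expansion (L : List ℝ) (hL : ∀ c ∈ L, c ≠ 0) :
    ∃ (e₁ e₂ : ℝ) (w : ℕ → ℝ), e₁ ^ 2 - 2 * e₂ = (L.map fun c => (c ^ 2)⁻¹).sum ∧
      ∀ h : ℝ → ℝ, ContDiff ℝ ∞ h → ∀ τ, listOp L h τ =
        L.prod * (h τ - e₁ * deriv h τ + e₂ * deriv (deriv h) τ) +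
          ∑ j ∈ Finset.range L.length, w j * (deriv^[j + 3] h) τ := by
  induction L with
  | nil => exact ⟨0, 0, 0, by simp, fun h _ τ => by simp [listOp]⟩
  | cons c L ih =>
    obtain ⟨e₁, e₂, w, he, hw⟩ := ih fun c hc => hL c (List.mem_cons_of_mem _ hc)
    have hc : c ≠ 0 := hL c List.mem_cons_self
    -- Applying c - d/dτ to h - e₁h' + e₂h'' gives c times the same expression with e₁ + 1/c and e₂
    -- + e₁/c, and a leftover -e₂h'''. The latter enters `w 0`; the other `w j` satisfy a two-term
    -- recursion, guarded because the list has grown by one.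
    refine ⟨e₁ + c⁻¹, e₂ + e₁ * c⁻¹, fun j => (if j < L.length then c * w j else 0) +
      (if j = 0 then -(L.prod * e₂) else -w (j - 1)), ?_, fun h hh τ => ?_⟩
    · rw [List.map_cons, List.sum_cons, ← he]
      field_simp
      ring
    · have hd : ∀ j, HasDerivAt (deriv^[j] h) ((deriv^[j + 1] h) τ) τ := fun j => by
        rw [Function.iterate_succ_apply']
        exact (((contDiff_iterate_deriv hh j).differentiable (by simp)) τ).hasDerivAt
      have hfun : listOp L h = fun τ => L.prod * (h τ - e₁ * deriv h τ + e₂ * deriv (deriv h) τ) +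
          ∑ j ∈ Finset.range L.length, w j * (deriv^[j + 3] h) τ := by
        ext τ; exact hw h hh τ
      have hder : HasDerivAt (fun τ =>
          L.prod * (h τ - e₁ * deriv h τ + e₂ * deriv (deriv h) τ) +
          ∑ j ∈ Finset.range L.length, w j * (deriv^[j + 3] h) τ)
          (L.prod * ((deriv^[1] h) τ - e₁ * (deriv^[2] h) τ + e₂ * (deriv^[3] h) τ) +
          ∑ j ∈ Finset.range L.length, w j * (deriv^[j + 4] h) τ) τ :=
        ((((hd 0).sub ((hd 1).const_mul e₁)).add ((hd 2).const_mul e₂)).const_mul L.prod).add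
          (HasDerivAt.fun_sum fun j _ => (hd (j + 3)).const_mul (w j))
      rw [listOp, stepOp, hfun, hder.deriv]
      simp only [List.length_cons, List.prod_cons, add_mul, Finset.sum_add_distrib]
      rw [Finset.sum_range_succ, Finset.sum_range_succ']
      have s1 : ∑ j ∈ Finset.range L.length,
          (if j < L.length then c * w j else 0) * (deriv^[j + 3] h) τ =
          c * ∑ j ∈ Finset.range L.length, w j * (deriv^[j + 3] h) τ := by
        rw [Finset.mul_sum]
        refine Finset.sum_congr rfl fun j hj => ?_
        rw [if_pos (Finset.mem_range.1 hj), mul_assoc]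
      rw [s1]
      simp only [lt_irrefl, if_false, Nat.succ_ne_zero, Nat.add_sub_cancel, if_true, zero_mul,
        add_zero, zero_add, neg_mul, Finset.sum_neg_distrib, Function.iterate_one,
        show deriv^[2] h = deriv (deriv h) from rfl]
      have s2 : ∀ j, j + 1 + 3 = j + 4 := fun j => by ring
      simp only [s2]
      field_simp
      ring

end Profile

/-! ### Taylor expansion of the p-th power; derivatives of the density. -/

section PointwiseExpansion

open Filter Topology

/-- Mean value inequality on the ball of radius |x|; each use integrates once and raises the order
of vanishing by one. -/
theorem abs_le_pow_of_abs_deriv_le {f f' : ℝ → ℝ} {C δ : ℝ} {n : ℕ} (hC : 0 ≤ C)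
    (hf : ∀ x, |x| ≤ δ → HasDerivAt f (f' x) x) (hf' : ∀ x, |x| ≤ δ → |f' x| ≤ C * |x| ^ n)
    (h0 : f 0 = 0) {x : ℝ} (hx : |x| ≤ δ) : |f x| ≤ C * |x| ^ (n + 1) := by
  have hmem : ∀ y ∈ Metric.closedBall (0 : ℝ) |x|, |y| ≤ |x| := fun y hy => by
    simpa using hy
  have := (convex_closedBall (0 : ℝ) |x|).norm_image_sub_le_of_norm_hasDerivWithin_le
    (f := f) (f' := f') (C := C * |x| ^ n) (x := 0) (y := x)
    (fun y hy => (hf y ((hmem y hy).trans hx)).hasDerivWithinAt)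
    (fun y hy => (hf' y ((hmem y hy).trans hx)).trans (by
      have := hmem y hy
      gcongr)) (by simp) (by simp)
  rw [h0] at this
  simpa [pow_succ, mul_assoc] using this

/-- Third order Taylor bound near 0, crude growth elsewhere. Only an upper bound is needed, and a
natural exponent q ≥ p keeps the remainder polynomial. -/
theorem exists_abs_one_add_rpow_le {p : ℝ} (hp : 1 < p) {q : ℕ} (hq : p ≤ q) :
    ∃ C, 0 ≤ C ∧ ∀ x : ℝ, |1 + x| ^ p ≤
      1 + p * x + p * (p - 1) / 2 * x ^ 2 + C * (|x| ^ 3 + |x| ^ q) := by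
  obtain ⟨K, hK⟩ : ∃ K, ∀ x ∈ Set.Icc (-(1 / 2) : ℝ) (1 / 2), ‖(1 + x) ^ (p - 3)‖ ≤ K := by
    refine isCompact_Icc.exists_bound_of_continuousOn ?_
    refine ContinuousOn.rpow_const (by fun_prop) fun x hx => Or.inl ?_
    linarith [hx.1]
  have hK0 : 0 ≤ K := (norm_nonneg _).trans (hK 0 (by norm_num))
  have hpos : ∀ x : ℝ, |x| ≤ 1 / 2 → 0 < 1 + x := fun x hx => by linarith [(abs_le.1 hx).1]
  have hd : ∀ (a x : ℝ), |x| ≤ 1 / 2 →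
      HasDerivAt (fun x : ℝ => (1 + x) ^ a) (a * (1 + x) ^ (a - 1)) x := fun a x hx => by
    have := ((hasDerivAt_id x).const_add 1).rpow_const (p := a) (Or.inl (hpos x hx).ne')
    simpa using this
  set K' := p * (p - 1) * |p - 2| * K with hK'
  have hp0 : 0 < p * (p - 1) := mul_pos (by linarith) (by linarith)
  have hK'0 : 0 ≤ K' := by positivity
  -- The Taylor remainder is controlled by integrating from 0 three times: here for the second
  -- derivative, then for the first, then for the function.
  have b2 : ∀ x : ℝ, |x| ≤ 1 / 2 → |p * (p - 1) * ((1 + x) ^ (p - 2) - 1)| ≤ K' * |x| ^ (0 + 1) :=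
    fun x hx => by
    refine abs_le_pow_of_abs_deriv_le (f := fun x => p * (p - 1) * ((1 + x) ^ (p - 2) - 1))
      (f' := fun x => p * (p - 1) * ((p - 2) * (1 + x) ^ (p - 2 - 1))) hK'0
      (fun y hy => ((hd (p - 2) y hy).sub_const 1).const_mul (p * (p - 1)))
      (fun y hy => ?_) (by simp) hx
    rw [abs_mul (p * (p - 1)), abs_mul (p - 2), abs_of_pos hp0, pow_zero, mul_one, hK', ← mul_assoc,
      show p - 2 - 1 = p - 3 by ring]
    gcongr
    exact hK y (abs_le.1 hy)
  have b1 : ∀ x : ℝ, |x| ≤ 1 / 2 →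
      |p * ((1 + x) ^ (p - 1) - 1) - p * (p - 1) * x| ≤ K' * |x| ^ (1 + 1) := fun x hx => by
    refine abs_le_pow_of_abs_deriv_le (f := fun x => p * ((1 + x) ^ (p - 1) - 1) - p * (p - 1) * x)
      hK'0 (fun y hy => ?_) b2 (by simp) hx
    refine ((((hd (p - 1) y hy).sub_const 1).const_mul p).sub
      ((hasDerivAt_id y).const_mul (p * (p - 1)))).congr_deriv ?_
    rw [show p - 1 - 1 = p - 2 by ring]
    ring
  have b0 : ∀ x : ℝ, |x| ≤ 1 / 2 →
      |(1 + x) ^ p - 1 - p * x - p * (p - 1) / 2 * x ^ 2| ≤ K' * |x| ^ (2 + 1) := fun x hx => by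
    refine abs_le_pow_of_abs_deriv_le
      (f := fun x => (1 + x) ^ p - 1 - p * x - p * (p - 1) / 2 * x ^ 2)
      hK'0 (fun y hy => ?_) b1 (by simp) hx
    refine ((((hd p y hy).sub_const 1).sub ((hasDerivAt_id y).const_mul p)).sub
      ((hasDerivAt_pow 2 y).const_mul (p * (p - 1) / 2))).congr_deriv ?_
    simp
    ring
  -- For |x| ≥ 1/2 one has |1 + x| ≤ 3|x|, which gives 3^q, and |x| ≤ 4|x|³, which compensates a
  -- negative linear term by 4p|x|³.
  refine ⟨max K' (3 ^ q + 4 * p), le_max_of_le_left hK'0, fun x => ?_⟩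
  have hx3 : 0 ≤ |x| ^ 3 := by positivity
  have hxq : 0 ≤ |x| ^ q := by positivity
  rcases le_total |x| (1 / 2) with hx | hx
  · have h1 := (abs_le.1 (b0 x hx)).2
    rw [abs_of_pos (hpos x hx)]
    have h2 : K' * |x| ^ 3 ≤ max K' (3 ^ q + 4 * p) * (|x| ^ 3 + |x| ^ q) :=
      mul_le_mul (le_max_left _ _) (by linarith) hx3 (le_max_of_le_left hK'0)
    norm_num at h1
    linarith
  · have h1 : |1 + x| ≤ 3 * |x| := (abs_add_le _ _).trans (by rw [abs_one]; linarith)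
    have h2 : |1 + x| ^ p ≤ 3 ^ q * |x| ^ q := by
      calc |1 + x| ^ p ≤ (3 * |x|) ^ p := Real.rpow_le_rpow (abs_nonneg _) h1 (by linarith)
        _ ≤ (3 * |x|) ^ (q : ℝ) := Real.rpow_le_rpow_of_exponent_le (by linarith) hq
        _ = _ := by rw [Real.rpow_natCast, mul_pow]
    have h3 : -(p * x) ≤ 4 * p * |x| ^ 3 := by
      have h4 : -x ≤ |x| := neg_le_abs x
      have h5 : |x| ≤ 4 * |x| ^ 3 := by nlinarith [abs_nonneg x, mul_self_nonneg (|x| - 1 / 2)]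
      nlinarith
    have h6 : 0 ≤ p * (p - 1) / 2 * x ^ 2 := by positivity
    have h7 : (3 ^ q + 4 * p) * (|x| ^ 3 + |x| ^ q) ≤
        max K' (3 ^ q + 4 * p) * (|x| ^ 3 + |x| ^ q) := by
      gcongr
      exact le_max_right _ _
    have h8 : (0 : ℝ) ≤ 3 ^ q * |x| ^ 3 := by positivity
    have h9 : (0 : ℝ) ≤ 4 * p * |x| ^ q := by positivity
    nlinarith

/-- Second order expansion of `|1 - e₁ q₁ + e₂ q₂ + ρ|^p` when `q₁`, `q₂`, `ρ` are of first, second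
and third order. -/
theorem exists_rpow_expansion_le {p : ℝ} (hp : 1 < p) {q : ℕ} (hq : p ≤ q) (hq3 : 3 ≤ q)
    (e₁ e₂ K : ℝ) (hK : 0 ≤ K) : ∃ C, 0 ≤ C ∧ ∀ q₁ q₂ ρ s y : ℝ, 0 < s → s ≤ 1 → 1 ≤ y →
      |q₁| ≤ K * (s * y) → |q₂| ≤ K * (s ^ 2 * y) → |ρ| ≤ K * (s ^ 3 * y) →
      |1 + (-e₁ * q₁ + e₂ * q₂ + ρ)| ^ p ≤ 1 + p * (-e₁ * q₁ + e₂ * q₂) +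
        p * (p - 1) / 2 * (e₁ ^ 2 * q₁ ^ 2) + C * (s ^ 3 * y ^ q) := by
  obtain ⟨C, hC0, hC⟩ := exists_abs_one_add_rpow_le hp hq
  -- In the application s = 1/τ is the small quantity and y ≥ 1 is a negative power of the cutoff.
  -- Powers of y are merely bounded by y^q; only the order in s matters.
  set M := (|e₁| + |e₂| + 1) * K with hM
  have hM0 : 0 ≤ M := by positivity
  have hpp : 0 ≤ p * (p - 1) / 2 := by nlinarith
  refine ⟨p * K + p * (p - 1) / 2 * (M * (|e₁| * K + M)) + C * (M ^ 3 + M ^ q), by positivity,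
    fun q₁ q₂ ρ s y hs hs1 hy h1 h2 h3 => ?_⟩
  have hy0 : 0 < y := by linarith
  set x := -e₁ * q₁ + e₂ * q₂ + ρ with hx
  have hs2 : s ^ 2 ≤ s := by nlinarith
  have hs3 : s ^ 3 ≤ s ^ 2 := by nlinarith [sq_nonneg s]
  have hx2 : |e₂ * q₂ + ρ| ≤ M * (s ^ 2 * y) := by
    calc |e₂ * q₂ + ρ| ≤ |e₂| * |q₂| + |ρ| := (abs_add_le _ _).trans (by rw [abs_mul])
      _ ≤ |e₂| * (K * (s ^ 2 * y)) + K * (s ^ 2 * y) := by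
          refine add_le_add (by gcongr) (h3.trans (by gcongr))
      _ ≤ M * (s ^ 2 * y) := by
          have : 0 ≤ |e₁| * K * (s ^ 2 * y) := by positivity
          rw [hM]; linarith
  have hx1 : |e₁ * q₁| ≤ |e₁| * K * (s * y) := by
    rw [abs_mul, mul_assoc]; gcongr
  have hxb : |x| ≤ M * (s * y) := by
    calc |x| ≤ |e₁ * q₁| + |e₂ * q₂| + |ρ| := by
          rw [hx, neg_mul]
          refine (abs_add_le _ _).trans ?_
          have := abs_add_le (-(e₁ * q₁)) (e₂ * q₂)
          rw [abs_neg] at this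
          linarith
      _ ≤ |e₁| * K * (s * y) + |e₂| * (K * (s * y)) + K * (s * y) := by
          refine add_le_add (add_le_add hx1 ?_) ?_
          · rw [abs_mul]
            refine mul_le_mul_of_nonneg_left (h2.trans ?_) (abs_nonneg _)
            gcongr
          · exact h3.trans (by gcongr; exact hs3.trans hs2)
      _ = _ := by rw [hM]; ring
  have hyq : y ≤ y ^ q := le_self_pow₀ hy (by omega)
  have hy2q : y ^ 2 ≤ y ^ q := pow_le_pow_right₀ hy (by omega)
  have hy3q : y ^ 3 ≤ y ^ q := pow_le_pow_right₀ hy hq3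
  have hsq : s ^ q ≤ s ^ 3 := pow_le_pow_of_le_one hs.le hs1 hq3
  have t1 : p * x ≤ p * (-e₁ * q₁ + e₂ * q₂) + p * K * (s ^ 3 * y ^ q) := by
    have : ρ ≤ K * (s ^ 3 * y ^ q) := (le_abs_self _).trans (h3.trans (by gcongr))
    rw [hx]
    nlinarith
  have t2 : x ^ 2 ≤ e₁ ^ 2 * q₁ ^ 2 + M * (|e₁| * K + M) * (s ^ 3 * y ^ q) := by
    have e : x ^ 2 = e₁ ^ 2 * q₁ ^ 2 + (e₂ * q₂ + ρ) * (x - e₁ * q₁) := by rw [hx]; ring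
    rw [e]
    refine add_le_add le_rfl ((le_abs_self _).trans ?_)
    rw [abs_mul]
    calc |e₂ * q₂ + ρ| * |x - e₁ * q₁| ≤
        (M * (s ^ 2 * y)) * (M * (s * y) + |e₁| * K * (s * y)) := by
          refine mul_le_mul hx2 ?_ (abs_nonneg _) (by positivity)
          exact (abs_sub _ _).trans (add_le_add hxb hx1)
      _ = M * (|e₁| * K + M) * (s ^ 3 * y ^ 2) := by ring
      _ ≤ _ := by gcongr
  have t3 : |x| ^ 3 ≤ M ^ 3 * (s ^ 3 * y ^ q) := by
    calc |x| ^ 3 ≤ (M * (s * y)) ^ 3 := by gcongr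
      _ = M ^ 3 * (s ^ 3 * y ^ 3) := by ring
      _ ≤ _ := by gcongr
  have t4 : |x| ^ q ≤ M ^ q * (s ^ 3 * y ^ q) := by
    calc |x| ^ q ≤ (M * (s * y)) ^ q := by gcongr
      _ = M ^ q * (s ^ q * y ^ q) := by rw [mul_pow M (s * y) q, mul_pow s y q]
      _ ≤ _ := by gcongr
  calc |1 + x| ^ p ≤ _ := hC x
    _ ≤ 1 + (p * (-e₁ * q₁ + e₂ * q₂) + p * K * (s ^ 3 * y ^ q)) + p * (p - 1) / 2 *
        (e₁ ^ 2 * q₁ ^ 2 + M * (|e₁| * K + M) * (s ^ 3 * y ^ q)) +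
        C * (M ^ 3 * (s ^ 3 * y ^ q) + M ^ q * (s ^ 3 * y ^ q)) := by gcongr
    _ = _ := by ring

/-- The `p`-th power of the profile. -/
noncomputable def density (r : ℕ) (ν R τ : ℝ) : ℝ :=
  logProd (r + 1) τ * cut (iterLog (r + 1) τ / R) ^ ν

/-- The derivative of `density`. -/
noncomputable def densityDeriv (r : ℕ) (ν R τ : ℝ) : ℝ :=
  logSlope (r + 1) τ * density r ν R τ +
    ν * cut (iterLog (r + 1) τ / R) ^ (ν - 1) * (deriv cut (iterLog (r + 1) τ / R) / R)

/-- The sum of the squares of the weights `z₀, …, z_r`. -/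
noncomputable def sqWeight (r : ℕ) (τ : ℝ) : ℝ := ∑ i ∈ Finset.range (r + 1), logWeight i τ ^ 2

/-- The second derivative of `density`. -/
noncomputable def densityDeriv2 (r : ℕ) (ν R τ : ℝ) : ℝ :=
  -(logSlope (r + 1) τ ^ 2 + sqWeight r τ) / 2 * density r ν R τ +
    logSlope (r + 1) τ * densityDeriv r ν R τ +
    ν * ((ν - 1) * cut (iterLog (r + 1) τ / R) ^ (ν - 2) *
        (deriv cut (iterLog (r + 1) τ / R) / R) ^ 2 +
      cut (iterLog (r + 1) τ / R) ^ (ν - 1) *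
        (deriv (deriv cut) (iterLog (r + 1) τ / R) / R ^ 2)) * logWeight r τ

theorem hasDerivAt_density (r : ℕ) {ν : ℝ} (hν : 1 ≤ ν) (R : ℝ) {τ : ℝ} (hτ : 1 ≤ τ) :
    HasDerivAt (density r ν R) (densityDeriv r ν R τ) τ := by
  have h1 := (hasDerivAt_comp_stretch (contDiff_cut.differentiable (by simp)) r R hτ).rpow_const
    (p := ν) (Or.inr hν)
  have h2 := (hasDerivAt_logProd (r + 1) hτ).mul h1
  refine h2.congr_deriv ?_
  have h0 := (logProd_pos (r + 1) hτ).ne'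
  rw [densityDeriv, density, logWeight]
  field_simp

theorem hasDerivAt_densityDeriv (r : ℕ) {ν : ℝ} (hν : 2 ≤ ν) (R : ℝ) {τ : ℝ} (hτ : 1 ≤ τ) :
    HasDerivAt (densityDeriv r ν R) (densityDeriv2 r ν R τ) τ := by
  have h1 := (hasDerivAt_comp_stretch (contDiff_cut.differentiable (by simp)) r R hτ).rpow_const
    (p := ν - 1) (Or.inr (by linarith))
  have h2 := (hasDerivAt_comp_stretch ((contDiff_iterate_deriv contDiff_cut 1).differentiable
    (by simp)) r R hτ).div_const R
  have h3 := ((hasDerivAt_logSlope (r + 1) hτ).mul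
    (hasDerivAt_density r (by linarith : 1 ≤ ν) R hτ)).add ((h1.const_mul ν).mul h2)
  refine h3.congr_deriv ?_
  rw [densityDeriv2, sqWeight, show ν - 2 = ν - 1 - 1 by ring]
  simp only [Function.iterate_one]
  ring

theorem profile_rpow_eq_density {p : ℝ} (hp : 0 < p) (r n : ℕ) (R : ℝ) {τ : ℝ} (hτ : 1 < τ) :
    profile p r n R τ ^ p = density r (n * p) R τ := profile_rpow hp r n R hτ

/-- The derivative of the boundary term in the one-dimensional computation. -/
noncomputable def fluxDeriv (a e₁ e₂ b : ℝ) (r : ℕ) (ν R τ : ℝ) : ℝ :=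
  a * (-e₁ * densityDeriv r ν R τ + e₂ * densityDeriv2 r ν R τ) +
    2 * b * (-(logSlope (r + 1) τ ^ 2 + sqWeight r τ) / 2 * density r ν R τ +
      logSlope (r + 1) τ * densityDeriv r ν R τ)

/-- The boundary term in the one-dimensional computation. -/
noncomputable def flux (a e₁ e₂ b : ℝ) (r : ℕ) (ν R τ : ℝ) : ℝ :=
  a * (-e₁ * density r ν R τ + e₂ * densityDeriv r ν R τ) +
    2 * b * (logSlope (r + 1) τ * density r ν R τ)

theorem hasDerivAt_flux (a e₁ e₂ b : ℝ) (r : ℕ) {ν : ℝ} (hν : 2 ≤ ν) (R : ℝ) {τ : ℝ}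
    (hτ : 1 ≤ τ) : HasDerivAt (flux a e₁ e₂ b r ν R) (fluxDeriv a e₁ e₂ b r ν R τ) τ := by
  have h1 := hasDerivAt_density r (by linarith : 1 ≤ ν) R hτ
  have h2 := hasDerivAt_densityDeriv r hν R hτ
  exact (((h1.const_mul (-e₁)).add (h2.const_mul e₂)).const_mul a).add
    (((hasDerivAt_logSlope (r + 1) hτ).mul h1).const_mul (2 * b))

theorem densityDeriv_eq {p : ℝ} (hp : 1 < p) {r n : ℕ} (hn : 1 ≤ n) {R : ℝ} (hR : 1 < R) {τ : ℝ}
    (hτ : 1 < τ) : densityDeriv r (n * p) R τ =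
      p * profile p r n R τ ^ (p - 1) * deriv (profile p r n R) τ := by
  have hn' : (1 : ℝ) ≤ n := by exact_mod_cast hn
  have h1 := hasDerivAt_density r (ν := n * p) (by nlinarith) R hτ.le
  have h2 := (((contDiff_profile (p := p) (r := r) (by omega : n ≠ 0) hR).differentiable
    (by simp)) τ).hasDerivAt.rpow_const (p := p) (Or.inr hp.le)
  have hev : density r (n * p) R =ᶠ[𝓝 τ] fun τ => profile p r n R τ ^ p := by
    filter_upwards [eventually_gt_nhds hτ] with t ht
    exact (profile_rpow_eq_density (by linarith) r n R ht).symm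
  rw [(h1.congr_of_eventuallyEq hev.symm).unique h2]
  ring

/-- Obtained by differentiating the same function in two ways. Positivity of the profile is required
because p - 2 may be negative. -/
theorem densityDeriv2_eq {p : ℝ} (hp : 1 < p) {r n : ℕ} (hn : 2 ≤ n) {R : ℝ} (hR : 1 < R) {τ : ℝ}
    (hτ : 1 < τ) (hpos : 0 < profile p r n R τ) : densityDeriv2 r (n * p) R τ =
      p * (p - 1) * profile p r n R τ ^ (p - 2) * deriv (profile p r n R) τ ^ 2 +
      p * profile p r n R τ ^ (p - 1) * deriv (deriv (profile p r n R)) τ := by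
  have hn' : (2 : ℝ) ≤ n := by exact_mod_cast hn
  have h1 := hasDerivAt_densityDeriv r (ν := n * p) (by nlinarith) R hτ.le
  have hcd := contDiff_profile (p := p) (r := r) (by omega : n ≠ 0) hR
  have h2 := ((hcd.differentiable (by simp)) τ).hasDerivAt.rpow_const (p := p - 1)
    (Or.inl hpos.ne')
  have h3 := (((contDiff_iterate_deriv hcd 1).differentiable (by simp)) τ).hasDerivAt
  have hev : densityDeriv r (n * p) R =ᶠ[𝓝 τ] fun τ =>
      p * profile p r n R τ ^ (p - 1) * deriv (profile p r n R) τ := by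
    filter_upwards [eventually_gt_nhds hτ] with t ht
    exact densityDeriv_eq hp (by omega) hR ht
  rw [(h1.congr_of_eventuallyEq hev.symm).unique ((h2.const_mul p).mul h3)]
  rw [show p - 1 - 1 = p - 2 by ring]
  simp only [Function.iterate_one]
  ring

end PointwiseExpansion

/-! ### The pointwise upper bound for |Th|^p. -/

section PointwiseBound

open Filter Topology

/-- A j-th derivative uses up j powers of the cutoff, so relative to the profile it costs v^{-j};
the common factor v^{-M} serves all j ≤ M at once. -/
theorem exists_bound_iterate_deriv_profile (p : ℝ) (r : ℕ) {M n : ℕ} (hn : M ≤ n) :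
    ∃ K, 0 ≤ K ∧ ∀ j ≤ M, ∀ R, 1 ≤ R → ∀ τ, 1 < τ → 0 < cut (iterLog (r + 1) τ / R) →
      |(deriv^[j] (profile p r n R)) τ| ≤
        K * (τ⁻¹ ^ j * (cut (iterLog (r + 1) τ / R) ^ M)⁻¹) * profile p r n R τ := by
  have h : ∀ j : ℕ, ∃ C, 0 ≤ C ∧ (j ≤ M → ∀ R, 1 ≤ R → ∀ τ, 1 < τ →
      |(deriv^[j] (profile p r n R)) τ| ≤ C * (τ ^ (0 + j))⁻¹ *
        (logProd (r + 1) τ ^ (1 / p) * cut (iterLog (r + 1) τ / R) ^ (n - j))) := by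
    intro j
    by_cases hj : j ≤ M
    · have h1 : HasProfileForm p r (n - j + j) (0 + j) 0 (profile p r n) := by
        rw [Nat.sub_add_cancel (hj.trans hn)]
        exact hasProfileForm_profile p r n _
      obtain ⟨C, hC0, hC⟩ := (h1.iterate_deriv j).bound
      exact ⟨C, hC0, fun _ => hC⟩
    · exact ⟨0, le_rfl, fun h => absurd h hj⟩
  choose C hC0 hC using h
  refine ⟨∑ j ∈ Finset.range (M + 1), C j, Finset.sum_nonneg fun j _ => hC0 j,
    fun j hj R hR τ hτ hv => ?_⟩
  set v := cut (iterLog (r + 1) τ / R) with hvdef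
  have hCj : C j ≤ ∑ j ∈ Finset.range (M + 1), C j :=
    Finset.single_le_sum (fun j _ => hC0 j) (Finset.mem_range.2 (by omega))
  have hv1 : v ≤ 1 := cut_le_one _
  have hP : 0 ≤ logProd (r + 1) τ ^ (1 / p) := Real.rpow_nonneg (logProd_pos _ hτ.le).le _
  have hS : 0 ≤ (∑ j ∈ Finset.range (M + 1), C j) := Finset.sum_nonneg fun j _ => hC0 j
  have hτ0 : 0 < τ := by linarith
  have hτj : 0 ≤ (τ ^ (0 + j))⁻¹ := by positivity
  have hpow : v ^ (n - j) ≤ (v ^ M)⁻¹ * v ^ n := by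
    rw [← div_eq_inv_mul, le_div_iff₀ (pow_pos hv M), ← pow_add]
    exact pow_le_pow_of_le_one hv.le hv1 (by omega)
  rw [profile, if_pos hτ, ← hvdef]
  calc |(deriv^[j] (profile p r n R)) τ| ≤ C j * (τ ^ (0 + j))⁻¹ *
        (logProd (r + 1) τ ^ (1 / p) * v ^ (n - j)) := hC j hj R hR τ hτ
    _ ≤ (∑ j ∈ Finset.range (M + 1), C j) * (τ ^ (0 + j))⁻¹ *
        (logProd (r + 1) τ ^ (1 / p) * ((v ^ M)⁻¹ * v ^ n)) :=
        mul_le_mul (mul_le_mul_of_nonneg_right hCj hτj) (mul_le_mul_of_nonneg_left hpow hP)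
          (mul_nonneg hP (pow_nonneg hv.le _)) (mul_nonneg hS hτj)
    _ = _ := by rw [zero_add, inv_pow]; ring

/-- With W = PV and W' = κW + PV', completing the square gives W'²/W = 2κW' - κ²W + (PV')²/W. The
Riccati expression is then added and subtracted, so that the bracket is the derivative of κW. -/
theorem sq_densityDeriv_div {r : ℕ} {ν R τ : ℝ} (hτ : 1 < τ)
    (hv : 0 < cut (iterLog (r + 1) τ / R)) :
    densityDeriv r ν R τ ^ 2 / density r ν R τ =
      2 * (-(logSlope (r + 1) τ ^ 2 + sqWeight r τ) / 2 * density r ν R τ +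
        logSlope (r + 1) τ * densityDeriv r ν R τ) + sqWeight r τ * density r ν R τ +
      ν ^ 2 * (deriv cut (iterLog (r + 1) τ / R) / R) ^ 2 *
        cut (iterLog (r + 1) τ / R) ^ (ν - 2) * (logProd (r + 1) τ)⁻¹ := by
  set v := cut (iterLog (r + 1) τ / R) with hvdef
  have hP := (logProd_pos (r + 1) hτ.le).ne'
  have hvν : v ^ ν ≠ 0 := (Real.rpow_pos_of_pos hv ν).ne'
  have h2 : v ^ (ν - 2) = v ^ ν / v ^ 2 := by
    rw [Real.rpow_sub hv]; norm_num
  rw [densityDeriv, density, h2, ← hvdef, Real.rpow_sub_one hv.ne']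
  have hv0 := hv.ne'
  field_simp
  ring

/-- The constant in front of the logarithmic terms, in terms of the factors of the operator. -/
noncomputable def listB (p : ℝ) (L : List ℝ) : ℝ :=
  (p - 1) / (2 * p) * |L.prod| ^ p * (L.map fun c => (c ^ 2)⁻¹).sum

theorem listB_nonneg {p : ℝ} (hp : 1 < p) (L : List ℝ) : 0 ≤ listB p L := by
  have h1 : 0 ≤ (p - 1) / (2 * p) := div_nonneg (by linarith) (by linarith)
  have h2 : 0 ≤ (L.map fun c => (c ^ 2)⁻¹).sum := List.sum_nonneg fun x hx => by
    obtain ⟨c, _, rfl⟩ := List.mem_map.1 hx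
    positivity
  unfold listB
  positivity

set_option maxHeartbeats 1000000 in
theorem exists_listOp_rpow_le {p : ℝ} (hp : 1 < p) {L : List ℝ} (hL : ∀ c ∈ L, c ≠ 0) (r : ℕ)
    {q n : ℕ} (hq : p ≤ q) (hq3 : 3 ≤ q) (hn : (L.length + 3) * q ≤ n) :
    ∃ e₁ e₂ C : ℝ, 0 ≤ C ∧ ∀ R, 1 < R → ∀ τ, 1 < τ →
      |listOp L (profile p r n R) τ| ^ p ≤ |L.prod| ^ p * density r (n * p) R τ +
        fluxDeriv (|L.prod| ^ p) e₁ e₂ (listB p L) r (n * p) R τ +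
        listB p L * (sqWeight r τ * density r (n * p) R τ) +
        C * ((R ^ 2)⁻¹ * (logProd (r + 1) τ)⁻¹ + (τ ^ 3)⁻¹ * logProd (r + 1) τ) := by
  obtain ⟨e₁, e₂, w, he, hw⟩ := exists_listOp_expansion L hL
  set M := L.length + 3 with hM
  have hMn : M ≤ n := (Nat.le_mul_of_pos_right M (by omega)).trans hn
  have hnpos : n ≠ 0 := by omega
  obtain ⟨K, hK0, hK⟩ := exists_bound_iterate_deriv_profile p r hMn
  have hA : L.prod ≠ 0 := fun h => (hL 0 (List.prod_eq_zero_iff.1 h)) rfl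
  set w' := ∑ j ∈ Finset.range L.length, |w j| with hw'
  have hw'0 : 0 ≤ w' := Finset.sum_nonneg fun j _ => abs_nonneg _
  obtain ⟨C, hC0, hC⟩ := exists_rpow_expansion_le hp hq hq3 e₁ e₂ (K * (1 + w' / |L.prod|))
    (by positivity)
  obtain ⟨C₁, hC₁⟩ := exists_bound_iterate_deriv_cut 1
  set ν : ℝ := n * p with hν
  set a := |L.prod| ^ p with ha
  have ha0 : 0 ≤ a := by positivity
  have hn3 : (3 : ℝ) ≤ n := by exact_mod_cast (show 3 ≤ n by omega)
  have hν2 : 2 < ν := by rw [hν]; nlinarith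
  have hb0 : 0 ≤ listB p L := listB_nonneg hp L
  refine ⟨e₁, e₂, a * C + listB p L * (ν ^ 2 * C₁ ^ 2), by positivity, fun R hR τ hτ => ?_⟩
  have hP := logProd_pos (r + 1) hτ.le
  have hτ0 : 0 < τ := by linarith
  have hR0 : 0 < R := by linarith
  set v := cut (iterLog (r + 1) τ / R) with hv
  set g := profile p r n R with hg
  have hcd : ContDiff ℝ ∞ g := contDiff_profile hnpos hR
  -- Where the cutoff vanishes one cannot divide by the profile. There Th, W, W' and W'' are all
  -- zero, since n exceeds the number of operators and ν > 2.
  rcases (cut_nonneg (iterLog (r + 1) τ / R)).eq_or_lt with h0 | hvpos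
  · have hform : HasProfileForm p r (n - L.length) 0 0 fun R => listOp L (profile p r n R) := by
      refine HasProfileForm.listOp L ?_
      rw [Nat.sub_add_cancel (by omega)]
      exact hasProfileForm_profile p r n _
    obtain ⟨b, _, hb⟩ := hform
    have h1 : listOp L g τ = 0 := by
      have h2 := hb R hR.le τ hτ
      beta_reduce at h2
      rw [h2, ← h0, zero_pow (by omega)]
      ring
    have hd : density r ν R τ = 0 := by
      rw [density, ← h0, Real.zero_rpow (by linarith), mul_zero]
    have hd1 : densityDeriv r ν R τ = 0 := by
      rw [densityDeriv, hd, ← h0, Real.zero_rpow (by linarith)]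
      ring
    have hd2 : densityDeriv2 r ν R τ = 0 := by
      rw [densityDeriv2, hd, hd1, ← h0, Real.zero_rpow (by linarith), Real.zero_rpow (by linarith)]
      ring
    rw [h1, fluxDeriv, hd, hd1, hd2, abs_zero, Real.zero_rpow (by linarith)]
    have : 0 ≤ (a * C + listB p L * (ν ^ 2 * C₁ ^ 2)) *
        ((R ^ 2)⁻¹ * (logProd (r + 1) τ)⁻¹ + (τ ^ 3)⁻¹ * logProd (r + 1) τ) := by positivity
    linarith
  · rw [← hv] at hvpos
    have hv1 : v ≤ 1 := cut_le_one _
    have hgpos : 0 < g τ := by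
      rw [hg, profile, if_pos hτ, ← hv]
      exact mul_pos (Real.rpow_pos_of_pos hP _) (pow_pos hvpos _)
    set y := (v ^ M)⁻¹ with hy
    have hy1 : 1 ≤ y := (one_le_inv₀ (pow_pos hvpos M)).2 (pow_le_one₀ hvpos.le hv1)
    have hs0 : 0 < τ⁻¹ := inv_pos.2 hτ0
    have hs1 : τ⁻¹ ≤ 1 := inv_le_one_of_one_le₀ hτ.le
    set q₁ := deriv g τ / g τ with hq₁
    set q₂ := deriv (deriv g) τ / g τ with hq₂
    set ρ := (∑ j ∈ Finset.range L.length, w j * (deriv^[j + 3] g) τ) / (L.prod * g τ) with hρ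
    have hK1 : K ≤ K * (1 + w' / |L.prod|) :=
      le_mul_of_one_le_right hK0 (by have : 0 ≤ w' / |L.prod| := by positivity
                                     linarith)
    have hq (j : ℕ) (hj : j ≤ M) : |(deriv^[j] g) τ / g τ| ≤ K * (τ⁻¹ ^ j * y) := by
      rw [abs_div, abs_of_pos hgpos, div_le_iff₀ hgpos]
      exact hK j hj R hR.le τ hτ hvpos
    have b1 : |q₁| ≤ K * (1 + w' / |L.prod|) * (τ⁻¹ * y) := by
      refine (hq 1 (by omega)).trans ?_
      rw [pow_one]
      gcongr
    have b2 : |q₂| ≤ K * (1 + w' / |L.prod|) * (τ⁻¹ ^ 2 * y) := by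
      refine (hq 2 (by omega)).trans ?_
      gcongr
    have b3 : |ρ| ≤ K * (1 + w' / |L.prod|) * (τ⁻¹ ^ 3 * y) := by
      have e : ρ = (∑ j ∈ Finset.range L.length, w j * ((deriv^[j + 3] g) τ / g τ)) / L.prod := by
        rw [hρ, mul_comm L.prod, ← div_div, Finset.sum_div]
        simp only [mul_div_assoc]
      have e2 : |∑ j ∈ Finset.range L.length, w j * ((deriv^[j + 3] g) τ / g τ)| ≤
          w' * (K * (τ⁻¹ ^ 3 * y)) := by
        rw [hw', Finset.sum_mul]
        refine (Finset.abs_sum_le_sum_abs _ _).trans (Finset.sum_le_sum fun j hj => ?_)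
        rw [abs_mul]
        refine mul_le_mul_of_nonneg_left ?_ (abs_nonneg _)
        have hj' := Finset.mem_range.1 hj
        refine (hq (j + 3) (by omega)).trans ?_
        have : τ⁻¹ ^ (j + 3) ≤ τ⁻¹ ^ 3 := pow_le_pow_of_le_one hs0.le hs1 (by omega)
        gcongr
      rw [e, abs_div, div_le_iff₀ (abs_pos.2 hA)]
      refine e2.trans ?_
      have : K * (1 + w' / |L.prod|) * (τ⁻¹ ^ 3 * y) * |L.prod| =
          K * (τ⁻¹ ^ 3 * y) * |L.prod| + w' * (K * (τ⁻¹ ^ 3 * y)) := by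
        have := abs_pos.2 hA
        field_simp
      rw [this]
      have : 0 ≤ K * (τ⁻¹ ^ 3 * y) * |L.prod| := by positivity
      linarith
    have hop : listOp L g τ = L.prod * g τ * (1 + (-e₁ * q₁ + e₂ * q₂ + ρ)) := by
      rw [hw g hcd τ, hq₁, hq₂, hρ]
      field_simp
      ring
    have hW : g τ ^ p = density r ν R τ := profile_rpow_eq_density (by linarith) r n R hτ
    have hWpos : 0 < density r ν R τ := by rw [← hW]; exact Real.rpow_pos_of_pos hgpos p
    have hD1 : densityDeriv r ν R τ = p * density r ν R τ * q₁ := by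
      rw [hν, densityDeriv_eq hp (by omega) hR hτ, ← hν, ← hW, ← hg, Real.rpow_sub_one hgpos.ne', hq₁]
      field_simp
    have hD2 : densityDeriv2 r ν R τ = p * (p - 1) * density r ν R τ * q₁ ^ 2 +
        p * density r ν R τ * q₂ := by
      rw [hν, densityDeriv2_eq hp (by omega) hR hτ hgpos, ← hν, ← hW, ← hg,
        Real.rpow_sub_one hgpos.ne', show p - 2 = p - 1 - 1 by ring, Real.rpow_sub_one hgpos.ne',
        Real.rpow_sub_one hgpos.ne', hq₁, hq₂]
      field_simp
    have hsq := sq_densityDeriv_div (ν := ν) hτ hvpos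
    rw [hD1, ← hv] at hsq
    have hsq' : (p * density r ν R τ * q₁) ^ 2 / density r ν R τ =
        p ^ 2 * (density r ν R τ * q₁ ^ 2) := by field_simp
    rw [hsq'] at hsq
    -- The reason for a high power of the cutoff: np ≥ Mq, so v^{np} absorbs the factor y^q =
    -- v^{-Mq} left by the expansion.
    have hrem : density r ν R τ * (τ⁻¹ ^ 3 * y ^ q) ≤ (τ ^ 3)⁻¹ * logProd (r + 1) τ := by
      have h1 : v ^ ν ≤ v ^ (M * q) := by
        rw [← Real.rpow_natCast]
        refine Real.rpow_le_rpow_of_exponent_ge hvpos hv1 ?_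
        have : ((M * q : ℕ) : ℝ) ≤ n := by exact_mod_cast hn
        exact this.trans (le_mul_of_one_le_right (by positivity) hp.le)
      have h2 : v ^ ν * y ^ q ≤ 1 := by
        rw [hy, inv_pow, ← pow_mul, ← div_eq_mul_inv]
        exact (div_le_one (pow_pos hvpos _)).2 h1
      calc density r ν R τ * (τ⁻¹ ^ 3 * y ^ q) =
          (τ ^ 3)⁻¹ * logProd (r + 1) τ * (v ^ ν * y ^ q) := by rw [density, inv_pow]; ring
        _ ≤ (τ ^ 3)⁻¹ * logProd (r + 1) τ * 1 := by gcongr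
        _ = _ := mul_one _
    have hbd : ν ^ 2 * (deriv cut (iterLog (r + 1) τ / R) / R) ^ 2 * v ^ (ν - 2) *
        (logProd (r + 1) τ)⁻¹ ≤ ν ^ 2 * C₁ ^ 2 * ((R ^ 2)⁻¹ * (logProd (r + 1) τ)⁻¹) := by
      have h1 : (deriv cut (iterLog (r + 1) τ / R)) ^ 2 ≤ C₁ ^ 2 := by
        rw [← sq_abs]
        exact pow_le_pow_left₀ (abs_nonneg _) (hC₁ _) 2
      have h2 : v ^ (ν - 2) ≤ 1 := Real.rpow_le_one hvpos.le hv1 (by linarith)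
      have h3 : 0 ≤ v ^ (ν - 2) := Real.rpow_nonneg hvpos.le _
      calc _ = ν ^ 2 * (deriv cut (iterLog (r + 1) τ / R)) ^ 2 * v ^ (ν - 2) *
            ((R ^ 2)⁻¹ * (logProd (r + 1) τ)⁻¹) := by rw [div_pow]; ring
        _ ≤ ν ^ 2 * C₁ ^ 2 * 1 * ((R ^ 2)⁻¹ * (logProd (r + 1) τ)⁻¹) := by gcongr
        _ = _ := by ring
    have hmain := hC q₁ q₂ ρ τ⁻¹ y hs0 hs1 hy1 b1 b2 b3
    have hp0 : p ≠ 0 := by linarith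
    -- Replacing pWq₂ by W'' - p(p-1)Wq₁² changes the coefficient e₁² of Wq₁² into e₁² - 2e₂ = Σ
    -- c⁻², which is exactly the sum in `listB`.
    have hbp : listB p L * p ^ 2 = a * (p * (p - 1) / 2) * (e₁ ^ 2 - 2 * e₂) := by
      rw [listB, he, ← ha]; field_simp
    have hlhs : |listOp L g τ| ^ p = a * density r ν R τ *
        |1 + (-e₁ * q₁ + e₂ * q₂ + ρ)| ^ p := by
      rw [hop, abs_mul, abs_mul, abs_of_pos hgpos, Real.mul_rpow (by positivity) (abs_nonneg _),
        Real.mul_rpow (abs_nonneg _) hgpos.le, hW]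
    rw [hlhs, fluxDeriv, hD1, hD2]
    have haW : 0 ≤ a * density r ν R τ := by positivity
    have step1 := mul_le_mul_of_nonneg_left hmain haW
    have step2 := mul_le_mul_of_nonneg_left hrem (mul_nonneg ha0 hC0)
    have step3 := mul_le_mul_of_nonneg_left hbd hb0
    have step4 : 0 ≤ a * C * ((R ^ 2)⁻¹ * (logProd (r + 1) τ)⁻¹) := by positivity
    have step5 : 0 ≤ listB p L * (ν ^ 2 * C₁ ^ 2) * ((τ ^ 3)⁻¹ * logProd (r + 1) τ) := by
      positivity
    have hkey : a * (p * (p - 1) / 2) * (e₁ ^ 2 - 2 * e₂) * (density r ν R τ * q₁ ^ 2) =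
        listB p L * (2 * (-(logSlope (r + 1) τ ^ 2 + sqWeight r τ) / 2 * density r ν R τ +
        logSlope (r + 1) τ * (p * density r ν R τ * q₁)) + sqWeight r τ * density r ν R τ +
      ν ^ 2 * (deriv cut (iterLog (r + 1) τ / R) / R) ^ 2 *
        v ^ (ν - 2) * (logProd (r + 1) τ)⁻¹) := by
      rw [← hbp, mul_assoc, hsq]
    refine step1.trans ?_
    linarith

end PointwiseBound

/-! ### Integration over the window and the limit R → ∞. -/

section OneDimensionalIntegrals

open Filter Topology Set

/-- The interval `1 ≤ L_{r+1} τ / R ≤ 4`. -/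
noncomputable def window (r : ℕ) (R : ℝ) : Set ℝ :=
  Icc (iterExp (r + 1) R) (iterExp (r + 1) (4 * R))

theorem le_of_mem_window {r : ℕ} {R τ : ℝ} (h : τ ∈ window r R) : R ≤ τ :=
  (le_iterExp _ _).trans h.1

theorem le_iterLog_of_mem_window {r : ℕ} {R τ : ℝ} (hR : 1 ≤ R) (h : τ ∈ window r R) :
    R ≤ iterLog r τ :=
  ((le_iterLog_iff (r + 1) hR (hR.trans (le_of_mem_window h))).2 h.1).trans
    (iterLog_succ_le r (hR.trans (le_of_mem_window h)))

theorem measurableSet_window (r : ℕ) (R : ℝ) : MeasurableSet (window r R) := measurableSet_Icc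

theorem continuousOn_iterLog {S : Set ℝ} (hS : ∀ τ ∈ S, 1 ≤ τ) (i : ℕ) :
    ContinuousOn (iterLog i) S := fun τ hτ =>
  (hasDerivAt_iterLog i (hS τ hτ)).continuousAt.continuousWithinAt

theorem continuousOn_logProd {S : Set ℝ} (hS : ∀ τ ∈ S, 1 ≤ τ) (r : ℕ) :
    ContinuousOn (logProd r) S := fun τ hτ =>
  (hasDerivAt_logProd r (hS τ hτ)).continuousAt.continuousWithinAt

theorem continuousOn_inv_logProd {S : Set ℝ} (hS : ∀ τ ∈ S, 1 ≤ τ) (r : ℕ) :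
    ContinuousOn (fun τ => (logProd r τ)⁻¹) S :=
  (continuousOn_logProd hS r).inv₀ fun τ hτ => (logProd_pos r (hS τ hτ)).ne'

theorem continuousOn_logWeight {S : Set ℝ} (hS : ∀ τ ∈ S, 1 ≤ τ) (i : ℕ) :
    ContinuousOn (logWeight i) S :=
  continuousOn_inv_logProd hS (i + 1)

theorem continuousOn_logSlope {S : Set ℝ} (hS : ∀ τ ∈ S, 1 ≤ τ) (r : ℕ) :
    ContinuousOn (logSlope r) S := fun τ hτ =>
  (hasDerivAt_logSlope r (hS τ hτ)).continuousAt.continuousWithinAt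

theorem continuousOn_sqWeight {S : Set ℝ} (hS : ∀ τ ∈ S, 1 ≤ τ) (r : ℕ) :
    ContinuousOn (sqWeight r) S :=
  continuousOn_finsetSum _ fun i _ => (continuousOn_logWeight hS i).pow 2

theorem continuousOn_density {S : Set ℝ} (hS : ∀ τ ∈ S, 1 ≤ τ) (r : ℕ) {ν : ℝ}
    (hν : 1 ≤ ν) (R : ℝ) :
    ContinuousOn (density r ν R) S := fun τ hτ =>
  (hasDerivAt_density r hν R (hS τ hτ)).continuousAt.continuousWithinAt

theorem continuousOn_densityDeriv {S : Set ℝ} (hS : ∀ τ ∈ S, 1 ≤ τ) (r : ℕ) {ν : ℝ}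
    (hν : 2 ≤ ν) (R : ℝ) :
    ContinuousOn (densityDeriv r ν R) S := fun τ hτ =>
  (hasDerivAt_densityDeriv r hν R (hS τ hτ)).continuousAt.continuousWithinAt

theorem continuousOn_densityDeriv2 {S : Set ℝ} (hS : ∀ τ ∈ S, 1 ≤ τ) (r : ℕ) {ν : ℝ}
    (hν : 2 ≤ ν) (R : ℝ) :
    ContinuousOn (densityDeriv2 r ν R) S := by
  have hξ : ContinuousOn (fun τ => iterLog (r + 1) τ / R) S :=
    (continuousOn_iterLog hS (r + 1)).div_const R
  have h0 : ContinuousOn (fun τ => cut (iterLog (r + 1) τ / R)) S :=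
    contDiff_cut.continuous.comp_continuousOn hξ
  have h1 : ContinuousOn (fun τ => deriv cut (iterLog (r + 1) τ / R)) S :=
    (contDiff_iterate_deriv contDiff_cut 1).continuous.comp_continuousOn hξ
  have h2 : ContinuousOn (fun τ => deriv (deriv cut) (iterLog (r + 1) τ / R)) S :=
    (contDiff_iterate_deriv contDiff_cut 2).continuous.comp_continuousOn hξ
  have hpow : ∀ a : ℝ, 0 ≤ a → ContinuousOn (fun τ => cut (iterLog (r + 1) τ / R) ^ a) S :=
    fun a ha => h0.rpow_const fun _ _ => Or.inr ha
  have hκ := continuousOn_logSlope hS (r + 1)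
  have hQ := continuousOn_sqWeight hS r
  have hz := continuousOn_logWeight hS r
  have hd := continuousOn_density hS r (by linarith : 1 ≤ ν) R
  have hd1 := continuousOn_densityDeriv hS r hν R
  have p1 := hpow (ν - 1) (by linarith)
  have p2 := hpow (ν - 2) (by linarith)
  unfold densityDeriv2
  fun_prop

theorem continuousOn_fluxDeriv {S : Set ℝ} (hS : ∀ τ ∈ S, 1 ≤ τ)
    (a e₁ e₂ b : ℝ) (r : ℕ) {ν : ℝ} (hν : 2 ≤ ν) (R : ℝ) :
    ContinuousOn (fluxDeriv a e₁ e₂ b r ν R) S := by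
  have hκ := continuousOn_logSlope hS (r + 1)
  have hQ := continuousOn_sqWeight hS r
  have hd := continuousOn_density hS r (by linarith : 1 ≤ ν) R
  have hd1 := continuousOn_densityDeriv hS r hν R
  have hd2 := continuousOn_densityDeriv2 hS r hν R
  unfold fluxDeriv
  fun_prop

theorem one_le_of_mem_window {r : ℕ} {R : ℝ} (hR : 1 ≤ R) : ∀ τ ∈ window r R, 1 ≤ τ :=
  fun _ h => hR.trans (le_of_mem_window h)

theorem integrableOn_window {r : ℕ} {R : ℝ} {f : ℝ → ℝ} (h : ContinuousOn f (window r R)) :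
    IntegrableOn f (window r R) := h.integrableOn_compact isCompact_Icc

theorem iterExp_le_iterExp_four (r : ℕ) {R : ℝ} (hR : 1 ≤ R) :
    iterExp (r + 1) R ≤ iterExp (r + 1) (4 * R) := iterExp_mono _ (by linarith)

theorem flux_eq_zero (a e₁ e₂ b : ℝ) (r : ℕ) {ν : ℝ} (hν : 2 ≤ ν) {R τ : ℝ}
    (h : cut (iterLog (r + 1) τ / R) = 0) : flux a e₁ e₂ b r ν R τ = 0 := by
  have h0 : density r ν R τ = 0 := by
    rw [density, h, Real.zero_rpow (by linarith), mul_zero]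
  rw [flux, densityDeriv, h0, h, Real.zero_rpow (by linarith)]
  ring

theorem integral_fluxDeriv (a e₁ e₂ b : ℝ) (r : ℕ) {ν : ℝ} (hν : 2 ≤ ν) {R : ℝ} (hR : 1 ≤ R) :
    ∫ τ in window r R, fluxDeriv a e₁ e₂ b r ν R τ = 0 := by
  have hle := iterExp_le_iterExp_four r hR
  have h1 : 1 ≤ iterExp (r + 1) R := hR.trans (le_iterExp _ _)
  rw [window, integral_Icc_eq_integral_Ioc, ← intervalIntegral.integral_of_le hle,
    intervalIntegral.integral_eq_sub_of_hasDerivAt (f := flux a e₁ e₂ b r ν R)]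
  · rw [flux_eq_zero a e₁ e₂ b r hν (cut_stretch_eq_zero hR h1 fun h => lt_irrefl _ h.1),
      flux_eq_zero a e₁ e₂ b r hν (cut_stretch_eq_zero hR (h1.trans hle) fun h => lt_irrefl _ h.2),
      sub_zero]
  · intro τ hτ
    rw [uIcc_of_le hle] at hτ
    exact hasDerivAt_flux a e₁ e₂ b r hν R (h1.trans hτ.1)
  · refine ContinuousOn.intervalIntegrable ?_
    rw [uIcc_of_le hle]
    exact continuousOn_fluxDeriv (fun τ hτ => h1.trans hτ.1) a e₁ e₂ b r hν R

/-- The integrand is the derivative of `iterLog (r + 1)`, whose values at the endpoints are s and t.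
-/
theorem integral_inv_logProd (r : ℕ) {s t : ℝ} (hs : 1 ≤ s) (hst : s ≤ t) :
    ∫ τ in Icc (iterExp (r + 1) s) (iterExp (r + 1) t), (logProd (r + 1) τ)⁻¹ = t - s := by
  have hle : iterExp (r + 1) s ≤ iterExp (r + 1) t := iterExp_mono _ hst
  have h1 : 1 ≤ iterExp (r + 1) s := hs.trans (le_iterExp _ _)
  rw [integral_Icc_eq_integral_Ioc, ← intervalIntegral.integral_of_le hle,
    intervalIntegral.integral_eq_sub_of_hasDerivAt (f := iterLog (r + 1))]
  · rw [iterLog_iterExp, iterLog_iterExp]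
  · intro τ hτ
    rw [uIcc_of_le hle] at hτ
    exact hasDerivAt_iterLog (r + 1) (h1.trans hτ.1)
  · refine ContinuousOn.intervalIntegrable ?_
    rw [uIcc_of_le hle]
    exact continuousOn_inv_logProd (fun τ hτ => h1.trans hτ.1) (r + 1)

theorem density_nonneg (r : ℕ) (ν R : ℝ) {τ : ℝ} (hτ : 1 ≤ τ) : 0 ≤ density r ν R τ :=
  mul_nonneg (logProd_pos _ hτ).le (Real.rpow_nonneg (cut_nonneg _) _)

/-- The integrand is v^ν/P, and v = 1 where L_{r+1}/R lies in [2, 3]; in the variable L_{r+1} that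
piece has length R. -/
theorem le_integral_logWeight_sq_density (r : ℕ) {ν : ℝ} (hν : 1 ≤ ν) {R : ℝ} (hR : 1 ≤ R) :
    R ≤ ∫ τ in window r R, logWeight r τ ^ 2 * density r ν R τ := by
  have hR0 : 0 < R := by linarith
  have hS := one_le_of_mem_window (r := r) hR
  have hsub : Icc (iterExp (r + 1) (2 * R)) (iterExp (r + 1) (3 * R)) ⊆ window r R :=
    Icc_subset_Icc (iterExp_mono _ (by linarith)) (iterExp_mono _ (by linarith))
  have hint : IntegrableOn (fun τ => logWeight r τ ^ 2 * density r ν R τ) (window r R) :=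
    integrableOn_window (((continuousOn_logWeight hS r).pow 2).mul
      (continuousOn_density hS r hν R))
  calc R = ∫ τ in Icc (iterExp (r + 1) (2 * R)) (iterExp (r + 1) (3 * R)),
        (logProd (r + 1) τ)⁻¹ := by
        rw [integral_inv_logProd r (by linarith) (by linarith)]; ring
    _ = ∫ τ in Icc (iterExp (r + 1) (2 * R)) (iterExp (r + 1) (3 * R)),
        logWeight r τ ^ 2 * density r ν R τ := by
        refine setIntegral_congr_fun measurableSet_Icc fun τ hτ => ?_
        have hτ1 := hS τ (hsub hτ)
        have hc : cut (iterLog (r + 1) τ / R) = 1 := by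
          refine cut_eq_one ((le_div_iff₀ hR0).2 ?_) ((div_le_iff₀ hR0).2 ?_)
          · exact (le_iterLog_iff _ (by linarith) hτ1).2 hτ.1
          · exact (iterLog_le_iff _ (by linarith) hτ1).2 hτ.2
        have h0 := (logProd_pos (r + 1) hτ1).ne'
        simp only [density, logWeight, hc, Real.one_rpow]
        field_simp
    _ ≤ _ := by
        refine setIntegral_mono_set hint ?_ hsub.eventuallyLE
        filter_upwards [ae_restrict_mem (measurableSet_window r R)] with τ hτ
        exact mul_nonneg (sq_nonneg _) (density_nonneg r ν R (hS τ hτ))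

/-- The error terms of the one-dimensional computation. -/
noncomputable def errorTerm (r : ℕ) (R τ : ℝ) : ℝ :=
  (R ^ 2)⁻¹ * (logProd (r + 1) τ)⁻¹ + (τ ^ 3)⁻¹ * logProd (r + 1) τ

theorem continuousOn_errorTerm {S : Set ℝ} (hS : ∀ τ ∈ S, 1 ≤ τ) (r : ℕ) (R : ℝ) :
    ContinuousOn (errorTerm r R) S := by
  have h1 := continuousOn_inv_logProd hS (r + 1)
  have h2 := continuousOn_logProd hS (r + 1)
  have h3 : ContinuousOn (fun τ : ℝ => (τ ^ 3)⁻¹) S :=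
    (continuousOn_id.pow 3).inv₀ fun τ hτ => pow_ne_zero 3 (by have := hS τ hτ; simp; linarith)
  unfold errorTerm
  fun_prop

theorem exists_integral_listOp_rpow_le {p : ℝ} (hp : 1 < p) {L : List ℝ} (hL : ∀ c ∈ L, c ≠ 0)
    (r : ℕ) {q n : ℕ} (hq : p ≤ q) (hq3 : 3 ≤ q) (hn : (L.length + 3) * q ≤ n) :
    ∃ C : ℝ, 0 ≤ C ∧ ∀ R, 1 < R → ∫ τ in window r R, |listOp L (profile p r n R) τ| ^ p ≤
      |L.prod| ^ p * (∫ τ in window r R, density r (n * p) R τ) +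
        listB p L * (∫ τ in window r R, sqWeight r τ * density r (n * p) R τ) +
        C * ∫ τ in window r R, errorTerm r R τ := by
  obtain ⟨e₁, e₂, C, hC0, hC⟩ := exists_listOp_rpow_le hp hL r hq hq3 hn
  refine ⟨C, hC0, fun R hR => ?_⟩
  have hn9 : 9 ≤ n := by nlinarith [Nat.zero_le L.length]
  have hν : (2 : ℝ) ≤ n * p := by
    have : (9 : ℝ) ≤ n := by exact_mod_cast hn9
    nlinarith
  have hS := one_le_of_mem_window (r := r) hR.le
  have i1 := integrableOn_window ((continuousOn_density hS r (by linarith : 1 ≤ n * p) R))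
  have i2 := integrableOn_window (continuousOn_fluxDeriv hS (|L.prod| ^ p) e₁ e₂ (listB p L) r hν R)
  have i3 := integrableOn_window ((continuousOn_sqWeight hS r).mul
    (continuousOn_density hS r (by linarith : 1 ≤ n * p) R))
  have i4 := integrableOn_window (continuousOn_errorTerm hS r R)
  have hcd := contDiff_listOp (contDiff_profile (p := p) (r := r) (by omega : n ≠ 0) hR) L
  have i0 : IntegrableOn (fun τ => |listOp L (profile p r n R) τ| ^ p) (window r R) :=
    integrableOn_window ((hcd.continuous.abs.continuousOn).rpow_const
      fun _ _ => Or.inr (by linarith))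
  have hmono := setIntegral_mono_on i0 ((((i1.const_mul (|L.prod| ^ p)).add i2).add
    (i3.const_mul (listB p L))).add (i4.const_mul C)) (measurableSet_window r R)
    fun τ hτ => hC R hR τ (hR.trans_le (le_of_mem_window hτ))
  refine hmono.trans (le_of_eq ?_)
  rw [integral_add' ((((i1.const_mul (|L.prod| ^ p)).add i2).add
    (i3.const_mul (listB p L)))) (i4.const_mul C),
    integral_add' ((i1.const_mul (|L.prod| ^ p)).add i2) (i3.const_mul (listB p L)),
    integral_add' (i1.const_mul (|L.prod| ^ p)) i2, integral_fluxDeriv _ _ _ _ r hν hR.le,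
    integral_const_mul, integral_const_mul, integral_const_mul, add_zero]
  rfl

/-- The left integrand equals L_r^{2-θ} z_r²W. The error integral is o(J), since its pointwise size
is o(1/P), the integral of 1/P over the window is 3R, and J ≥ R. As L_r ≥ R on the window, θ < 2 is
impossible, and for θ = 2 both sides are multiples of J. -/
theorem sharpness_of_integral_inequality {r : ℕ} {θ C b K ν R₀ : ℝ} (hC : 0 < C) (hK : 0 ≤ K)
    (hν : 1 ≤ ν)
    (h : ∀ R, R₀ ≤ R → 1 < R →
      C * (∫ τ in window r R, (logProd r τ ^ 2)⁻¹ * iterLog r τ ^ (-θ) * density r ν R τ) ≤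
        b * (∫ τ in window r R, logWeight r τ ^ 2 * density r ν R τ) +
        K * ∫ τ in window r R, (errorTerm r R τ + Real.exp (-τ) * logProd (r + 1) τ)) :
    2 ≤ θ ∧ (θ = 2 → C ≤ b) := by
  set J := fun R => ∫ τ in window r R, logWeight r τ ^ 2 * density r ν R τ with hJ
  have herr : ∀ ε : ℝ, 0 < ε → ∃ R₁, ∀ R, R₁ ≤ R → 1 < R →
      ∫ τ in window r R, (errorTerm r R τ + Real.exp (-τ) * logProd (r + 1) τ) ≤ ε * J R := by
    intro ε hε
    -- Each of the three error terms is made at most (ε/9)/P; their sum (ε/3)/P integrates over the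
    -- window to εR ≤ εJ.
    have t1 : ∀ᶠ τ : ℝ in atTop, logProd (r + 1) τ ^ 2 / τ ^ 3 ≤ ε / 9 :=
      (tendsto_logProd_sq_div_cube (r + 1)).eventually_le_const (by positivity)
    have t2 : ∀ᶠ τ : ℝ in atTop, τ ^ 3 * Real.exp (-τ) ≤ 1 :=
      (Real.tendsto_pow_mul_exp_neg_atTop_nhds_zero 3).eventually_le_const (by norm_num)
    have t3 : ∀ᶠ R : ℝ in atTop, (R ^ 2)⁻¹ ≤ ε / 9 :=
      (tendsto_inv_atTop_zero.comp (tendsto_pow_atTop (two_ne_zero))).eventually_le_const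
        (by positivity)
    obtain ⟨R₁, hR₁⟩ := eventually_atTop.1 (t1.and (t2.and t3))
    refine ⟨R₁, fun R hR hR1 => ?_⟩
    have hS := one_le_of_mem_window (r := r) hR1.le
    have hint : IntegrableOn (fun τ => ε / 3 * (logProd (r + 1) τ)⁻¹) (window r R) :=
      (integrableOn_window (continuousOn_inv_logProd hS (r + 1))).const_mul _
    have hint' : IntegrableOn (fun τ => errorTerm r R τ + Real.exp (-τ) * logProd (r + 1) τ)
        (window r R) := by
      refine integrableOn_window ((continuousOn_errorTerm hS r R).add
        (ContinuousOn.mul ?_ (continuousOn_logProd hS (r + 1))))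
      exact (Real.continuous_exp.comp continuous_neg).continuousOn
    have hmono := setIntegral_mono_on hint' hint (measurableSet_window r R) fun τ hτ => by
      have hRτ : R ≤ τ := le_of_mem_window hτ
      obtain ⟨a1, a2, _⟩ := hR₁ τ (hR.trans hRτ)
      have a3 := (hR₁ R hR).2.2
      have hτ0 : 0 < τ := by linarith
      have hP := logProd_pos (r + 1) (hS τ hτ)
      have b1 : (τ ^ 3)⁻¹ * logProd (r + 1) τ ≤ ε / 9 * (logProd (r + 1) τ)⁻¹ := by
        calc (τ ^ 3)⁻¹ * logProd (r + 1) τ =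
            logProd (r + 1) τ ^ 2 / τ ^ 3 * (logProd (r + 1) τ)⁻¹ := by field_simp
          _ ≤ _ := by gcongr
      have b2 : Real.exp (-τ) ≤ (τ ^ 3)⁻¹ := by
        rw [← one_div, le_div_iff₀ (by positivity), mul_comm]; exact a2
      have b3 : Real.exp (-τ) * logProd (r + 1) τ ≤ ε / 9 * (logProd (r + 1) τ)⁻¹ :=
        (mul_le_mul_of_nonneg_right b2 hP.le).trans b1
      have b4 : (R ^ 2)⁻¹ * (logProd (r + 1) τ)⁻¹ ≤ ε / 9 * (logProd (r + 1) τ)⁻¹ := by gcongr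
      unfold errorTerm
      linarith
    refine hmono.trans ?_
    have hI := integral_inv_logProd r hR1.le (show R ≤ 4 * R by linarith)
    rw [integral_const_mul, window, hI]
    have := le_integral_logWeight_sq_density r hν hR1.le
    have h2 : ε * R ≤ ε * J R := mul_le_mul_of_nonneg_left this hε.le
    linarith
  have hJpos : ∀ R, 1 < R → 0 < J R := fun R hR =>
    lt_of_lt_of_le (by linarith) (le_integral_logWeight_sq_density r hν hR.le)
  have hpt : ∀ τ : ℝ, 1 ≤ τ → ((logProd r τ ^ 2)⁻¹ * iterLog r τ ^ (-θ)) =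
      iterLog r τ ^ (2 - θ) * logWeight r τ ^ 2 := fun τ hτ => by
    have h1 := logProd_pos r hτ
    have h2 := iterLog_pos r hτ
    rw [show 2 - θ = -θ + 2 by ring, Real.rpow_add h2, logWeight, logProd_succ]
    norm_num
    field_simp
  constructor
  · by_contra! hθ
    obtain ⟨R₁, hR₁⟩ := herr 1 one_pos
    have hlim : ∀ᶠ R : ℝ in atTop, (b + K) / C < R ^ (2 - θ) :=
      (tendsto_rpow_atTop (by linarith)).eventually_gt_atTop _
    obtain ⟨R, hR, hRR⟩ := ((hlim.and (eventually_gt_atTop (max (max R₀ R₁) 1)))).exists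
    have g0 : R₀ ≤ R := ((le_max_left _ _).trans (le_max_left _ _)).trans hRR.le
    have g1 : R₁ ≤ R := ((le_max_right _ _).trans (le_max_left _ _)).trans hRR.le
    have g2 : 1 < R := (le_max_right _ _).trans_lt hRR
    have hS := one_le_of_mem_window (r := r) g2.le
    have hlow : R ^ (2 - θ) * J R ≤ ∫ τ in window r R,
        (logProd r τ ^ 2)⁻¹ * iterLog r τ ^ (-θ) * density r ν R τ := by
      rw [hJ, ← integral_const_mul]
      refine setIntegral_mono_on ?_ ?_ (measurableSet_window r R) fun τ hτ => ?_
      · exact (integrableOn_window (((continuousOn_logWeight hS r).pow 2).mul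
          (continuousOn_density hS r hν R))).const_mul _
      · refine integrableOn_window ((ContinuousOn.mul ?_ ?_).mul (continuousOn_density hS r hν R))
        · exact ((continuousOn_logProd hS r).pow 2).inv₀ fun τ hτ =>
            pow_ne_zero 2 (logProd_pos r (hS τ hτ)).ne'
        · exact (continuousOn_iterLog hS r).rpow_const fun τ hτ =>
            Or.inl (iterLog_pos r (hS τ hτ)).ne'
      · rw [hpt τ (hS τ hτ), mul_assoc]
        have h1 := density_nonneg r ν R (hS τ hτ)
        have h2 : R ^ (2 - θ) ≤ iterLog r τ ^ (2 - θ) :=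
          Real.rpow_le_rpow (by linarith) (le_iterLog_of_mem_window g2.le hτ) (by linarith)
        gcongr
    have hh := h R g0 g2
    have he := mul_le_mul_of_nonneg_left (hR₁ R g1 g2) hK
    have hl := mul_le_mul_of_nonneg_left hlow hC.le
    have hJR := hJpos R g2
    have hfin : C * R ^ (2 - θ) * J R ≤ (b + K) * J R := by
      change C * _ ≤ b * J R + _ at hh
      linarith
    have := le_of_mul_le_mul_right hfin hJR
    rw [div_lt_iff₀ hC] at hR
    linarith
  · rintro rfl
    refine le_of_forall_pos_le_add fun ε hε => ?_
    obtain ⟨R₁, hR₁⟩ := herr (ε / (K + 1)) (by positivity)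
    set R := max (max R₀ R₁) 2 with hR
    have g0 : R₀ ≤ R := (le_max_left _ _).trans (le_max_left _ _)
    have g1 : R₁ ≤ R := (le_max_right _ _).trans (le_max_left _ _)
    have g2 : 1 < R := one_lt_two.trans_le (le_max_right _ _)
    have hS := one_le_of_mem_window (r := r) g2.le
    have hJR := hJpos R g2
    have hh := h R g0 g2
    have heq : ∫ τ in window r R, (logProd r τ ^ 2)⁻¹ * iterLog r τ ^ (-2 : ℝ) * density r ν R τ =
        J R := by
      refine setIntegral_congr_fun (measurableSet_window r R) fun τ hτ => ?_
      rw [hpt τ (hS τ hτ), sub_self, Real.rpow_zero, one_mul]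
    have he := mul_le_mul_of_nonneg_left (hR₁ R g1 g2) hK
    have hKε : K * (ε / (K + 1) * J R) ≤ ε * J R := by
      have : K * (ε / (K + 1)) ≤ ε := by
        rw [mul_div_assoc', div_le_iff₀ (by linarith)]; nlinarith
      calc _ = K * (ε / (K + 1)) * J R := by ring
        _ ≤ _ := by gcongr
    rw [heq] at hh
    have hfin : C * J R ≤ (b + ε) * J R := by
      change C * _ ≤ b * J R + _ at hh
      linarith
    exact le_of_mul_le_mul_right hfin hJR

end OneDimensionalIntegrals

/-! ### Reduction of integrals over space to the logarithmic variable. -/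

section Integration

open Filter Topology Set

/-- Substitution s = e^{c-τ}, under which ds/s is dτ. No integrability is required. -/
theorem integral_log_change (c : ℝ) (F : ℝ → ℝ) :
    ∫ s in Ioi (0 : ℝ), s⁻¹ * F (c - Real.log s) = ∫ τ, F τ := by
  have himg : (fun τ : ℝ => Real.exp (c - τ)) '' univ = Ioi 0 := by
    ext s
    simp only [image_univ, mem_range, mem_Ioi]
    exact ⟨fun ⟨y, hy⟩ => hy ▸ Real.exp_pos _,
      fun hs => ⟨c - Real.log s, by rw [sub_sub_cancel, Real.exp_log hs]⟩⟩
  have hd : ∀ τ ∈ (univ : Set ℝ), HasDerivWithinAt (fun τ : ℝ => Real.exp (c - τ))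
      (-Real.exp (c - τ)) univ τ := fun τ _ => by
    have := ((hasDerivAt_id τ).const_sub c).exp
    exact (this.congr_deriv (by simp)).hasDerivWithinAt
  have hinj : InjOn (fun τ : ℝ => Real.exp (c - τ)) univ := fun a _ b _ hab => by
    have := Real.exp_injective hab
    linarith
  rw [← himg, integral_image_eq_integral_abs_deriv_smul MeasurableSet.univ hd hinj]
  simp only [Measure.restrict_univ, abs_neg, abs_of_pos (Real.exp_pos _), smul_eq_mul, Real.log_exp,
    sub_sub_cancel]
  congr with τ
  rw [← mul_assoc, mul_inv_cancel₀ (Real.exp_pos _).ne', one_mul]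

theorem integrableOn_log_change (c : ℝ) {F : ℝ → ℝ} (hF : Integrable F) :
    IntegrableOn (fun s => s⁻¹ * F (c - Real.log s)) (Ioi (0 : ℝ)) := by
  have himg : (fun τ : ℝ => Real.exp (c - τ)) '' univ = Ioi 0 := by
    ext s
    simp only [image_univ, mem_range, mem_Ioi]
    exact ⟨fun ⟨y, hy⟩ => hy ▸ Real.exp_pos _,
      fun hs => ⟨c - Real.log s, by rw [sub_sub_cancel, Real.exp_log hs]⟩⟩
  have hd : ∀ τ ∈ (univ : Set ℝ), HasDerivWithinAt (fun τ : ℝ => Real.exp (c - τ))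
      (-Real.exp (c - τ)) univ τ := fun τ _ => by
    have := ((hasDerivAt_id τ).const_sub c).exp
    exact (this.congr_deriv (by simp)).hasDerivWithinAt
  have hinj : InjOn (fun τ : ℝ => Real.exp (c - τ)) univ := fun a _ b _ hab => by
    have := Real.exp_injective hab
    linarith
  rw [← himg, integrableOn_image_iff_integrableOn_abs_deriv_smul MeasurableSet.univ hd hinj]
  simp only [abs_neg, abs_of_pos (Real.exp_pos _), smul_eq_mul, Real.log_exp, sub_sub_cancel]
  refine (hF.congr (Eventually.of_forall fun τ => ?_)).integrableOn
  rw [← mul_assoc, mul_inv_cancel₀ (Real.exp_pos _).ne', one_mul]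

theorem pow_mul_exp_neg_mul_log {k : ℕ} (hk : 1 ≤ k) {s : ℝ} (hs : 0 < s) :
    s ^ (k - 1) * Real.exp (-(k : ℝ) * Real.log s) = s⁻¹ := by
  obtain ⟨j, rfl⟩ := Nat.exists_eq_add_of_le hk
  have h1 : Real.exp (-((1 + j : ℕ) : ℝ) * Real.log s) = (s ^ (1 + j))⁻¹ := by
    rw [neg_mul, Real.exp_neg, Real.exp_nat_mul, Real.exp_log hs]
  rw [h1, Nat.add_sub_cancel_left, pow_add, pow_one]
  field_simp

variable {E : Type*} [NormedAddCommGroup E] [InnerProductSpace ℝ E] [FiniteDimensional ℝ E]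

theorem norm_starProjection_eq (V : Submodule ℝ E) (x : E) :
    ‖V.starProjection x‖ = ‖V.orthogonalProjectionOnto x‖ := by
  rw [Submodule.starProjection_apply]; rfl

variable [MeasurableSpace E] [BorelSpace E]

theorem measurePreserving_prod_sub (V : Submodule ℝ E) (x₀ : E) :
    MeasurePreserving (V.measurableEquivProd x₀) volume volume := by
  refine MeasurePreserving.trans (μb := (volume : Measure E)) ?_
    (MeasurePreserving.trans (μb := volume) V.orthogonalDecomposition.measurePreserving
      (WithLp.volume_preserving_ofLp V Vᗮ))
  have : MeasurePreserving (fun x : E => x - x₀) volume volume := measurePreserving_sub_right _ x₀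
  exact this

/-- Product decomposition along `V` and its complement, then polar coordinates in the complement:
d^{-k} cancels s^{k-1} up to ds/s. -/
theorem integral_normal_mul_tangential (V : Submodule ℝ E) [Nontrivial Vᗮ] (x₀ : E) (c : ℝ)
    (F : ℝ → ℝ) (β : V → ℝ) :
    ∫ x, Real.exp (-(Module.finrank ℝ Vᗮ : ℝ) * logDist Vᗮ x₀ x) * F (c - logDist Vᗮ x₀ x) *
        β (V.orthogonalProjectionOnto (x - x₀)) =
      ((Module.finrank ℝ Vᗮ : ℝ) * (volume : Measure Vᗮ).real (Metric.ball 0 1) * ∫ v, β v) *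
        ∫ τ, F τ := by
  set Φ : ℝ → ℝ := fun s => Real.exp (-(Module.finrank ℝ Vᗮ : ℝ) * Real.log s) *
    F (c - Real.log s) with hΦ
  have h1 : ∀ x, Real.exp (-(Module.finrank ℝ Vᗮ : ℝ) * logDist Vᗮ x₀ x) *
      F (c - logDist Vᗮ x₀ x) * β (V.orthogonalProjectionOnto (x - x₀)) =
      (fun z : V × Vᗮ => β z.1 * Φ ‖z.2‖) (V.measurableEquivProd x₀ x) := fun x => by
    simp only [Submodule.measurableEquivProd_apply, vsub_eq_sub, hΦ, logDist,
      norm_starProjection_eq]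
    ring
  simp only [h1]
  rw [(measurePreserving_prod_sub V x₀).integral_comp'
    (g := fun z : V × Vᗮ => β z.1 * Φ ‖z.2‖)]
  have h2 : ∫ z : V × Vᗮ, β z.1 * Φ ‖z.2‖ = (∫ v, β v) * ∫ w : Vᗮ, Φ ‖w‖ :=
    integral_prod_mul β fun w : Vᗮ => Φ ‖w‖
  have h3 : ∫ s in Ioi (0 : ℝ), s ^ (Module.finrank ℝ Vᗮ - 1) • Φ s = ∫ τ, F τ := by
    rw [← integral_log_change c F]
    refine setIntegral_congr_fun measurableSet_Ioi fun s hs => ?_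
    simp only [smul_eq_mul, hΦ]
    rw [← mul_assoc, pow_mul_exp_neg_mul_log Module.finrank_pos hs]
  rw [h2, integral_fun_norm_addHaar, h3]
  simp only [nsmul_eq_mul, smul_eq_mul]
  ring

theorem integrable_normal_mul_tangential (V : Submodule ℝ E) [Nontrivial Vᗮ] (x₀ : E) (c : ℝ)
    {F : ℝ → ℝ} {β : V → ℝ} (hF : Integrable F) (hβ : Integrable β) :
    Integrable fun x => Real.exp (-(Module.finrank ℝ Vᗮ : ℝ) * logDist Vᗮ x₀ x) *
      F (c - logDist Vᗮ x₀ x) * β (V.orthogonalProjectionOnto (x - x₀)) := by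
  set Φ : ℝ → ℝ := fun s => Real.exp (-(Module.finrank ℝ Vᗮ : ℝ) * Real.log s) *
    F (c - Real.log s) with hΦ
  have h1 : (fun x => Real.exp (-(Module.finrank ℝ Vᗮ : ℝ) * logDist Vᗮ x₀ x) *
      F (c - logDist Vᗮ x₀ x) * β (V.orthogonalProjectionOnto (x - x₀))) =
      (fun z : V × Vᗮ => β z.1 * Φ ‖z.2‖) ∘ (V.measurableEquivProd x₀) := by
    ext x
    simp only [Submodule.measurableEquivProd_apply, vsub_eq_sub, hΦ, logDist,
      norm_starProjection_eq, Function.comp]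
    ring
  rw [h1, (measurePreserving_prod_sub V x₀).integrable_comp_emb
    (V.measurableEquivProd x₀).measurableEmbedding]
  have h2 : Integrable fun w : Vᗮ => Φ ‖w‖ := by
    rw [integrable_fun_norm_addHaar]
    refine (integrableOn_log_change c hF).congr_fun (fun s hs => ?_) measurableSet_Ioi
    simp only [smul_eq_mul, hΦ]
    rw [← mul_assoc, pow_mul_exp_neg_mul_log Module.finrank_pos hs]
  exact hβ.mul_prod h2

end Integration

/-! ### The tangential cutoff and bounds on its iterated Laplacians. -/

section Tangential

open Laplacian Filter Topology

variable {E : Type*} [NormedAddCommGroup E] [InnerProductSpace ℝ E] [FiniteDimensional ℝ E]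

/-- A smooth bump in the tangential variable, supported in the ball of radius `2δ`. -/
noncomputable def tangentBump (V : Submodule ℝ E) {δ : ℝ} (hδ : 0 < δ) : ContDiffBump (0 : V) :=
  ⟨δ, 2 * δ, hδ, by linarith⟩

/-- The tangential cutoff around `x₀`. -/
noncomputable def tangentCut (V : Submodule ℝ E) (x₀ : E) {δ : ℝ} (hδ : 0 < δ) (x : E) : ℝ :=
  tangentBump V hδ (V.orthogonalProjectionOnto (x - x₀))

variable (V : Submodule ℝ E) (x₀ : E) {δ : ℝ} (hδ : 0 < δ)

theorem contDiff_tangentCut : ContDiff ℝ ∞ (tangentCut V x₀ hδ) :=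
  (tangentBump V hδ).contDiff.comp
    (V.orthogonalProjectionOnto.contDiff.comp (contDiff_id.sub contDiff_const))

theorem tangentCut_nonneg (x : E) : 0 ≤ tangentCut V x₀ hδ x := ContDiffBump.nonneg _

theorem constAlong_tangentCut : ConstAlong Vᗮ (tangentCut V x₀ hδ) := by
  intro x v hv
  have : V.orthogonalProjectionOnto v = 0 :=
    Submodule.orthogonalProjectionOnto_eq_zero_iff.2 hv
  rw [tangentCut, tangentCut, add_sub_right_comm, map_add, this, add_zero]

theorem tangentCut_eq_zero {x : E} (h : 2 * δ ≤ ‖V.starProjection (x - x₀)‖) :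
    tangentCut V x₀ hδ x = 0 := by
  refine ContDiffBump.zero_of_le_dist _ ?_
  rw [dist_zero_right]
  exact h

theorem tangentCut_eventuallyEq_zero {x : E} (h : 2 * δ < ‖V.starProjection (x - x₀)‖) :
    tangentCut V x₀ hδ =ᶠ[𝓝 x] 0 := by
  have : ContinuousAt (fun y : E => ‖V.starProjection (y - x₀)‖) x := by fun_prop
  filter_upwards [this.eventually (lt_mem_nhds h)] with y hy
  exact tangentCut_eq_zero V x₀ hδ hy.le

/-- Such a function is not compactly supported, but its values are those taken on x₀ + `V`, where it
lives on a compact ball. -/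
theorem exists_bound_of_constAlong {F : Type*} [NormedAddCommGroup F] {ψ : E → F}
    (hψ : Continuous ψ) (h : ∀ x, ∀ v ∈ Vᗮ, ψ (x + v) = ψ x) {ε : ℝ}
    (h0 : ∀ x, ε < ‖V.starProjection (x - x₀)‖ → ψ x = 0) :
    ∃ M, 0 ≤ M ∧ ∀ x, ‖ψ x‖ ≤ M ∧ (ε < ‖V.starProjection (x - x₀)‖ → ψ x = 0) := by
  obtain ⟨M, hM⟩ := (isCompact_closedBall x₀ ε).exists_bound_of_continuousOn hψ.continuousOn
  refine ⟨max M 0, le_max_right _ _, fun x => ⟨?_, h0 x⟩⟩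
  by_cases hx : ε < ‖V.starProjection (x - x₀)‖
  · rw [h0 x hx, norm_zero]; exact le_max_right _ _
  · have h1 : ψ x = ψ (x₀ + V.starProjection (x - x₀)) := by
      have := h (x₀ + V.starProjection (x - x₀)) _ (V.sub_starProjection_mem_orthogonal (x - x₀))
      rw [← this]
      congr 1
      abel
    rw [h1]
    exact (hM _ (by simpa using not_lt.1 hx)).trans (le_max_left _ _)

theorem exists_bound_tangentCut (m : ℕ) : ∃ M, 0 ≤ M ∧ ∀ l ≤ m, ∀ x,
    |(fun v : E → ℝ => Δ v)^[l] (tangentCut V x₀ hδ) x| ≤ M ∧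
    ‖fderiv ℝ ((fun v : E → ℝ => Δ v)^[l] (tangentCut V x₀ hδ)) x‖ ≤ M ∧
    (2 * δ < ‖V.starProjection (x - x₀)‖ →
      (fun v : E → ℝ => Δ v)^[l] (tangentCut V x₀ hδ) x = 0 ∧
      fderiv ℝ ((fun v : E → ℝ => Δ v)^[l] (tangentCut V x₀ hδ)) x = 0) := by
  have key : ∀ l : ℕ, ∃ M, 0 ≤ M ∧ ∀ x,
      |(fun v : E → ℝ => Δ v)^[l] (tangentCut V x₀ hδ) x| ≤ M ∧
      ‖fderiv ℝ ((fun v : E → ℝ => Δ v)^[l] (tangentCut V x₀ hδ)) x‖ ≤ M ∧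
      (2 * δ < ‖V.starProjection (x - x₀)‖ →
        (fun v : E → ℝ => Δ v)^[l] (tangentCut V x₀ hδ) x = 0 ∧
        fderiv ℝ ((fun v : E → ℝ => Δ v)^[l] (tangentCut V x₀ hδ)) x = 0) := by
    intro l
    set ψ := (fun v : E → ℝ => Δ v)^[l] (tangentCut V x₀ hδ) with hψdef
    have hψ : ContDiff ℝ ∞ ψ := contDiff_iterate_laplacian (contDiff_tangentCut V x₀ hδ) l
    have hc : ConstAlong Vᗮ ψ := (constAlong_tangentCut V x₀ hδ).iterate_laplacian l
    have hz : ∀ x, 2 * δ < ‖V.starProjection (x - x₀)‖ → ψ =ᶠ[𝓝 x] 0 := fun x hx =>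
      iterate_laplacian_eventuallyEq_zero (tangentCut_eventuallyEq_zero V x₀ hδ hx) l
    obtain ⟨M₁, hM₁, h1⟩ := exists_bound_of_constAlong V x₀ hψ.continuous hc
      (ε := 2 * δ) fun x hx => (hz x hx).eq_of_nhds
    obtain ⟨M₂, hM₂, h2⟩ := exists_bound_of_constAlong V x₀ (hψ.continuous_fderiv (by simp))
      (ε := 2 * δ) (fun x v hv => by
        rw [← fderiv_comp_add_right]
        congr 1
        ext y
        exact hc y v hv) fun x hx => by
        rw [(hz x hx).fderiv_eq]
        simp
    refine ⟨max M₁ M₂, le_max_of_le_left hM₁, fun x => ⟨(h1 x).1.trans (le_max_left _ _),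
      (h2 x).1.trans (le_max_right _ _), fun hx => ⟨(h1 x).2 hx, (h2 x).2 hx⟩⟩⟩
  choose M hM0 hM using key
  refine ⟨∑ l ∈ Finset.range (m + 1), M l, Finset.sum_nonneg fun l _ => hM0 l,
    fun l hl x => ?_⟩
  have hle : M l ≤ ∑ l ∈ Finset.range (m + 1), M l :=
    Finset.single_le_sum (fun l _ => hM0 l) (Finset.mem_range.2 (by omega))
  exact ⟨(hM l x).1.trans hle, (hM l x).2.1.trans hle, (hM l x).2.2⟩

end Tangential

/-! ### The distance as the norm of the normal component. -/

section Distance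

theorem dist_eq_norm_starProjection {N : ℕ} {K : AffineSubspace ℝ (EuclideanSpace ℝ (Fin N))}
    {x₀ : EuclideanSpace ℝ (Fin N)} (hx₀ : x₀ ∈ K) (x : EuclideanSpace ℝ (Fin N)) :
    dist K x = ‖K.directionᗮ.starProjection (x - x₀)‖ := by
  have : Nonempty K := ⟨⟨x₀, hx₀⟩⟩
  have h1 : (EuclideanGeometry.orthogonalProjection K x : EuclideanSpace ℝ (Fin N)) =
      K.direction.starProjection (x - x₀) + x₀ := by
    refine (EuclideanGeometry.coe_orthogonalProjection_eq_iff_mem).2 ⟨?_, ?_⟩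
    · exact AffineSubspace.vadd_mem_of_mem_direction
        (Submodule.starProjection_apply_mem _ _) hx₀
    · rw [vsub_eq_sub, ← sub_sub, sub_right_comm]
      exact Submodule.sub_starProjection_mem_orthogonal _
  rw [dist, ← EuclideanGeometry.dist_orthogonalProjection_eq_infDist, dist_eq_norm, h1,
    Submodule.starProjection_orthogonal_val]
  congr 1
  abel

end Distance

/-! ### The constants |A| and |B| in terms of the factors of the operator. -/

section Factors

theorem prod_evenFactors (p σ : ℝ) (k j : ℕ) : |(evenFactors σ k j).prod| ^ p =
    (∏ i ∈ Finset.range j, |σ - 2 * i| ^ p) * ∏ i ∈ Finset.Icc 1 j, |σ + k - 2 * i| ^ p := by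
  induction j with
  | zero => simp [evenFactors]
  | succ j ih =>
    rw [evenFactors, List.prod_cons, List.prod_cons, abs_mul, abs_mul,
      Real.mul_rpow (abs_nonneg _) (by positivity), Real.mul_rpow (abs_nonneg _) (abs_nonneg _), ih,
      Finset.prod_range_succ, Finset.prod_Icc_succ_top (by omega)]
    push_cast
    rw [show σ + (k : ℝ) - 2 - 2 * j = σ + k - 2 * (j + 1) by ring]
    ring

theorem sum_evenFactors (σ : ℝ) (k j : ℕ) :
    ((evenFactors σ k j).map fun c => (c ^ 2)⁻¹).sum =
    (∑ i ∈ Finset.range j, ((σ - 2 * i) ^ 2)⁻¹) +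
      ∑ i ∈ Finset.Icc 1 j, ((σ + k - 2 * i) ^ 2)⁻¹ := by
  induction j with
  | zero => simp [evenFactors]
  | succ j ih =>
    rw [evenFactors, List.map_cons, List.sum_cons, List.map_cons, List.sum_cons, ih,
      Finset.sum_range_succ, Finset.sum_Icc_succ_top (by omega)]
    push_cast
    rw [show σ + (k : ℝ) - 2 - 2 * j = σ + k - 2 * (j + 1) by ring]
    ring

theorem ne_zero_of_mem_evenFactors {σ : ℝ} {k j : ℕ} (h1 : ∀ i < j, σ - 2 * (i : ℝ) ≠ 0)
    (h2 : ∀ i, 1 ≤ i → i ≤ j → σ + k - 2 * (i : ℝ) ≠ 0) : ∀ c ∈ evenFactors σ k j, c ≠ 0 := by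
  induction j with
  | zero => simp [evenFactors]
  | succ j ih =>
    intro c hc
    rw [evenFactors, List.mem_cons, List.mem_cons] at hc
    rcases hc with rfl | rfl | hc
    · exact h1 j (by omega)
    · have := h2 (j + 1) (by omega) le_rfl
      push_cast at this
      intro h
      exact this (by linarith)
    · exact ih (fun i hi => h1 i (by omega)) (fun i hi hi' => h2 i hi (by omega)) c hc

variable {p : ℝ} (γ : ℝ) (k m : ℕ)

/-- The critical exponent `(mp + γ - k)/p` of the distance. -/
noncomputable def critExp (p γ : ℝ) (k m : ℕ) : ℝ := (m * p + γ - k) / p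

theorem critExp_mul (hp : p ≠ 0) : critExp p γ k m * p = m * p + γ - k :=
  div_mul_cancel₀ _ hp

theorem factorA'_eq (hp : p ≠ 0) (i : ℕ) :
    factorA' p γ k m i = -(critExp p γ k m - 2 * i) := by
  rw [factorA', critExp]; field_simp; ring

theorem factorA''_eq (hp : p ≠ 0) (j : ℕ) :
    factorA'' p γ k m j = critExp p γ k m + k - 2 * j := by
  rw [factorA'', critExp]; field_simp; ring

/-- With σ the critical exponent, a_i = -(σ - 2i) and b_j = σ + k - 2j. The assumption m ≥ 1 makes
the number (m-1)/2 + 1 of the a_i equal to m/2 for even m; with truncated subtraction this fails at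
m = 0. -/
theorem absA_eq (hp : p ≠ 0) (hm : 1 ≤ m) :
    absA p γ k m = |(lapFactors (critExp p γ k m) k m).prod| ^ p := by
  simp only [absA, factorA'_eq γ k m hp, factorA''_eq γ k m hp, abs_neg]
  rw [lapFactors]
  split_ifs with h
  · rw [prod_evenFactors]
    obtain ⟨j, rfl⟩ := h
    rw [show (j + j - 1) / 2 + 1 = (j + j) / 2 by omega]
  · obtain ⟨j, rfl⟩ := Nat.not_even_iff_odd.1 h
    rw [List.prod_cons, abs_mul, Real.mul_rpow (abs_nonneg _) (abs_nonneg _), prod_evenFactors,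
      show (2 * j + 1 - 1) / 2 = j by omega, show (2 * j + 1) / 2 = j by omega,
      Finset.prod_range_succ]
    ring

theorem absB_eq (hp : p ≠ 0) (hm : 1 ≤ m) :
    absB p γ k m = listB p (lapFactors (critExp p γ k m) k m) := by
  rw [absB, listB, absA_eq γ k m hp hm]
  congr 1
  simp only [factorA'_eq γ k m hp, factorA''_eq γ k m hp, neg_sq]
  rw [lapFactors]
  split_ifs with h
  · rw [sum_evenFactors]
    obtain ⟨j, rfl⟩ := h
    rw [show (j + j - 1) / 2 + 1 = (j + j) / 2 by omega]
  · obtain ⟨j, rfl⟩ := Nat.not_even_iff_odd.1 h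
    rw [List.map_cons, List.sum_cons, sum_evenFactors,
      show (2 * j + 1 - 1) / 2 = j by omega, show (2 * j + 1) / 2 = j by omega,
      Finset.sum_range_succ]
    ring

theorem ne_zero_of_mem_lapFactors (hp : p ≠ 0) (hm : 1 ≤ m)
    (hA' : ∀ i : ℕ, i ≤ (m - 1) / 2 → factorA' p γ k m i ≠ 0)
    (hA'' : ∀ j : ℕ, 1 ≤ j → j ≤ m / 2 → factorA'' p γ k m j ≠ 0) :
    ∀ c ∈ lapFactors (critExp p γ k m) k m, c ≠ 0 := by
  simp only [factorA'_eq γ k m hp, factorA''_eq γ k m hp, neg_ne_zero] at hA' hA''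
  rw [lapFactors]
  split_ifs with h
  · obtain ⟨j, rfl⟩ := h
    exact ne_zero_of_mem_evenFactors (fun i hi => hA' i (by omega)) hA''
  · obtain ⟨j, rfl⟩ := Nat.not_even_iff_odd.1 h
    intro c hc
    rcases List.mem_cons.1 hc with rfl | hc
    · exact hA' _ le_rfl
    · exact ne_zero_of_mem_evenFactors (fun i hi => hA' i (by omega))
        (fun i hi hi' => hA'' i hi (by omega)) c hc

end Factors

/-! ### Support and smoothness of the test functions. -/

section TestFunction

open Filter Topology Set

variable {N : ℕ} (V : Submodule ℝ (EuclideanSpace ℝ (Fin N))) (x₀ : EuclideanSpace ℝ (Fin N))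

theorem mem_Icc_sub_logDist_iff {c T₁ T₂ : ℝ} (hc : c < T₁) (x : EuclideanSpace ℝ (Fin N)) :
    c - logDist V x₀ x ∈ Icc T₁ T₂ ↔
      ‖V.starProjection (x - x₀)‖ ∈ Icc (Real.exp (c - T₂)) (Real.exp (c - T₁)) := by
  rw [logDist]
  rcases (norm_nonneg (V.starProjection (x - x₀))).eq_or_lt with h | h
  -- On the affine subspace itself the convention log 0 = 0 puts c - `logDist` at c, outside the
  -- interval because c < T₁.
  · rw [← h, Real.log_zero, sub_zero]
    exact ⟨fun h' => absurd h'.1 (not_le.2 hc), fun h' => absurd h'.1 (not_le.2 (Real.exp_pos _))⟩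
  · rw [mem_Icc, mem_Icc, ← Real.log_le_iff_le_exp h, ← Real.le_log_iff_exp_le h]
    constructor <;> rintro ⟨h1, h2⟩ <;> constructor <;> linarith

/-- The points whose normal distance lies in `[e^{c - T₂}, e^{c - T₁}]` and whose tangential
distance is at most `2δ`. -/
def shell (c T₁ T₂ δ : ℝ) : Set (EuclideanSpace ℝ (Fin N)) :=
  {x | ‖Vᗮ.starProjection (x - x₀)‖ ∈ Icc (Real.exp (c - T₂)) (Real.exp (c - T₁)) ∧
    ‖V.starProjection (x - x₀)‖ ≤ 2 * δ}

theorem isClosed_shell (c T₁ T₂ δ : ℝ) : IsClosed (shell V x₀ c T₁ T₂ δ) := by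
  have h1 : Continuous fun x => ‖Vᗮ.starProjection (x - x₀)‖ := by fun_prop
  have h2 : Continuous fun x => ‖V.starProjection (x - x₀)‖ := by fun_prop
  exact (isClosed_Icc.preimage h1).inter (isClosed_le h2 continuous_const)

theorem shell_subset_closedBall {c T₁ T₂ δ : ℝ} (h : Real.exp (c - T₁) ≤ δ) :
    shell V x₀ c T₁ T₂ δ ⊆ Metric.closedBall x₀ (3 * δ) := by
  rintro x ⟨h1, h2⟩
  have h3 : x - x₀ = V.starProjection (x - x₀) + Vᗮ.starProjection (x - x₀) :=
    (V.starProjection_add_starProjection_orthogonal (x - x₀)).symm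
  rw [mem_closedBall_iff_norm, h3]
  exact (norm_add_le _ _).trans (by linarith [h1.2])

theorem starProjection_ne_zero_of_mem_shell {c T₁ T₂ δ : ℝ} {x : EuclideanSpace ℝ (Fin N)}
    (hx : x ∈ shell V x₀ c T₁ T₂ δ) : Vᗮ.starProjection (x - x₀) ≠ 0 := fun h => by
  have := hx.1.1
  rw [h, norm_zero] at this
  exact absurd this (not_le.2 (Real.exp_pos _))

/-- A power of the distance, times a profile in the logarithm of the distance, times a tangential
cutoff. -/
noncomputable def testFun (c σ : ℝ) (h : ℝ → ℝ) {δ : ℝ} (hδ : 0 < δ)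
    (x : EuclideanSpace ℝ (Fin N)) : ℝ :=
  radial c σ h (logDist Vᗮ x₀ x) * tangentCut V x₀ hδ x

variable {c T₁ T₂ δ : ℝ} (σ : ℝ) {h : ℝ → ℝ} (hδ : 0 < δ)

theorem testFun_eq_zero (hc : c < T₁) (h0 : ∀ τ ∉ Icc T₁ T₂, h τ = 0)
    {x : EuclideanSpace ℝ (Fin N)} (hx : x ∉ shell V x₀ c T₁ T₂ δ) :
    testFun V x₀ c σ h hδ x = 0 := by
  rw [testFun]
  by_cases h1 : ‖Vᗮ.starProjection (x - x₀)‖ ∈ Icc (Real.exp (c - T₂)) (Real.exp (c - T₁))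
  · have h2 : ¬ ‖V.starProjection (x - x₀)‖ ≤ 2 * δ := fun h2 => hx ⟨h1, h2⟩
    rw [tangentCut_eq_zero V x₀ hδ (not_le.1 h2).le, mul_zero]
  · rw [radial, h0 _ (fun h2 => h1 ((mem_Icc_sub_logDist_iff Vᗮ x₀ hc x).1 h2)), mul_zero, zero_mul]

theorem testFun_eventuallyEq_zero (hc : c < T₁) (h0 : ∀ τ ∉ Icc T₁ T₂, h τ = 0)
    {x : EuclideanSpace ℝ (Fin N)} (hx : x ∉ shell V x₀ c T₁ T₂ δ) :
    testFun V x₀ c σ h hδ =ᶠ[𝓝 x] 0 := by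
  filter_upwards [(isClosed_shell V x₀ c T₁ T₂ δ).isOpen_compl.mem_nhds hx] with y hy
  exact testFun_eq_zero V x₀ σ hδ hc h0 hy

theorem contDiff_testFun (hc : c < T₁) (h0 : ∀ τ ∉ Icc T₁ T₂, h τ = 0) (hh : ContDiff ℝ ∞ h) :
    ContDiff ℝ ∞ (testFun V x₀ c σ h hδ) := by
  refine contDiff_iff_contDiffAt.2 fun x => ?_
  by_cases hx : x ∈ shell V x₀ c T₁ T₂ δ
  · exact contDiffAt_radial_mul (contDiff_radial hh c σ) (contDiff_tangentCut V x₀ hδ)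
      (starProjection_ne_zero_of_mem_shell V x₀ hx)
  · exact contDiffAt_const.congr_of_eventuallyEq (testFun_eventuallyEq_zero V x₀ σ hδ hc h0 hx)

theorem isTest_testFun (hc : c < T₁) (h0 : ∀ τ ∉ Icc T₁ T₂, h τ = 0) (hh : ContDiff ℝ ∞ h)
    {U : Set (EuclideanSpace ℝ (Fin N))} (hU : shell V x₀ c T₁ T₂ δ ⊆ U) :
    IsTest U (testFun V x₀ c σ h hδ) := by
  have hsupp : Function.support (testFun V x₀ c σ h hδ) ⊆ shell V x₀ c T₁ T₂ δ := fun x hx => by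
    by_contra hx'
    exact hx (testFun_eq_zero V x₀ σ hδ hc h0 hx')
  have hcl := isClosed_shell V x₀ c T₁ T₂ δ
  refine ⟨contDiff_testFun V x₀ σ hδ hc h0 hh, ?_, (closure_minimal hsupp hcl).trans hU⟩
  have hb : Bornology.IsBounded (shell V x₀ c T₁ T₂ δ) := by
    refine (Metric.isBounded_closedBall (x := x₀) (r := Real.exp (c - T₁) + 2 * δ)).subset ?_
    rintro x ⟨h1, h2⟩
    rw [mem_closedBall_iff_norm, ← V.starProjection_add_starProjection_orthogonal (x - x₀)]
    exact (norm_add_le _ _).trans (by linarith [h1.2])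
  exact HasCompactSupport.of_support_subset_isCompact
    (Metric.isCompact_of_isClosed_isBounded hcl hb) hsupp

theorem absLap_eq_zero {u : EuclideanSpace ℝ (Fin N) → ℝ} {x : EuclideanSpace ℝ (Fin N)}
    (hu : u =ᶠ[𝓝 x] 0) (m : ℕ) : absLap m u x = 0 := by
  rw [absLap]
  split_ifs
  · rw [(iterate_laplacian_eventuallyEq_zero hu _).eq_of_nhds]; simp
  · rw [gradient, (iterate_laplacian_eventuallyEq_zero hu _).fderiv_eq]; simp

theorem absLap_nonneg (m : ℕ) (u : EuclideanSpace ℝ (Fin N) → ℝ) (x : EuclideanSpace ℝ (Fin N)) :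
    0 ≤ absLap m u x := by
  rw [absLap]; split_ifs <;> positivity

theorem shell_subset_diff {K : AffineSubspace ℝ (EuclideanSpace ℝ (Fin N))} (hx₀ : x₀ ∈ K)
    {Ω : Set (EuclideanSpace ℝ (Fin N))} (hΩ : Metric.closedBall x₀ (3 * δ) ⊆ Ω)
    (hT : Real.exp (c - T₁) ≤ δ) :
    shell K.direction x₀ c T₁ T₂ δ ⊆ Ω \ (K : Set (EuclideanSpace ℝ (Fin N))) := by
  refine fun x hx => ⟨hΩ (shell_subset_closedBall _ _ hT hx), fun hxK => ?_⟩
  refine starProjection_ne_zero_of_mem_shell _ _ hx ?_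
  rw [Submodule.starProjection_apply_eq_zero_iff, Submodule.orthogonal_orthogonal]
  exact AffineSubspace.vsub_mem_direction hxK hx₀

end TestFunction

/-! ### Bounds uniform in R for the radial factors, and a convexity inequality. -/

section UniformBound

theorem logProd_rpow_bound {p : ℝ} {r l n a : ℕ} {f : ℝ → ℝ → ℝ} (h : HasProfileForm p r l n a f) :
    ∃ C, 0 ≤ C ∧ ∀ R, 1 ≤ R → ∀ τ, 1 < τ → |f R τ| ≤ C * logProd (r + 1) τ ^ (1 / p) := by
  obtain ⟨C, hC, hb⟩ := h.bound
  refine ⟨C, hC, fun R hR τ hτ => (hb R hR τ hτ).trans ?_⟩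
  have h1 : (τ ^ a)⁻¹ ≤ 1 := inv_le_one_of_one_le₀ (one_le_pow₀ hτ.le)
  have h2 : cut (iterLog (r + 1) τ / R) ^ l ≤ 1 := pow_le_one₀ (cut_nonneg _) (cut_le_one _)
  have h3 : 0 ≤ logProd (r + 1) τ ^ (1 / p) := Real.rpow_nonneg (logProd_pos _ hτ.le).le _
  have h4 : (0 : ℝ) ≤ (τ ^ a)⁻¹ := by positivity
  calc C * (τ ^ a)⁻¹ * (logProd (r + 1) τ ^ (1 / p) * cut (iterLog (r + 1) τ / R) ^ l)
      ≤ C * 1 * (logProd (r + 1) τ ^ (1 / p) * 1) := by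
        have := cut_nonneg (iterLog (r + 1) τ / R)
        gcongr
    _ = _ := by ring

theorem exists_bound_evenOp_profile (p σ : ℝ) (r k m n : ℕ) (hn : 2 * m + 1 ≤ n) :
    ∃ C, 0 ≤ C ∧ ∀ i ≤ m, ∀ R, 1 ≤ R → ∀ τ, 1 < τ →
      |evenOp σ k i (profile p r n R) τ| ≤ C * logProd (r + 1) τ ^ (1 / p) ∧
      |stepOp (σ - 2 * i) (evenOp σ k i (profile p r n R)) τ| ≤
        C * logProd (r + 1) τ ^ (1 / p) := by
  have key : ∀ i : ℕ, ∃ C, 0 ≤ C ∧ (i ≤ m → ∀ R, 1 ≤ R → ∀ τ, 1 < τ →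
      |evenOp σ k i (profile p r n R) τ| ≤ C * logProd (r + 1) τ ^ (1 / p) ∧
      |stepOp (σ - 2 * i) (evenOp σ k i (profile p r n R)) τ| ≤
        C * logProd (r + 1) τ ^ (1 / p)) := by
    intro i
    by_cases hi : i ≤ m
    · have h1 : HasProfileForm p r (n - 2 * i - 1 + 1) (0 + 1) 0
          fun R => evenOp σ k i (profile p r n R) := by
        simp only [evenOp_eq_listOp]
        refine HasProfileForm.listOp _ ?_
        rw [length_evenFactors, show n - 2 * i - 1 + 1 + 2 * i = n by omega]
        exact hasProfileForm_profile p r n _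
      obtain ⟨C₁, hC₁, b1⟩ := logProd_rpow_bound h1
      obtain ⟨C₂, hC₂, b2⟩ := logProd_rpow_bound (h1.stepOp (σ - 2 * i))
      refine ⟨max C₁ C₂, le_max_of_le_left hC₁, fun _ R hR τ hτ => ?_⟩
      have h3 : 0 ≤ logProd (r + 1) τ ^ (1 / p) := Real.rpow_nonneg (logProd_pos _ hτ.le).le _
      exact ⟨(b1 R hR τ hτ).trans (mul_le_mul_of_nonneg_right (le_max_left _ _) h3),
        (b2 R hR τ hτ).trans (mul_le_mul_of_nonneg_right (le_max_right _ _) h3)⟩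
    · exact ⟨0, le_rfl, fun h => absurd h hi⟩
  choose C hC0 hC using key
  refine ⟨∑ i ∈ Finset.range (m + 1), C i, Finset.sum_nonneg fun i _ => hC0 i,
    fun i hi R hR τ hτ => ?_⟩
  have hle : C i ≤ ∑ i ∈ Finset.range (m + 1), C i :=
    Finset.single_le_sum (fun i _ => hC0 i) (Finset.mem_range.2 (by omega))
  have h3 : 0 ≤ logProd (r + 1) τ ^ (1 / p) := Real.rpow_nonneg (logProd_pos _ hτ.le).le _
  obtain ⟨a1, a2⟩ := hC i hi R hR τ hτ
  exact ⟨a1.trans (mul_le_mul_of_nonneg_right hle h3),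
    a2.trans (mul_le_mul_of_nonneg_right hle h3)⟩

/-- Bernoulli's inequality at the point x + e, that is, the tangent line lies below the convex
function t^p. -/
theorem add_rpow_le {p x e : ℝ} (hp : 1 ≤ p) (hx : 0 ≤ x) (he : 0 ≤ e) :
    (x + e) ^ p ≤ x ^ p + p * e * (x + e) ^ (p - 1) := by
  rcases (add_nonneg hx he).eq_or_lt with h | h
  · have h1 : e = 0 := by linarith
    rw [h1]; simp
  · have hb := one_add_mul_self_le_rpow_one_add (s := -(e / (x + e))) (p := p)
      (neg_le_neg ((div_le_one h).2 (by linarith))) hp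
    have h1 : 1 + -(e / (x + e)) = x / (x + e) := by field_simp; ring
    rw [h1, Real.div_rpow hx h.le, le_div_iff₀ (Real.rpow_pos_of_pos h _)] at hb
    have h2 : (x + e) ^ p = (x + e) ^ (p - 1) * (x + e) := by
      rw [← Real.rpow_add_one h.ne']; simp
    have h3 : (1 + p * -(e / (x + e))) * (x + e) ^ p =
        (x + e) ^ p - p * e * (x + e) ^ (p - 1) := by
      rw [h2]; field_simp; ring
    linarith

theorem prod_X_sq (i : ℕ) (t : ℝ) :
    ∏ j ∈ Finset.Icc 1 i, X j t ^ 2 = (logProd i (1 - Real.log t) ^ 2)⁻¹ := by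
  induction i with
  | zero => simp [logProd]
  | succ i ih =>
    rw [Finset.prod_Icc_succ_top (by omega), ih, X_succ_eq, logProd_succ, mul_pow, mul_inv, inv_pow]

end UniformBound

/-! ### Both sides of the inequality evaluated on the test functions. -/

section TestIntegrals

open Filter Topology Set

variable {N : ℕ} {K : AffineSubspace ℝ (EuclideanSpace ℝ (Fin N))}
  {x₀ : EuclideanSpace ℝ (Fin N)}

theorem dist_rpow_eq (hx₀ : x₀ ∈ K) {x : EuclideanSpace ℝ (Fin N)}
    (hx : K.directionᗮ.starProjection (x - x₀) ≠ 0) (s : ℝ) :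
    dist K x ^ s = Real.exp (s * logDist K.directionᗮ x₀ x) := by
  rw [dist_eq_norm_starProjection hx₀, Real.rpow_def_of_pos (norm_pos_iff.2 hx), logDist, mul_comm]

theorem exp_logDist (hx₀ : x₀ ∈ K) {x : EuclideanSpace ℝ (Fin N)}
    (hx : K.directionᗮ.starProjection (x - x₀) ≠ 0) :
    Real.exp (logDist K.directionᗮ x₀ x) = dist K x := by
  rw [dist_eq_norm_starProjection hx₀, logDist, Real.exp_log (norm_pos_iff.2 hx)]

/-- The mass of the angular and tangential variables. -/
noncomputable def sliceMass (V : Submodule ℝ (EuclideanSpace ℝ (Fin N))) (β : V → ℝ) : ℝ :=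
  (Module.finrank ℝ Vᗮ : ℝ) * (volume : Measure Vᗮ).real (Metric.ball 0 1) * ∫ v, β v

/-- The critical exponent is chosen so that -γ - mp + σp = -k, exactly the power of d that polar
coordinates cancel. -/
theorem integral_weight_testFun [Nontrivial K.directionᗮ] (hx₀ : x₀ ∈ K) {p γ : ℝ} (hp : 0 < p)
    {m : ℕ} {c T₁ T₂ δ : ℝ} (hδ : 0 < δ) (hc : c < T₁) {h : ℝ → ℝ} (hh0 : ∀ τ, 0 ≤ h τ)
    (h0 : ∀ τ ∉ Icc T₁ T₂, h τ = 0) {Ω : Set (EuclideanSpace ℝ (Fin N))}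
    (hΩ : shell K.direction x₀ c T₁ T₂ δ ⊆ Ω) (w : ℝ → ℝ) :
    ∫ x in Ω, dist K x ^ (-γ - (m : ℝ) * p) * w (dist K x) *
      |testFun K.direction x₀ c (critExp p γ (Module.finrank ℝ K.directionᗮ) m) h hδ x| ^ p =
    sliceMass K.direction (fun v => tangentBump K.direction hδ v ^ p) *
      ∫ τ in Icc T₁ T₂, w (Real.exp (c - τ)) * h τ ^ p := by
  set k := Module.finrank ℝ K.directionᗮ
  set σ := critExp p γ k m with hσ
  have hσp : σ * p = m * p + γ - k := critExp_mul γ k m hp.ne'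
  rw [setIntegral_eq_integral_of_forall_compl_eq_zero fun x hx => by
    rw [testFun_eq_zero K.direction x₀ σ hδ hc h0 fun hx' => hx (hΩ hx'), abs_zero,
      Real.zero_rpow hp.ne', mul_zero]]
  rw [← integral_indicator measurableSet_Icc, sliceMass,
    ← integral_normal_mul_tangential K.direction x₀ c]
  congr 1 with x
  by_cases hx : c - logDist K.directionᗮ x₀ x ∈ Icc T₁ T₂
  · have hP : K.directionᗮ.starProjection (x - x₀) ≠ 0 := fun h => by
      have := ((mem_Icc_sub_logDist_iff K.directionᗮ x₀ hc x).1 hx).1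
      rw [h, norm_zero] at this
      exact absurd this (not_le.2 (Real.exp_pos _))
    rw [indicator_of_mem hx, sub_sub_cancel, exp_logDist hx₀ hP, dist_rpow_eq hx₀ hP, testFun,
      radial, abs_mul, abs_of_nonneg (mul_nonneg (Real.exp_pos _).le (hh0 _)),
      abs_of_nonneg (tangentCut_nonneg _ _ _ _),
      Real.mul_rpow (mul_nonneg (Real.exp_pos _).le (hh0 _)) (tangentCut_nonneg _ _ _ _),
      Real.mul_rpow (Real.exp_pos _).le (hh0 _), ← Real.exp_mul, tangentCut]
    have he : Real.exp (-(k : ℝ) * logDist K.directionᗮ x₀ x) =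
        Real.exp ((-γ - (m : ℝ) * p) * logDist K.directionᗮ x₀ x) *
          Real.exp (σ * logDist K.directionᗮ x₀ x * p) := by
      rw [← Real.exp_add]
      congr 1
      linear_combination (-logDist K.directionᗮ x₀ x) * hσp
    rw [he]
    ring
  · rw [indicator_of_notMem hx, testFun_eq_zero K.direction x₀ σ hδ hc h0 fun hx' =>
      hx ((mem_Icc_sub_logDist_iff K.directionᗮ x₀ hc x).2 hx'.1), abs_zero,
      Real.zero_rpow hp.ne', mul_zero, mul_zero, zero_mul]

/-- The same balance -γ + (σ-m)p = -k applies to the leading term. The lower order terms carry e^ρ =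
e^c e^{-τ} and are split off by `add_rpow_le`. Derivatives of the tangential cutoff are not
controlled by the cutoff itself, so the error is integrated against the indicator of its support
ball. -/
theorem integral_absLap_testFun_le [Nontrivial K.directionᗮ] (hx₀ : x₀ ∈ K) {p γ : ℝ} (hp : 1 < p)
    {m : ℕ} {c T₁ T₂ δ G M : ℝ} (hδ : 0 < δ) (hc : c < T₁) {h ℓ : ℝ → ℝ} (hh : ContDiff ℝ ∞ h)
    (h0 : ∀ τ ∉ Icc T₁ T₂, h τ = 0) {Ω : Set (EuclideanSpace ℝ (Fin N))}
    (hΩ : shell K.direction x₀ c T₁ T₂ δ ⊆ Ω) (hG0 : 0 ≤ G) (hM0 : 0 ≤ M)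
    (hℓ : ∀ τ ∈ Icc T₁ T₂, 0 ≤ ℓ τ) (hℓc : ContinuousOn ℓ (Icc T₁ T₂))
    (hG : ∀ i ≤ m, ∀ τ ∈ Icc T₁ T₂,
      |evenOp (critExp p γ (Module.finrank ℝ K.directionᗮ) m)
        (Module.finrank ℝ K.directionᗮ) i h τ| ≤ G * ℓ τ ^ (1 / p) ∧
      |stepOp (critExp p γ (Module.finrank ℝ K.directionᗮ) m - 2 * i)
        (evenOp (critExp p γ (Module.finrank ℝ K.directionᗮ) m)
          (Module.finrank ℝ K.directionᗮ) i h) τ| ≤ G * ℓ τ ^ (1 / p))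
    (hM : ∀ l ≤ m, ∀ x,
      |(fun v : EuclideanSpace ℝ (Fin N) → ℝ => Laplacian.laplacian v)^[l]
        (tangentCut K.direction x₀ hδ) x| ≤ M ∧
      ‖fderiv ℝ ((fun v : EuclideanSpace ℝ (Fin N) → ℝ => Laplacian.laplacian v)^[l]
        (tangentCut K.direction x₀ hδ)) x‖ ≤ M) :
    ∫ x in Ω, dist K x ^ (-γ) * absLap m
      (testFun K.direction x₀ c (critExp p γ (Module.finrank ℝ K.directionᗮ) m) h hδ) x ^ p ≤
    sliceMass K.direction (fun v => tangentBump K.direction hδ v ^ p) *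
      (∫ τ in Icc T₁ T₂, |lapOp (critExp p γ (Module.finrank ℝ K.directionᗮ) m)
        (Module.finrank ℝ K.directionᗮ) m h τ| ^ p) +
    sliceMass K.direction ((Metric.closedBall 0 (2 * δ)).indicator 1) *
      (p * (2 * 2 ^ m * G * M) * (G + 2 * 2 ^ m * G * M) ^ (p - 1) * Real.exp c) *
      ∫ τ in Icc T₁ T₂, Real.exp (-τ) * ℓ τ := by
  set k := Module.finrank ℝ K.directionᗮ
  set σ := critExp p γ k m with hσ
  have hp0 : 0 < p := by linarith
  have hσp : σ * p = m * p + γ - k := critExp_mul γ k m hp0.ne'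
  set e₀ := 2 * 2 ^ m * G * M with he₀
  have he₀0 : 0 ≤ e₀ := by positivity
  set C₃ := p * e₀ * (G + e₀) ^ (p - 1) * Real.exp c with hC₃
  have hlap : ∀ τ ∈ Icc T₁ T₂, |lapOp σ k m h τ| ≤ G * ℓ τ ^ (1 / p) := fun τ hτ => by
    rw [lapOp]
    split_ifs
    · exact (hG _ (Nat.div_le_self _ _) τ hτ).1
    · exact (hG ((m - 1) / 2) (by omega) τ hτ).2
  have hz : ∀ x ∉ shell K.direction x₀ c T₁ T₂ δ, dist K x ^ (-γ) *
      absLap m (testFun K.direction x₀ c σ h hδ) x ^ p = 0 := fun x hx => by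
    rw [absLap_eq_zero (testFun_eventuallyEq_zero K.direction x₀ σ hδ hc h0 hx),
      Real.zero_rpow hp0.ne', mul_zero]
  rw [setIntegral_eq_integral_of_forall_compl_eq_zero fun x hx => hz x fun hx' => hx (hΩ hx')]
  set F₁ := (Icc T₁ T₂).indicator fun τ => |lapOp σ k m h τ| ^ p with hF₁
  set F₂ := (Icc T₁ T₂).indicator fun τ => C₃ * (Real.exp (-τ) * ℓ τ) with hF₂
  have hF₁0 : ∀ τ, 0 ≤ F₁ τ := fun τ => indicator_nonneg (fun _ _ => by positivity) _
  have hF₂0 : ∀ τ, 0 ≤ F₂ τ := fun τ => indicator_nonneg (fun τ hτ => by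
    have := hℓ τ hτ
    positivity) _
  have iF₁ : Integrable F₁ := by
    refine (ContinuousOn.integrableOn_compact isCompact_Icc ?_).integrable_indicator
      measurableSet_Icc
    rw [lapOp_eq_listOp]
    exact (contDiff_listOp hh _).continuous.abs.continuousOn.rpow_const fun _ _ => Or.inr hp0.le
  have iF₂ : Integrable F₂ := by
    refine (ContinuousOn.integrableOn_compact isCompact_Icc ?_).integrable_indicator
      measurableSet_Icc
    exact continuousOn_const.mul ((Real.continuous_exp.comp continuous_neg).continuousOn.mul hℓc)
  have iβ₁ : Integrable fun v => tangentBump K.direction hδ v ^ p := by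
    refine Continuous.integrable_of_hasCompactSupport
      ((tangentBump K.direction hδ).continuous.rpow_const fun _ => Or.inr hp0.le) ?_
    exact (tangentBump K.direction hδ).hasCompactSupport.comp_left
      (g := fun s : ℝ => s ^ p) (Real.zero_rpow hp0.ne')
  have iβ₂ : Integrable ((Metric.closedBall (0 : K.direction) (2 * δ)).indicator (1 : K.direction → ℝ)) := by
    refine IntegrableOn.integrable_indicator ?_ measurableSet_closedBall
    exact continuousOn_const.integrableOn_compact (isCompact_closedBall _ _)
  have hbound : ∀ x, dist K x ^ (-γ) * absLap m (testFun K.direction x₀ c σ h hδ) x ^ p ≤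
      Real.exp (-(k : ℝ) * logDist K.directionᗮ x₀ x) * F₁ (c - logDist K.directionᗮ x₀ x) *
        tangentBump K.direction hδ (K.direction.orthogonalProjectionOnto (x - x₀)) ^ p +
      Real.exp (-(k : ℝ) * logDist K.directionᗮ x₀ x) * F₂ (c - logDist K.directionᗮ x₀ x) *
        (Metric.closedBall (0 : K.direction) (2 * δ)).indicator (1 : K.direction → ℝ)
          (K.direction.orthogonalProjectionOnto (x - x₀)) := by
    intro x
    by_cases hx : x ∈ shell K.direction x₀ c T₁ T₂ δ
    · have hP := starProjection_ne_zero_of_mem_shell _ _ hx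
      have hτ := (mem_Icc_sub_logDist_iff K.directionᗮ x₀ hc x).2 hx.1
      have hQ : K.direction.orthogonalProjectionOnto (x - x₀) ∈
          Metric.closedBall (0 : K.direction) (2 * δ) := by
        rw [mem_closedBall_zero_iff, ← norm_starProjection_eq]
        exact hx.2
      rw [indicator_of_mem hQ, hF₁, hF₂, indicator_of_mem hτ, indicator_of_mem hτ, Pi.one_apply,
        mul_one, dist_rpow_eq hx₀ hP]
      set ρ := logDist K.directionᗮ x₀ x with hρ
      set τ := c - ρ with hτdef
      set φ := tangentBump K.direction hδ (K.direction.orthogonalProjectionOnto (x - x₀))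
      have hρ0 : ρ ≤ 0 := by linarith [hτ.1]
      have hφ0 : 0 ≤ φ := ContDiffBump.nonneg _
      have hφ1 : φ ≤ 1 := ContDiffBump.le_one _
      set a := |lapOp σ k m h τ|
      have ha0 : 0 ≤ a := abs_nonneg _
      have ha : a ≤ G * ℓ τ ^ (1 / p) := hlap τ hτ
      set lam := ℓ τ ^ (1 / p)
      have hlam0 : 0 ≤ lam := Real.rpow_nonneg (hℓ τ hτ) _
      have hlamp : lam ^ (p - 1) * lam = ℓ τ := by
        rw [← Real.rpow_add_one' hlam0 (by simpa using hp0.ne'), sub_add_cancel,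
          ← Real.rpow_mul (hℓ τ hτ), one_div_mul_cancel hp0.ne', Real.rpow_one]
      have habs : absLap m (testFun K.direction x₀ c σ h hδ) x ≤
          Real.exp ((σ - m) * ρ) * (a * φ + e₀ * lam * Real.exp ρ) := by
        have := absLap_radial_mul_le hh (contDiff_tangentCut K.direction x₀ hδ)
          (constAlong_tangentCut K.direction x₀ hδ) c σ m hP hρ0
          (fun i hi => (hG i hi τ hτ).1) (fun i hi => (hG i hi τ hτ).2)
          (fun l hl => (hM l hl x).1) (fun l hl => (hM l hl x).2)
        refine this.trans (le_of_eq ?_)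
        rw [abs_of_nonneg (tangentCut_nonneg _ _ _ _), he₀, tangentCut]
        ring
      have he0 : 0 ≤ e₀ * lam * Real.exp ρ := by positivity
      have hexp : Real.exp ρ ≤ 1 := Real.exp_le_one_iff.2 hρ0
      have hsum : a * φ + e₀ * lam * Real.exp ρ ≤ (G + e₀) * lam := by
        have h1 : a * φ ≤ G * lam * 1 := by gcongr
        have h2 : e₀ * lam * Real.exp ρ ≤ e₀ * lam * 1 := by gcongr
        linarith
      have he : Real.exp ρ = Real.exp c * Real.exp (-τ) := by
        rw [← Real.exp_add, hτdef]; congr 1; ring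
      calc Real.exp (-γ * ρ) * absLap m (testFun K.direction x₀ c σ h hδ) x ^ p
          ≤ Real.exp (-γ * ρ) *
            (Real.exp ((σ - m) * ρ) * (a * φ + e₀ * lam * Real.exp ρ)) ^ p := by
            have := absLap_nonneg m (testFun K.direction x₀ c σ h hδ) x
            gcongr
        _ = Real.exp (-k * ρ) * (a * φ + e₀ * lam * Real.exp ρ) ^ p := by
            rw [Real.mul_rpow (Real.exp_pos _).le (by positivity), ← Real.exp_mul, ← mul_assoc,
              ← Real.exp_add]
            congr 2
            linear_combination ρ * hσp
        _ ≤ Real.exp (-k * ρ) * ((a * φ) ^ p + p * (e₀ * lam * Real.exp ρ) *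
            ((G + e₀) * lam) ^ (p - 1)) := by
            gcongr
            refine (add_rpow_le hp.le (by positivity) he0).trans ?_
            gcongr
        _ = _ := by
            rw [Real.mul_rpow ha0 hφ0, Real.mul_rpow (by positivity) hlam0, he, hC₃, ← hlamp]
            ring
    · rw [hz x hx]
      have b1 := hF₁0 (c - logDist K.directionᗮ x₀ x)
      have b2 := hF₂0 (c - logDist K.directionᗮ x₀ x)
      have b3 : 0 ≤ tangentBump K.direction hδ (K.direction.orthogonalProjectionOnto (x - x₀)) :=
        ContDiffBump.nonneg _
      have b4 : 0 ≤ (Metric.closedBall (0 : K.direction) (2 * δ)).indicator (1 : K.direction → ℝ)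
          (K.direction.orthogonalProjectionOnto (x - x₀)) :=
        indicator_nonneg (fun _ _ => zero_le_one) _
      positivity
  have i1 := integrable_normal_mul_tangential K.direction x₀ c iF₁ iβ₁
  have i2 := integrable_normal_mul_tangential K.direction x₀ c iF₂ iβ₂
  refine (integral_mono_of_nonneg (Eventually.of_forall fun x => mul_nonneg
    (Real.rpow_nonneg Metric.infDist_nonneg _) (Real.rpow_nonneg (absLap_nonneg _ _ _) _))
    (i1.add i2) (Eventually.of_forall hbound)).trans (le_of_eq ?_)
  rw [integral_add' i1 i2,
    integral_normal_mul_tangential K.direction x₀ c F₁ (fun v => tangentBump K.direction hδ v ^ p),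
    integral_normal_mul_tangential K.direction x₀ c F₂, hF₁, hF₂,
    integral_indicator measurableSet_Icc, integral_indicator measurableSet_Icc, integral_const_mul,
    sliceMass, sliceMass]
  ring

end TestIntegrals

/-! ### Assembly of the optimality statement. -/

section Optimality

open Filter Topology Set

variable {N : ℕ} {K : AffineSubspace ℝ (EuclideanSpace ℝ (Fin N))}
  {x₀ : EuclideanSpace ℝ (Fin N)}

theorem sliceMass_tangentBump_pos (V : Submodule ℝ (EuclideanSpace ℝ (Fin N))) [Nontrivial Vᗮ]
    {δ : ℝ} (hδ : 0 < δ) {p : ℝ} (hp : 0 < p) :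
    0 < sliceMass V (fun v => tangentBump V hδ v ^ p) := by
  have h1 : (0 : ℝ) < Module.finrank ℝ Vᗮ := by exact_mod_cast Module.finrank_pos
  have h2 : 0 < (volume : Measure Vᗮ).real (Metric.ball 0 1) :=
    ENNReal.toReal_pos (Metric.measure_ball_pos _ _ one_pos).ne' measure_ball_lt_top.ne
  refine mul_pos (mul_pos h1 h2) ?_
  have hc : Continuous fun v => tangentBump V hδ v ^ p :=
    (tangentBump V hδ).continuous.rpow_const fun _ => Or.inr hp.le
  refine hc.integral_pos_of_hasCompactSupport_nonneg_nonzero (x := 0)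
    ((tangentBump V hδ).hasCompactSupport.comp_left (g := fun s : ℝ => s ^ p)
      (Real.zero_rpow hp.ne')) (fun v => Real.rpow_nonneg (ContDiffBump.nonneg _) _) ?_
  have h3 : tangentBump V hδ (0 : V) = 1 :=
    ContDiffBump.one_of_mem_closedBall _ (Metric.mem_closedBall_self hδ.le)
  rw [h3, Real.one_rpow]
  exact one_ne_zero

theorem sliceMass_nonneg (V : Submodule ℝ (EuclideanSpace ℝ (Fin N))) {β : V → ℝ}
    (hβ : ∀ v, 0 ≤ β v) : 0 ≤ sliceMass V β :=
  mul_nonneg (mul_nonneg (Nat.cast_nonneg _) measureReal_nonneg) (integral_nonneg hβ)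

theorem sum_Icc_one (f : ℕ → ℝ) (r : ℕ) :
    ∑ i ∈ Finset.Icc 1 r, f i = ∑ i ∈ Finset.range r, f (i + 1) := by
  induction r with
  | zero => simp
  | succ r ih => rw [Finset.sum_Icc_succ_top (by omega), ih, Finset.sum_range_succ]

theorem exists_pos_dist (hx₀ : x₀ ∈ K) [Nontrivial K.directionᗮ]
    {Ω : Set (EuclideanSpace ℝ (Fin N))} (hΩ : IsOpen Ω) (hx₀Ω : x₀ ∈ Ω) :
    ∃ x ∈ Ω, 0 < dist K x := by
  obtain ⟨w, hw⟩ := exists_ne (0 : K.directionᗮ)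
  have hw' : (w : EuclideanSpace ℝ (Fin N)) ≠ 0 := by simpa using hw
  have hc : ContinuousAt (fun t : ℝ => x₀ + t • (w : EuclideanSpace ℝ (Fin N))) 0 := by fun_prop
  have hm : ∀ᶠ t : ℝ in 𝓝 0, x₀ + t • (w : EuclideanSpace ℝ (Fin N)) ∈ Ω :=
    hc.eventually (hΩ.mem_nhds (by simpa using hx₀Ω))
  obtain ⟨t, ht, ht0⟩ := ((hm.filter_mono nhdsWithin_le_nhds).and
    (self_mem_nhdsWithin : Ioi (0 : ℝ) ∈ 𝓝[>] 0)).exists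
  refine ⟨_, ht, ?_⟩
  rw [dist_eq_norm_starProjection hx₀, add_sub_cancel_left,
    Submodule.starProjection_eq_self_iff.2 (Submodule.smul_mem _ _ w.2), norm_pos_iff]
  exact smul_ne_zero (ne_of_gt ht0) hw'

theorem integral_sqWeight_mul_density (r : ℕ) {ν R : ℝ} (hν : 1 ≤ ν) (hR : 1 ≤ R) :
    ∫ τ in window r R, sqWeight r τ * density r ν R τ =
      ∑ i ∈ Finset.range (r + 1), ∫ τ in window r R, logWeight i τ ^ 2 * density r ν R τ := by
  have hS := one_le_of_mem_window (r := r) hR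
  simp only [sqWeight, Finset.sum_mul]
  exact integral_finsetSum _ fun i _ => integrableOn_window
    (((continuousOn_logWeight hS i).pow 2).mul (continuousOn_density hS r hν R))

theorem optimality_of_improvedRellichIneq {k m r : ℕ} {p γ D θ C : ℝ}
    {Ω : Set (EuclideanSpace ℝ (Fin N))} (hΩ : IsOpen Ω) (hk : 1 ≤ k)
    (hK : Module.finrank ℝ K.direction + k = N)
    (hKΩ : ((K : Set (EuclideanSpace ℝ (Fin N))) ∩ Ω).Nonempty) (hm : 1 ≤ m) (hp : 1 < p)
    (hA' : ∀ i : ℕ, i ≤ (m - 1) / 2 → factorA' p γ k m i ≠ 0)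
    (hA'' : ∀ j : ℕ, 1 ≤ j → j ≤ m / 2 → factorA'' p γ k m j ≠ 0)
    (hD : ∀ x ∈ Ω, dist K x ≤ D) (hC : 0 < C)
    (hineq : ∀ u : EuclideanSpace ℝ (Fin N) → ℝ,
      IsTest (Ω \ (K : Set (EuclideanSpace ℝ (Fin N)))) u →
        ImprovedRellichIneq Ω K k m (r + 1) p γ D θ C u) :
    2 ≤ θ ∧ (θ = 2 → C ≤ absB p γ k m) := by
  obtain ⟨x₀, hx₀, hx₀Ω⟩ := hKΩ
  obtain rfl : k = Module.finrank ℝ K.directionᗮ := by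
    have := K.direction.finrank_add_finrank_orthogonal
    rw [finrank_euclideanSpace_fin] at this
    omega
  have : Nontrivial K.directionᗮ := Module.nontrivial_of_finrank_pos (R := ℝ) hk
  have hD0 : 0 < D := by
    obtain ⟨x, hx, hx0⟩ := exists_pos_dist hx₀ hΩ hx₀Ω
    exact hx0.trans_le (hD x hx)
  obtain ⟨ε, hε, hball⟩ := Metric.isOpen_iff.1 hΩ x₀ hx₀Ω
  obtain ⟨δ, hδ, hδε⟩ : ∃ δ : ℝ, 0 < δ ∧ 3 * δ < ε := ⟨ε / 4, by linarith, by linarith⟩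
  have hcl : Metric.closedBall x₀ (3 * δ) ⊆ Ω :=
    (Metric.closedBall_subset_ball hδε).trans hball
  set k := Module.finrank ℝ K.directionᗮ with hkdef
  set σ := critExp p γ k m with hσ
  have hp0 : 0 < p := by linarith
  -- q is a natural number with q ≥ p and q ≥ 3, as the Taylor remainder requires; n = (m+3)q is
  -- then the power of the cutoff that absorbs all losses.
  set q := ⌈p⌉₊ + 3 with hq
  have hpq : p ≤ q := (Nat.le_ceil p).trans (by exact_mod_cast Nat.le_add_right _ _)
  obtain ⟨n, hn⟩ : ∃ n, n = (m + 3) * q := ⟨_, rfl⟩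
  have hlen : (lapFactors σ k m).length = m := length_lapFactors _ _
  have hn2 : 2 * m + 1 ≤ n := by rw [hn, hq]; nlinarith [Nat.zero_le ⌈p⌉₊, Nat.zero_le m]
  have hn0 : n ≠ 0 := by omega
  have hν : (1 : ℝ) ≤ n * p := by
    have : (1 : ℝ) ≤ n := by exact_mod_cast Nat.one_le_iff_ne_zero.2 hn0
    nlinarith
  obtain ⟨C₄, hC₄, hlist⟩ := exists_integral_listOp_rpow_le hp
    (ne_zero_of_mem_lapFactors γ k m hp0.ne' hm hA' hA'') r (n := n) hpq (by omega) (by rw [hlen, hn])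
  rw [← absA_eq γ k m hp0.ne' hm, ← absB_eq γ k m hp0.ne' hm] at hlist
  obtain ⟨G, hG0, hG⟩ := exists_bound_evenOp_profile p σ r k m n hn2
  obtain ⟨M, hM0, hM⟩ := exists_bound_tangentCut K.direction x₀ hδ m
  set c := 1 + Real.log D with hc
  set M₁ := sliceMass K.direction (fun v => tangentBump K.direction hδ v ^ p) with hM₁
  have hM₁0 : 0 < M₁ := sliceMass_tangentBump_pos K.direction hδ hp0
  set M₂ := sliceMass K.direction ((Metric.closedBall 0 (2 * δ)).indicator 1) *
      (p * (2 * 2 ^ m * G * M) * (G + 2 * 2 ^ m * G * M) ^ (p - 1) * Real.exp c) with hM₂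
  have hM₂0 : 0 ≤ M₂ := mul_nonneg
    (sliceMass_nonneg _ fun v => indicator_nonneg (fun _ _ => zero_le_one) _) (by positivity)
  -- The two lower bounds on R give c < T₁, hence d ≤ 1 on the support, and e^{c-T₁} ≤ δ, hence
  -- support inside Ω. The quotient M₂/M₁ appears because the inequality is divided by the mass M₁
  -- of the main terms.
  refine sharpness_of_integral_inequality (R₀ := max (c + 1) (c - Real.log δ)) (K := C₄ + M₂ / M₁)
    (r := r) (ν := n * p) hC (by positivity) hν fun R hR hR1 => ?_
  have hS := one_le_of_mem_window (r := r) hR1.le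
  have hRT : R ≤ iterExp (r + 1) R := le_iterExp _ _
  have hcT : c < iterExp (r + 1) R := by linarith [(le_max_left _ _).trans hR]
  have hδT : Real.exp (c - iterExp (r + 1) R) ≤ δ := by
    rw [← Real.le_log_iff_exp_le hδ]
    linarith [(le_max_right _ _).trans hR]
  have h0 : ∀ τ ∉ window r R, profile p r n R τ = 0 := fun τ hτ =>
    profile_eq_zero hn0 hR1.le hτ
  have hcd := contDiff_profile (p := p) (r := r) hn0 hR1
  have hsub := shell_subset_diff (T₂ := iterExp (r + 1) (4 * R)) x₀ hx₀ hcl hδT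
  have hsubΩ := hsub.trans sdiff_subset
  have hmain := hineq _ (isTest_testFun K.direction x₀ σ hδ hcT h0 hcd hsub)
  have hτ1 : ∀ τ ∈ window r R, 1 < τ := fun τ hτ => hR1.trans_le (le_of_mem_window hτ)
  have hterm : ∀ w w' : ℝ → ℝ, (∀ τ, w (Real.exp (c - τ)) = w' τ) →
      ∫ x in Ω, dist K x ^ (-γ - (m : ℝ) * p) * w (dist K x) *
        |testFun K.direction x₀ c σ (profile p r n R) hδ x| ^ p =
      M₁ * ∫ τ in window r R, w' τ * density r (n * p) R τ := fun w w' hw => by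
    rw [hσ, integral_weight_testFun hx₀ hp0 hδ hcT (profile_nonneg p r n R) h0 hsubΩ w]
    congr 1
    refine setIntegral_congr_fun (measurableSet_window r R) fun τ hτ => ?_
    simp only [hw, profile_rpow_eq_density hp0 r n R (hτ1 τ hτ)]
  have hlog : ∀ τ, 1 - Real.log (Real.exp (c - τ) / D) = τ := fun τ => by
    rw [Real.log_div (Real.exp_pos _).ne' hD0.ne', Real.log_exp, hc]; ring
  have e0 := hterm (fun _ => 1) (fun _ => 1) fun _ => rfl
  simp only [mul_one, one_mul] at e0
  have e1 : ∀ i, _ := fun i => hterm (fun t => ∏ j ∈ Finset.Icc 1 i, X j (t / D) ^ 2)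
    (fun τ => (logProd i τ ^ 2)⁻¹) fun τ => by rw [prod_X_sq, hlog]
  have e2 := hterm (fun t => (∏ j ∈ Finset.Icc 1 r, X j (t / D) ^ 2) * X (r + 1) (t / D) ^ θ)
    (fun τ => (logProd r τ ^ 2)⁻¹ * (iterLog r τ)⁻¹ ^ θ) fun τ => by
      rw [prod_X_sq, X_succ_eq, hlog]
  have hθ : ∫ τ in window r R, (logProd r τ ^ 2)⁻¹ * (iterLog r τ)⁻¹ ^ θ * density r (n * p) R τ =
      ∫ τ in window r R, (logProd r τ ^ 2)⁻¹ * iterLog r τ ^ (-θ) * density r (n * p) R τ :=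
    setIntegral_congr_fun (measurableSet_window r R) fun τ hτ => by
      simp only [Real.inv_rpow (iterLog_pos r (hS τ hτ)).le,
        Real.rpow_neg (iterLog_pos r (hS τ hτ)).le]
  have hright := integral_absLap_testFun_le hx₀ hp hδ hcT hcd h0 hsubΩ hG0 hM0
    (ℓ := logProd (r + 1)) (γ := γ) (m := m) (fun τ hτ => (logProd_pos _ (hS τ hτ)).le)
    (continuousOn_logProd hS (r + 1)) (fun i hi τ hτ => hG i hi R hR1.le τ (hτ1 τ hτ))
    fun l hl x => ⟨(hM l hl x).1, (hM l hl x).2.1⟩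
  change _ ≤ M₁ * (∫ τ in window r R, |lapOp σ k m (profile p r n R) τ| ^ p) +
    M₂ * ∫ τ in window r R, Real.exp (-τ) * logProd (r + 1) τ at hright
  have hl := hlist R hR1
  rw [integral_sqWeight_mul_density r hν hR1.le, Finset.sum_range_succ, ← lapOp_eq_listOp] at hl
  have hexpc : ContinuousOn (fun τ : ℝ => Real.exp (-τ) * logProd (r + 1) τ) (window r R) :=
    (Real.continuous_exp.comp continuous_neg).continuousOn.mul (continuousOn_logProd hS (r + 1))
  have hE0 : 0 ≤ ∫ τ in window r R, errorTerm r R τ :=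
    setIntegral_nonneg (measurableSet_window r R) fun τ hτ => by
      have := logProd_pos (r + 1) (hS τ hτ)
      have := hτ1 τ hτ
      unfold errorTerm
      positivity
  have hX0 : 0 ≤ ∫ τ in window r R, Real.exp (-τ) * logProd (r + 1) τ :=
    setIntegral_nonneg (measurableSet_window r R) fun τ hτ =>
      mul_nonneg (Real.exp_pos _).le (logProd_pos (r + 1) (hS τ hτ)).le
  rw [integral_add (integrableOn_window (continuousOn_errorTerm hS r R))
    (integrableOn_window hexpc)]
  simp only [ImprovedRellichIneq, Nat.add_sub_cancel, e0, e1, sum_Icc_one, ← mul_assoc] at hmain e2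
  rw [e2, hθ] at hmain
  simp only [← Finset.mul_sum] at hmain
  have hfin := hmain.trans (hright.trans (add_le_add_left (mul_le_mul_of_nonneg_left hl hM₁0.le) _))
  simp only [logWeight, inv_pow] at hfin ⊢
  -- Multiplying by M₁ restores the spatial inequality. The single constant multiplies both error
  -- integrals, and the two superfluous products are nonnegative.
  refine le_of_mul_le_mul_left (a := M₁) ?_ hM₁0
  have hc1 : M₁ * (M₂ / M₁) = M₂ := mul_div_cancel₀ _ hM₁0.ne'
  have hc2 := mul_nonneg hM₂0 hE0
  have hc3 := mul_nonneg hM₁0.le (mul_nonneg hC₄ hX0)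
  rw [mul_add M₁, ← mul_assoc M₁ (C₄ + _), mul_add M₁ C₄, hc1]
  linarith

end Optimality

end Rellich

theorem theorem2 {N : ℕ} (k m r : ℕ) (p γ D θ C : ℝ)
    (Ω : Set (EuclideanSpace ℝ (Fin N)))
    (K : AffineSubspace ℝ (EuclideanSpace ℝ (Fin N)))
    (hΩ : IsOpen Ω)
    (hk : 1 ≤ k)
    (hK : Module.finrank ℝ K.direction + k = N)
    (hKΩ : ((K : Set (EuclideanSpace ℝ (Fin N))) ∩ Ω).Nonempty)
    (hm : 1 ≤ m) (hp : 1 < p)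
    (hA' : ∀ i : ℕ, i ≤ (m - 1) / 2 → Rellich.factorA' p γ k m i ≠ 0)
    (hA'' : ∀ j : ℕ, 1 ≤ j → j ≤ m / 2 → Rellich.factorA'' p γ k m j ≠ 0)
    (hD : ∀ x ∈ Ω, Rellich.dist K x ≤ D)
    (hr : 1 ≤ r) (hC : 0 < C)
    (hineq : ∀ u : EuclideanSpace ℝ (Fin N) → ℝ,
      Rellich.IsTest (Ω \ (K : Set (EuclideanSpace ℝ (Fin N)))) u →
        Rellich.ImprovedRellichIneq Ω K k m r p γ D θ C u) :
    2 ≤ θ ∧ (θ = 2 → C ≤ Rellich.absB p γ k m) := by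
  -- The shift by one matches the indexing: the last function X_{r+1} is the reciprocal of L_r.
  obtain ⟨r, rfl⟩ := Nat.exists_eq_add_of_le' hr
  exact Rellich.optimality_of_improvedRellichIneq hΩ hk hK hKΩ hm hp hA' hA'' hD hC hineq
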